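/- **Conventions.** A *region* is a finite non-empty union $\Gamma\subset\mathbb R^2$ of closed unit squares of the lattice $\mathbb Z^2$ with connected interior; it is *simply connected* if it has no holes, i.e. if its complement in the plane is connected. An *(ordinary) tile* is a simply connected region, considered up to translation; a *tileset* is a finite set of tiles. A region is tileable by a tileset $\mathbf T$ if it is the union of finitely many translated copies of tiles of $\mathbf T$ with pairwise disjoint interiors. A *generalized Wang tile* over a finite set $C$ of colors is an ordinary tile with a color from $C$ on each unit edge of its boundary; an *(ordinary) Wang tile* is a generalized Wang tile whose underlying tile is a unit square. For these, the input region also carries a color from $C$ on each of its boundary edges, and it is tileable if it has a tiling by translated copies in which incident edges of copies have the same color and the edges on the boundary of the region have the prescribed colors. A *set of relational Wang tiles* is a finite set $\mathbf W$ with two binary relations $H,V$ on $\mathbf W$; the input is a region $\Gamma$ with a boundary tile from $\mathbf W$ assigned to each boundary edge, and it is tileable if there is a map from the unit squares of $\Gamma$ to $\mathbf W$ such that $H(\tau,\tau')$ holds whenever $\tau'$ is immediately to the right of $\tau$ and $V(\tau,\tau')$ holds whenever $\tau'$ is immediately below $\tau$, where across each boundary edge the assigned boundary tile is regarded as the neighbor.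 Each kind of tiles gives a class of decision problems, one for each fixed finite tileset (with its finite set of colors): given a simply connected region (with labels on its boundary edges, where applicable), is it tileable? The input is a list of the unit squares of the region by their coordinates, in any order, each with the labels of its boundary edges where applicable. A class $\mathcal A$ is *linear time reducible* to a class $\mathcal B$ if for every tileset $\mathbf T$ of $\mathcal A$ there are a tileset $\mathbf T'$ of $\mathcal B$ and a map $f$ from the inputs for $\mathbf T$ to the inputs for $\mathbf T'$ such that $\Gamma$ is $\mathbf T$-tileable if and only if $f(\Gamma)$ is $\mathbf T'$-tileable, and $f$ is computable by a random access machine (unit cost; integer addition, subtraction, comparison with zero, indirect addressing) in time $O(\text{number of unit squares of }\Gamma)$. Two classes are *linear time equivalent* if each is linear time reducible to the other. **Lemma (Tileability Equivalence Lemma).** The following five classes of tileability problems for simply connected regions are pairwise linear time equivalent: 1. tileability with a fixed finite set of rectangular tiles; 2. tileability with a fixed finite set of ordinary tiles; 3. tileability with a fixed finite set of generalized Wang tiles; 4. tileability with a fixed finite set of ordinary Wang tiles; 5. tileability with a fixed finite set of relational Wang tiles. Moreover, in the reductions from (2) to (3) and from (3) to (2) the tileset $\mathbf T'$ can be chosen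 with exactly as many tiles as $\mathbf T$. -/

import Mathlib

namespace Tileability

/-! ### Regions of the square lattice -/

/-- A closed unit square of the lattice, named by its lower left corner. -/
abbrev Cell : Type := ℤ × ℤ

/-- The four sides of a unit square. -/
inductive Dir
  | right
  | up
  | left
  | down
  deriving DecidableEq

/-- The displacement from a cell to its neighbour across the given side. -/
def Dir.vec : Dir → Cell
  | .right => (1, 0)
  | .up => (0, 1)
  | .left => (-1, 0)
  | .down => (0, -1)

def Dir.opp : Dir → Dir
  | .right => .left
  | .up => .down
  | .left => .right
  | .down => .up

theorem Dir.vec_opp (d : Dir) : d.opp.vec = -d.vec := by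
  cases d <;> rfl

theorem Dir.vec_ne_zero (d : Dir) : d.vec ≠ 0 := by
  cases d <;> simp [Dir.vec]

/-- Two cells are adjacent when they share a unit edge. -/
def grid : SimpleGraph Cell where
  Adj p q := ∃ d : Dir, q = p + d.vec
  symm := ⟨fun p q ⟨d, h⟩ => ⟨d.opp, by rw [h, Dir.vec_opp]; abel⟩⟩
  loopless := ⟨fun p ⟨d, h⟩ => d.vec_ne_zero (by simpa using h)⟩

/-- A simply connected region: a finite union of closed unit squares, given by the set of its
cells. The interior of the union is connected: any two cells are joined by a chain of cells in
which consecutive ones share an edge. The union has no holes: its complement in the plane, an open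
set, is connected, that is, any two cells outside are joined by such a chain of cells outside. -/
structure Region where
  cells : Finset Cell
  connected : (grid.induce (cells : Set Cell)).Connected
  noHoles : (grid.induce ((cells : Set Cell)ᶜ)).Connected

/-- The unit edges on the boundary of a set of cells. A boundary edge is a side of exactly one cell
of the set, so it is named by that cell and the side. -/
abbrev BoundaryEdge (S : Finset Cell) : Type :=
  {e : Cell × Dir // e.1 ∈ S ∧ e.1 + e.2.vec ∉ S}

/-- A simply connected region with a label from `C` on each boundary edge. -/
structure LabelledRegion (C : Type) extends Region where
  label : BoundaryEdge cells → C

/-- Normal position: the bounding box has its lower left corner at the origin. -/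
def InNormalPosition (S : Finset Cell) : Prop :=
  (∀ p ∈ S, 0 ≤ p.1 ∧ 0 ≤ p.2) ∧ (∃ p ∈ S, p.1 = 0) ∧ (∃ p ∈ S, p.2 = 0)

/-- An ordinary tile. Tiles are used up to translation, so each is represented by its unique
translate in normal position; in particular distinct tiles are not translates of each other. -/
structure Tile extends Region where
  normal : InNormalPosition cells

/-- A generalized Wang tile over the set of colours `C`: an ordinary tile with a colour on each
boundary edge. -/
structure WangTile (C : Type) extends LabelledRegion C where
  normal : InNormalPosition cells

/-- A rectangle in normal position. -/
def IsRectangle (S : Finset Cell) : Prop :=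
  ∃ a b : ℕ, S = Finset.Ico (0 : ℤ) a ×ˢ Finset.Ico (0 : ℤ) b

/-! ### Tilings -/

/-- `P` is a finite set of placements: `(t, v)` stands for the copy of `t` translated by `v`.
The copies lie in `S`, and each cell of `S` is covered by exactly one of them. -/
def IsTiling {τ : Type} (shape : τ → Finset Cell) (S : Finset Cell) (P : Finset (τ × Cell)) :
    Prop :=
  (∀ a ∈ P, ∀ p ∈ shape a.1, p + a.2 ∈ S) ∧
    ∀ p ∈ S, ∃! a : τ × Cell, a ∈ P ∧ p - a.2 ∈ shape a.1

/-- Tileability by translates of ordinary tiles. -/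
def Tileable (T : Finset Tile) (G : Region) : Prop :=
  ∃ P : Finset (Tile × Cell), (∀ a ∈ P, a.1 ∈ T) ∧ IsTiling (fun t : Tile => t.cells) G.cells P

/-- Wang tileability of a region with a coloured boundary by translates of generalized Wang tiles:
a tiling in which incident edges of the copies have the same colour, and each edge of a copy that
lies on the boundary of the region has the colour specified there. -/
def WangTileable {C : Type} (T : Finset (WangTile C)) (G : LabelledRegion C) : Prop :=
  ∃ P : Finset (WangTile C × Cell), (∀ a ∈ P, a.1 ∈ T) ∧
    IsTiling (fun t : WangTile C => t.cells) G.cells P ∧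
    (∀ a ∈ P, ∀ b ∈ P, ∀ (e : BoundaryEdge a.1.cells) (e' : BoundaryEdge b.1.cells),
      e'.1.1 + b.2 = e.1.1 + a.2 + e.1.2.vec → e'.1.2 = e.1.2.opp →
        a.1.label e = b.1.label e') ∧
    (∀ a ∈ P, ∀ (e : BoundaryEdge a.1.cells) (g : BoundaryEdge G.cells),
      g.1.1 = e.1.1 + a.2 → g.1.2 = e.1.2 → a.1.label e = G.label g)

/-- A finite set of relational Wang tiles. `H t t'` says that `t'` may be placed immediately to the
right of `t`, and `V t t'` that `t'` may be placed immediately below `t`. -/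
structure RelWangSet where
  n : ℕ
  H : Fin n → Fin n → Prop
  V : Fin n → Fin n → Prop

/-- Whether `t'` may stand across the side `d` of `t`. -/
def RelWangSet.Allowed (W : RelWangSet) (d : Dir) (t t' : Fin W.n) : Prop :=
  match d with
  | .right => W.H t t'
  | .left => W.H t' t
  | .down => W.V t t'
  | .up => W.V t' t

/-- Tileability of a region with boundary tiles by a set of relational Wang tiles. -/
def RelWangTileable (W : RelWangSet) (G : LabelledRegion (Fin W.n)) : Prop :=
  ∃ φ : {p : Cell // p ∈ G.cells} → Fin W.n,
    (∀ (p q : {p : Cell // p ∈ G.cells}) (d : Dir),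
      q.1 = p.1 + d.vec → W.Allowed d (φ p) (φ q)) ∧
    ∀ e : BoundaryEdge G.cells, W.Allowed e.1.2 (φ ⟨e.1.1, e.2.1⟩) (G.label e)

/-! ### Random access machines with uniform cost -/

/-- Programs of a random access machine with integer registers and a random access memory of
integers; the only arithmetic is addition and subtraction. -/
inductive Program
  /-- `reg r := k` -/
  | const (r : ℕ) (k : ℤ)
  /-- `reg r := reg a + reg b` -/
  | add (r a b : ℕ)
  /-- `reg r := reg a - reg b` -/
  | sub (r a b : ℕ)
  /-- `reg r := mem (reg a)` -/
  | load (r a : ℕ)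
  /-- `mem (reg a) := reg b` -/
  | store (a b : ℕ)
  /-- append `reg r` to the output -/
  | print (r : ℕ)
  /-- sequential composition -/
  | seq (p q : Program)
  /-- `if reg r > 0 then p else q` -/
  | ite (r : ℕ) (p q : Program)
  /-- `while reg r > 0 do p` -/
  | loop (r : ℕ) (p : Program)

structure State where
  reg : ℕ → ℤ
  mem : ℤ → ℤ
  out : List ℤ

/-- `Run p s t s'`: started in `s`, the program `p` halts in `s'` after `t` steps. Each elementary
instruction and each evaluation of a test is one step. -/
inductive Run : Program → State → ℕ → State → Prop
  | const (r k s) : Run (.const r k) s 1 { s with reg := Function.update s.reg r k }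
  | add (r a b s) :
      Run (.add r a b) s 1 { s with reg := Function.update s.reg r (s.reg a + s.reg b) }
  | sub (r a b s) :
      Run (.sub r a b) s 1 { s with reg := Function.update s.reg r (s.reg a - s.reg b) }
  | load (r a s) :
      Run (.load r a) s 1 { s with reg := Function.update s.reg r (s.mem (s.reg a)) }
  | store (a b s) :
      Run (.store a b) s 1 { s with mem := Function.update s.mem (s.reg a) (s.reg b) }
  | print (r s) : Run (.print r) s 1 { s with out := s.out ++ [s.reg r] }
  | seq {p q s s' s'' t t'} : Run p s t s' → Run q s' t' s'' → Run (.seq p q) s (t + t') s''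
  | ite_pos {r p q s t s'} : 0 < s.reg r → Run p s t s' → Run (.ite r p q) s (t + 1) s'
  | ite_neg {r p q s t s'} : ¬ 0 < s.reg r → Run q s t s' → Run (.ite r p q) s (t + 1) s'
  | loop_done {r p s} : ¬ 0 < s.reg r → Run (.loop r p) s 1 s
  | loop_step {r p s s' s'' t t'} : 0 < s.reg r → Run p s t s' → Run (.loop r p) s' t' s'' →
      Run (.loop r p) s (t + t' + 1) s''

/-- The initial state on input `l`: register `0` holds the length of `l`, the entries of `l` stand
in the memory at the addresses `0, 1, …`, and everything else is `0`. -/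
def State.init (l : List ℤ) : State where
  reg r := if r = 0 then l.length else 0
  mem a := if 0 ≤ a then l.getD a.toNat 0 else 0
  out := []

/-! ### Decision problems and reductions -/

/-- A decision problem: its instances, their sizes, the lists of integers that describe an
instance, and the instances with answer "yes". -/
structure Problem where
  Inst : Type
  size : Inst → ℕ
  Describes : List ℤ → Inst → Prop
  Yes : Inst → Prop

/-- The map `f` between the instances is computable in linear time: one program, from every
description of an instance `G`, produces some description of `f G` in at most `c * size G`
steps. -/
def LinearTimeComputable (A B : Problem) (f : A.Inst → B.Inst) : Prop :=
  ∃ (prog : Program) (c : ℕ), ∀ (G : A.Inst) (l : List ℤ), A.Describes l G →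
    ∃ (t : ℕ) (s : State), Run prog (State.init l) t s ∧ t ≤ c * A.size G ∧
      B.Describes s.out (f G)

/-- `f` is a linear time reduction map from the problem `A` to the problem `B`. -/
def IsLinearTimeReduction (A B : Problem) (f : A.Inst → B.Inst) : Prop :=
  LinearTimeComputable A B f ∧ ∀ G : A.Inst, A.Yes G ↔ B.Yes (f G)

/-- A class of tileability problems, one problem for each fixed finite tileset. -/
structure TileabilityClass where
  Tileset : Type
  card : Tileset → ℕ
  problem : Tileset → Problem

def LinearTimeReducible (A B : TileabilityClass) : Prop :=
  ∀ T : A.Tileset, ∃ (T' : B.Tileset) (f : (A.problem T).Inst → (B.problem T').Inst),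
    IsLinearTimeReduction (A.problem T) (B.problem T') f

/-- Linear time reducible with a tileset of the same size. -/
def LinearTimeReducibleSameCard (A B : TileabilityClass) : Prop :=
  ∀ T : A.Tileset, ∃ (T' : B.Tileset) (f : (A.problem T).Inst → (B.problem T').Inst),
    B.card T' = A.card T ∧ IsLinearTimeReduction (A.problem T) (B.problem T') f

def LinearTimeEquivalent (A B : TileabilityClass) : Prop :=
  LinearTimeReducible A B ∧ LinearTimeReducible B A

/-! ### The five classes -/

/-- A region is described by listing the coordinates of its cells, each cell once, in any order. -/
def Region.Describes (l : List ℤ) (G : Region) : Prop :=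
  ∃ L : List Cell, L.Nodup ∧ (∀ p, p ∈ L ↔ p ∈ G.cells) ∧ l = L.flatMap fun p => [p.1, p.2]

/-- The code of the side `d` of the cell `p`: the label plus one if it is a boundary edge of the
region, and `0` if not. -/
def LabelledRegion.sideCode {c : ℕ} (G : LabelledRegion (Fin c)) (p : Cell) (d : Dir) : ℤ :=
  if h : p ∈ G.cells ∧ p + d.vec ∉ G.cells then ((G.label ⟨(p, d), h⟩ : ℕ) : ℤ) + 1 else 0

/-- A labelled region is described by listing its cells, each once, in any order, a cell by its
coordinates and the codes of its four sides. -/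
def LabelledRegion.Describes {c : ℕ} (l : List ℤ) (G : LabelledRegion (Fin c)) : Prop :=
  ∃ L : List Cell, L.Nodup ∧ (∀ p, p ∈ L ↔ p ∈ G.cells) ∧
    l = L.flatMap fun p =>
      [p.1, p.2, G.sideCode p .right, G.sideCode p .up, G.sideCode p .left, G.sideCode p .down]

def tileProblem (T : Finset Tile) : Problem where
  Inst := Region
  size G := G.cells.card
  Describes := Region.Describes
  Yes := Tileable T

def wangProblem {c : ℕ} (T : Finset (WangTile (Fin c))) : Problem where
  Inst := LabelledRegion (Fin c)
  size G := G.cells.card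
  Describes := LabelledRegion.Describes
  Yes := WangTileable T

def relWangProblem (W : RelWangSet) : Problem where
  Inst := LabelledRegion (Fin W.n)
  size G := G.cells.card
  Describes := LabelledRegion.Describes
  Yes := RelWangTileable W

/-- Tileability with a fixed finite set of rectangular tiles. -/
def rectangles : TileabilityClass where
  Tileset := {T : Finset Tile // ∀ t ∈ T, IsRectangle t.cells}
  card T := T.1.card
  problem T := tileProblem T.1

/-- Tileability with a fixed finite set of ordinary tiles. -/
def ordinaryTiles : TileabilityClass where
  Tileset := Finset Tile
  card T := T.card
  problem T := tileProblem T

/-- Tileability with a fixed finite set of generalized Wang tiles over a fixed finite set of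
colours. -/
def generalizedWangTiles : TileabilityClass where
  Tileset := Σ c : ℕ, Finset (WangTile (Fin c))
  card T := T.2.card
  problem T := wangProblem T.2

/-- Tileability with a fixed finite set of Wang tiles: the generalized ones of a unit square. -/
def ordinaryWangTiles : TileabilityClass where
  Tileset := Σ c : ℕ, {T : Finset (WangTile (Fin c)) // ∀ t ∈ T, t.cells = {(0, 0)}}
  card T := T.2.1.card
  problem T := wangProblem T.2.1

/-- Tileability with a fixed finite set of relational Wang tiles. -/
def relationalWangTiles : TileabilityClass where
  Tileset := RelWangSet
  card W := W.n
  problem W := relWangProblem W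

end Tileability

/-! The five classes are linked by the cycle rectangles → ordinary tiles → generalized Wang tiles →
ordinary Wang tiles → relational Wang tiles → rectangles. Reducibility is transitive: `compProg`
interleaves two programs in one machine, and the size of the intermediate instance is at most the
running time of the first program. The step from generalized Wang tiles straight to ordinary tiles
is added for the sake of the number of tiles.

Rectangles are ordinary tiles, and an ordinary tile is a generalized Wang tile over one colour. In
the latter step the work lies in the description: the boundary edges must be found in linear time.
By connectedness all coordinates lie within the number of cells of those of the first cell, so each
cell can be marked at an address of its own; the multiples of the row length are tabulated
beforehand. Generalized Wang tiles are cut into unit squares, with a private colour for every inner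
edge, which forces the squares of a tile to reassemble. Unit Wang tiles become relational ones by
adding a boundary tile for each colour and side.

For `jigsaw`, the lattice is scaled by `c + 4` and one small cell on every edge is handed over to
the left or lower side, at a position that encodes the colour. The jigsaw tiles of a tiling must be
aligned with the scaled lattice: a lowest, then leftmost, small cell in a misaligned copy leads to a
contradiction (`exists_jigsawPlace`). The positions on the two sides of an edge must agree, for
otherwise a small cell would be covered twice or covered outside the region.

The heart is the passage from relational Wang tiles to rectangles. The plane is tiled by bricks of
about `3 * u` by `4` and chips of about `2 * u` by `2` or `3`, one of each for every place `(a, b)`.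
A symbol at each place displaces a vertical wall by a small power of four. The width of a brick
shows the difference of the displacements at `(a - 1, b)` and `(a, b)`, that of a chip the
difference at `(a, b)` and `(a, b - 1)`; so bricks can enforce a horizontal relation of the symbols
and chips a vertical one. Conversely every tiling has this form (`BoxTiling.settled`), by induction
row by row: the floor of the next place has width about `5 * u` and can only be filled by a brick
followed by a chip, as the other order would start a disturbance that spreads to the right forever.
Equality of widths is then an equality between two sums of three powers of four, from which the
symbols are recovered (`BrickCode.decode`).

The shape of the region fixes the walls on its border, so boundary data must sit in symbols of their
own. Therefore each cell is divided into four: one place holds the tile, the places to its right and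
above it hold guesses of the next tiles, and the fourth is idle. A guess is compared with the tile
that it predicts; on the boundary it is replaced by the prescribed boundary tile (`IsGuess`). -/

namespace Tileability

/-! ### Connected sets of cells -/

/-- Two cells of `S` joined by a chain of adjacent cells of `S`. -/
def Joined (S : Set Cell) (p q : Cell) : Prop :=
  ∃ (hp : p ∈ S) (hq : q ∈ S), (grid.induce S).Reachable ⟨p, hp⟩ ⟨q, hq⟩

namespace Joined

variable {S S' : Set Cell} {p q r : Cell}

theorem refl (hp : p ∈ S) : Joined S p p := ⟨hp, hp, SimpleGraph.Reachable.refl _⟩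

theorem symm (h : Joined S p q) : Joined S q p :=
  let ⟨hp, hq, h⟩ := h
  ⟨hq, hp, h.symm⟩

theorem trans (h : Joined S p q) (h' : Joined S q r) : Joined S p r :=
  let ⟨hp, _, h⟩ := h
  let ⟨_, hr, h'⟩ := h'
  ⟨hp, hr, h.trans h'⟩

theorem of_adj (hp : p ∈ S) (hq : q ∈ S) (h : grid.Adj p q) : Joined S p q :=
  ⟨hp, hq, SimpleGraph.Adj.reachable (G := grid.induce S) (by simpa using h)⟩

theorem mono (hS : S ⊆ S') (h : Joined S p q) : Joined S' p q :=
  let ⟨hp, hq, h⟩ := h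
  ⟨hS hp, hS hq, h.map (SimpleGraph.induceHomOfLE _ hS).toHom⟩

end Joined

theorem connected_iff_joined {S : Set Cell} :
    (grid.induce S).Connected ↔ S.Nonempty ∧ ∀ p ∈ S, ∀ q ∈ S, Joined S p q := by
  constructor
  · intro h
    exact ⟨Set.nonempty_coe_sort.1 h.nonempty, fun p hp q hq => ⟨hp, hq, h.preconnected _ _⟩⟩
  · rintro ⟨⟨p, hp⟩, h⟩
    refine (SimpleGraph.connected_iff_exists_forall_reachable _).2 ⟨⟨p, hp⟩, fun q => ?_⟩
    obtain ⟨_, _, h'⟩ := h p hp q.1 q.2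
    exact h'

theorem adj_vec (p : Cell) (d : Dir) : grid.Adj p (p + d.vec) := ⟨d, rfl⟩

theorem adj_right (x y : ℤ) : grid.Adj (x, y) (x + 1, y) := ⟨.right, by simp [Dir.vec]⟩

theorem adj_up (x y : ℤ) : grid.Adj (x, y) (x, y + 1) := ⟨.up, by simp [Dir.vec]⟩

theorem joined_row {S : Set Cell} {x x' y : ℤ} (hx : x ≤ x')
    (h : ∀ t, x ≤ t → t ≤ x' → (t, y) ∈ S) : Joined S (x, y) (x', y) := by
  induction x', hx using Int.leInduction with
  | base => exact Joined.refl (h x le_rfl le_rfl)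
  | succ n hn ih =>
    exact (ih fun t h₁ h₂ => h t h₁ (by omega)).trans
      (Joined.of_adj (h _ hn (by omega)) (h _ (by omega) le_rfl) (adj_right n y))

theorem joined_column {S : Set Cell} {x y y' : ℤ} (hy : y ≤ y')
    (h : ∀ t, y ≤ t → t ≤ y' → (x, t) ∈ S) : Joined S (x, y) (x, y') := by
  induction y', hy using Int.leInduction with
  | base => exact Joined.refl (h y le_rfl le_rfl)
  | succ n hn ih =>
    exact (ih fun t h₁ h₂ => h t h₁ (by omega)).trans
      (Joined.of_adj (h _ hn (by omega)) (h _ (by omega) le_rfl) (adj_up x n))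

/-- The path is L-shaped, along a row and then along a column. Order-connected sets cover bounded
boxes and half-planes alike. -/
theorem joined_box {S : Set Cell} {I J : Set ℤ} [I.OrdConnected] [J.OrdConnected]
    (h : I ×ˢ J ⊆ S) {p q : Cell} (hp : p ∈ I ×ˢ J) (hq : q ∈ I ×ˢ J) : Joined S p q := by
  obtain ⟨x, y⟩ := p
  obtain ⟨x', y'⟩ := q
  have h₁ : Joined S (x, y) (x', y) := by
    rcases le_total x x' with hx | hx
    · exact joined_row hx fun t ht ht' => h ⟨Set.OrdConnected.out ‹_› hp.1 hq.1 ⟨ht, ht'⟩, hp.2⟩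
    · exact (joined_row hx fun t ht ht' =>
        h ⟨Set.OrdConnected.out ‹_› hq.1 hp.1 ⟨ht, ht'⟩, hp.2⟩).symm
  refine h₁.trans ?_
  rcases le_total y y' with hy | hy
  · exact joined_column hy fun t ht ht' => h ⟨hq.1, Set.OrdConnected.out ‹_› hp.2 hq.2 ⟨ht, ht'⟩⟩
  · exact (joined_column hy fun t ht ht' =>
      h ⟨hq.1, Set.OrdConnected.out ‹_› hq.2 hp.2 ⟨ht, ht'⟩⟩).symm

theorem connected_box {I J : Set ℤ} [I.OrdConnected] [J.OrdConnected] (hI : I.Nonempty)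
    (hJ : J.Nonempty) : (grid.induce (I ×ˢ J : Set Cell)).Connected :=
  connected_iff_joined.2 ⟨hI.prod hJ, fun _ hp _ hq => joined_box subset_rfl hp hq⟩

/-- The preimage of a connected set of cells is connected if the fibres are connected and the
fibres over adjacent cells touch. -/
theorem connected_preimage {f : Cell → Cell}
    (hf : ∀ q, (grid.induce (f ⁻¹' {q})).Connected)
    (hadj : ∀ q d, ∃ z w, grid.Adj z w ∧ f z = q ∧ f w = q + Dir.vec d)
    {S : Set Cell} (hS : (grid.induce S).Connected) : (grid.induce (f ⁻¹' S)).Connected := by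
  have fib : ∀ {q z w}, q ∈ S → f z = q → f w = q → Joined (f ⁻¹' S) z w := by
    intro q z w hq hz hw
    refine Joined.mono (S := f ⁻¹' {q}) ?_ ((connected_iff_joined.1 (hf q)).2 z hz w hw)
    rintro v hv
    have hv : f v = q := hv
    simpa [hv] using hq
  -- A walk in `S` is lifted edge by edge: inside a fibre to a cell that touches the next fibre, and
  -- then across.
  have key : ∀ {p q : S}, (grid.induce S).Walk p q → ∀ z w, f z = p → f w = q →
      Joined (f ⁻¹' S) z w := by
    intro p q W
    induction W with
    | nil => intro z w hz hw; exact fib (Subtype.prop _) hz hw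
    | @cons a b c hab W ih =>
      intro z w hz hw
      obtain ⟨d, hd⟩ : grid.Adj a.1 b.1 := by simpa using hab
      obtain ⟨z', w', hzw, hz', hw'⟩ := hadj a.1 d
      rw [← hd] at hw'
      exact ((fib a.2 hz hz').trans (Joined.of_adj (by simp [hz']) (by simp [hw']) hzw)).trans
        (ih w' w hw' hw)
  obtain ⟨⟨q, hq⟩, h⟩ := connected_iff_joined.1 hS
  refine connected_iff_joined.2 ⟨?_, fun z hz w hw => ?_⟩
  · obtain ⟨z, hz⟩ := (connected_iff_joined.1 (hf q)).1
    have hz : f z = q := hz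
    exact ⟨z, by simpa [hz] using hq⟩
  · obtain ⟨_, _, ⟨W⟩⟩ := h _ hz _ hw
    exact key W z w rfl rfl

/-! ### Rectangles -/

/-- The cells of the rectangle of width `w` and height `h` with lower left cell `v`. -/
noncomputable def box (v : Cell) (w h : ℤ) : Finset Cell :=
  Finset.Ico v.1 (v.1 + w) ×ˢ Finset.Ico v.2 (v.2 + h)

theorem mem_box {v z : Cell} {w h : ℤ} :
    z ∈ box v w h ↔ (v.1 ≤ z.1 ∧ z.1 < v.1 + w) ∧ v.2 ≤ z.2 ∧ z.2 < v.2 + h := by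
  simp [box]

theorem box_connected {w h : ℤ} (hw : 0 < w) (hh : 0 < h) (v : Cell) :
    (grid.induce (box v w h : Set Cell)).Connected := by
  have := connected_box (I := Set.Ico v.1 (v.1 + w)) (J := Set.Ico v.2 (v.2 + h))
    (Set.nonempty_Ico.2 (by omega)) (Set.nonempty_Ico.2 (by omega))
  convert this using 2
  all_goals (ext; simp [box])

/-- The complement is a union of four half-planes; each is connected, and each one added meets the
union of the previous ones near a corner of the box. -/
theorem box_noHoles (v : Cell) (w h : ℤ) :
    (grid.induce ((box v w h : Set Cell)ᶜ)).Connected := by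
  set A : Set Cell := Set.Iio v.1 ×ˢ Set.univ
  set B : Set Cell := Set.univ ×ˢ Set.Iio v.2
  set C : Set Cell := Set.Ici (v.1 + w) ×ˢ Set.univ
  set D : Set Cell := Set.univ ×ˢ Set.Ici (v.2 + h)
  have hA : (grid.induce A).Connected := connected_box Set.nonempty_Iio Set.univ_nonempty
  have hB : (grid.induce B).Connected := connected_box Set.univ_nonempty Set.nonempty_Iio
  have hC : (grid.induce C).Connected := connected_box Set.nonempty_Ici Set.univ_nonempty
  have hD : (grid.induce D).Connected := connected_box Set.univ_nonempty Set.nonempty_Ici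
  have h₁ : (grid.induce (A ∪ B)).Connected :=
    connected_iff_joined.2 ⟨hA.nonempty.elim fun a => ⟨a.1, .inl a.2⟩, fun p hp q hq =>
      ⟨hp, hq, SimpleGraph.induce_union_connected hA.preconnected hB.preconnected
        ⟨(v.1 - 1, v.2 - 1), by simp [A, B]⟩ _ _⟩⟩
  have h₂ : (grid.induce (A ∪ B ∪ C)).Connected :=
    connected_iff_joined.2 ⟨hA.nonempty.elim fun a => ⟨a.1, .inl (.inl a.2)⟩, fun p hp q hq =>
      ⟨hp, hq, SimpleGraph.induce_union_connected h₁.preconnected hC.preconnected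
        ⟨(v.1 + w, v.2 - 1), by simp [A, B, C]⟩ _ _⟩⟩
  have h₃ : (grid.induce (A ∪ B ∪ C ∪ D)).Connected :=
    connected_iff_joined.2 ⟨hA.nonempty.elim fun a => ⟨a.1, .inl (.inl (.inl a.2))⟩,
      fun p hp q hq =>
      ⟨hp, hq, SimpleGraph.induce_union_connected h₂.preconnected hD.preconnected
        ⟨(v.1 - 1, v.2 + h), by simp [A, B, C, D]⟩ _ _⟩⟩
  have e : ((box v w h : Set Cell)ᶜ) = A ∪ B ∪ C ∪ D := by
    ext z
    simp only [Set.mem_compl_iff, Finset.mem_coe, mem_box, Set.mem_union, Set.mem_prod,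
      Set.mem_Iio, Set.mem_univ, Set.mem_Ici, true_and, and_true, A, B, C, D]
    omega
  rw [e]
  exact h₃

/-- The rectangle of width `w + 1` and height `h + 1` as a tile. -/
noncomputable def rectTile (w h : ℕ) : Tile where
  cells := box 0 (w + 1) (h + 1)
  connected := box_connected (by omega) (by omega) _
  noHoles := box_noHoles _ _ _
  normal := ⟨fun p hp => by rw [mem_box] at hp; simp at hp; omega,
    ⟨0, by rw [mem_box]; simp, rfl⟩, ⟨0, by rw [mem_box]; simp, rfl⟩⟩

theorem isRectangle_rectTile (w h : ℕ) : IsRectangle (rectTile w h).cells :=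
  ⟨w + 1, h + 1, by simp [rectTile, box]⟩

/-! ### Extent of a region -/

theorem Dir.vec_bound (d : Dir) :
    -1 ≤ d.vec.1 ∧ d.vec.1 ≤ 1 ∧ -1 ≤ d.vec.2 ∧ d.vec.2 ≤ 1 := by
  cases d <;> simp [Dir.vec]

/-- Two cells of a region with `n` cells differ by less than `n` in each coordinate. -/
theorem Region.abs_sub_lt (G : Region) {p q : Cell} (hp : p ∈ G.cells) (hq : q ∈ G.cells) :
    |q.1 - p.1| < G.cells.card ∧ |q.2 - p.2| < G.cells.card := by
  have key : ∀ {p q : (G.cells : Set Cell)} (W : (grid.induce (G.cells : Set Cell)).Walk p q),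
      |q.1.1 - p.1.1| ≤ W.length ∧ |q.1.2 - p.1.2| ≤ W.length := by
    intro p q W
    induction W with
    | nil => simp
    | @cons a b c hab W ih =>
      obtain ⟨d, hd⟩ : grid.Adj a.1 b.1 := by simpa using hab
      have := d.vec_bound
      simp only [hd, Prod.fst_add, Prod.snd_add, abs_le] at ih
      simp only [SimpleGraph.Walk.length_cons, abs_le]
      push_cast
      omega
  -- A path repeats no cell, so its length is less than the number of cells, and each step changes a
  -- coordinate by at most one.
  obtain ⟨W, hW⟩ := (G.connected.preconnected ⟨p, hp⟩ ⟨q, hq⟩).exists_isPath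
  have h₁ := hW.length_lt
  have h₂ := key W
  simp only [Fintype.card_coe, SetLike.coe_sort_coe] at h₁
  have h₃ : (W.length : ℤ) < G.cells.card := by
    have : Fintype.card (↥(G.cells : Set Cell)) = G.cells.card := by simp
    omega
  exact ⟨h₂.1.trans_lt h₃, h₂.2.trans_lt h₃⟩

/-! ### Composition of programs -/

theorem Run.pos {p : Program} {s s' : State} {t : ℕ} (h : Run p s t s') : 0 < t := by
  induction h <;> omega

theorem Run.length_out_le {p : Program} {s s' : State} {t : ℕ} (h : Run p s t s') :
    s'.out.length ≤ s.out.length + t := by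
  induction h <;> (try simp) <;> omega

/-- Where the first of two composed programs keeps its memory cell `a`. -/
def fstAddr (a : ℤ) : ℤ := if 0 ≤ a then a else a + a

/-- Where the second of two composed programs keeps its memory cell `a`. -/
def sndAddr (a : ℤ) : ℤ := if 0 ≤ a then -1 - (a + a + (a + a)) else 1 + (a + a + (a + a))

/-- `reg 2 := fstAddr (reg a)`, using register `5`. -/
def fstAddrProg (a : ℕ) : Program :=
  .seq (.const 2 1) (.seq (.add 2 a 2)
    (.ite 2 (.seq (.const 5 0) (.add 2 a 5)) (.add 2 a a)))

/-- `reg 2 := sndAddr (reg a)`, using register `5`. -/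
def sndAddrProg (a : ℕ) : Program :=
  .seq (.const 2 1) (.seq (.add 2 a 2)
    (.ite 2 (.seq (.add 5 a a) (.seq (.add 5 5 5) (.seq (.const 2 (-1)) (.sub 2 2 5))))
      (.seq (.add 5 a a) (.seq (.add 5 5 5) (.seq (.const 2 1) (.add 2 2 5))))))

theorem run_fstAddrProg {a : ℕ} (ha : a ≠ 2) (ha' : a ≠ 5) (S : State) :
    ∃ t ≤ 5, ∃ R : ℕ → ℤ, R 2 = fstAddr (S.reg a) ∧ (∀ r, r ≠ 2 → r ≠ 5 → R r = S.reg r) ∧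
      Run (fstAddrProg a) S t { S with reg := R } := by
  by_cases h : 0 ≤ S.reg a
  · refine ⟨_, ?_, _, ?_, ?_, .seq (.const ..) (.seq (.add ..) (.ite_pos ?_
      (.seq (.const ..) (.add ..))))⟩
    · omega
    · simp [fstAddr, h, ha, ha']
    · intro r h₂ h₅; simp [h₂, h₅]
    · simp [ha]; omega
  · refine ⟨_, ?_, _, ?_, ?_, .seq (.const ..) (.seq (.add ..) (.ite_neg ?_ (.add ..)))⟩
    · omega
    · simp [fstAddr, h, ha]
    · intro r h₂ h₅; simp [h₂]
    · simp [ha]; omega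

theorem run_sndAddrProg {a : ℕ} (ha : a ≠ 2) (S : State) :
    ∃ t ≤ 7, ∃ R : ℕ → ℤ, R 2 = sndAddr (S.reg a) ∧ (∀ r, r ≠ 2 → r ≠ 5 → R r = S.reg r) ∧
      Run (sndAddrProg a) S t { S with reg := R } := by
  by_cases h : 0 ≤ S.reg a
  · refine ⟨_, ?_, _, ?_, ?_, .seq (.const ..) (.seq (.add ..) (.ite_pos ?_
      (.seq (.add ..) (.seq (.add ..) (.seq (.const ..) (.sub ..))))))⟩
    · omega
    · simp [sndAddr, h, ha]
    · intro r h₂ h₅; simp [h₂, h₅]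
    · simp [ha]; omega
  · refine ⟨_, ?_, _, ?_, ?_, .seq (.const ..) (.seq (.add ..) (.ite_neg ?_
      (.seq (.add ..) (.seq (.add ..) (.seq (.const ..) (.add ..))))))⟩
    · omega
    · simp [sndAddr, h, ha]
    · intro r h₂ h₅; simp [h₂, h₅]
    · simp [ha]; omega

/-- The first of two composed programs: its output goes to the memory of the second, register `8`
holds the next address for it, and register `1` counts it. -/
def fstProg : Program → Program
  | .const r k => .const (3 * r) k
  | .add r a b => .add (3 * r) (3 * a) (3 * b)
  | .sub r a b => .sub (3 * r) (3 * a) (3 * b)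
  | .load r a => .seq (fstAddrProg (3 * a)) (.load (3 * r) 2)
  | .store a b => .seq (fstAddrProg (3 * a)) (.store 2 (3 * b))
  | .print r => .seq (.store 8 (3 * r)) (.seq (.const 2 4) (.seq (.sub 8 8 2)
      (.seq (.const 2 1) (.add 1 1 2))))
  | .seq p q => .seq (fstProg p) (fstProg q)
  | .ite r p q => .ite (3 * r) (fstProg p) (fstProg q)
  | .loop r p => .loop (3 * r) (fstProg p)

/-- The second of two composed programs. -/
def sndProg : Program → Program
  | .const r k => .const (3 * r + 1) k
  | .add r a b => .add (3 * r + 1) (3 * a + 1) (3 * b + 1)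
  | .sub r a b => .sub (3 * r + 1) (3 * a + 1) (3 * b + 1)
  | .load r a => .seq (sndAddrProg (3 * a + 1)) (.load (3 * r + 1) 2)
  | .store a b => .seq (sndAddrProg (3 * a + 1)) (.store 2 (3 * b + 1))
  | .print r => .print (3 * r + 1)
  | .seq p q => .seq (sndProg p) (sndProg q)
  | .ite r p q => .ite (3 * r + 1) (sndProg p) (sndProg q)
  | .loop r p => .loop (3 * r + 1) (sndProg p)

/-- `S` represents the state `s` of the second program. -/
structure SndSim (s S : State) : Prop where
  reg : ∀ r, S.reg (3 * r + 1) = s.reg r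
  mem : ∀ a, S.mem (sndAddr a) = s.mem a

/-- `S` represents the state `s` of the first program, whose output is the input of the second. -/
structure FstSim (s S : State) : Prop where
  reg : ∀ r, S.reg (3 * r) = s.reg r
  mem : ∀ a, S.mem (fstAddr a) = s.mem a
  ptr : S.reg 8 = -1 - 4 * s.out.length
  out : S.out = []
  snd : SndSim (State.init s.out) S

theorem fstAddr_inj {a b : ℤ} : fstAddr a = fstAddr b ↔ a = b := by
  unfold fstAddr; split_ifs <;> omega

theorem sndAddr_inj {a b : ℤ} : sndAddr a = sndAddr b ↔ a = b := by
  unfold sndAddr; split_ifs <;> omega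

/-- The first program owns the nonnegative addresses, where its input already stands, and the even
negative ones. The odd negative addresses belong to the second program, split by their residue
modulo `4` according to the sign of the original address. -/
theorem fstAddr_ne_sndAddr (a b : ℤ) : fstAddr a ≠ sndAddr b := by
  unfold fstAddr sndAddr; split_ifs <;> omega

theorem SndSim.congr {s S S' : State} (h : SndSim s S) (hr : ∀ r, S'.reg (3 * r + 1) =
    S.reg (3 * r + 1)) (hm : ∀ a, S'.mem (sndAddr a) = S.mem (sndAddr a)) : SndSim s S' :=
  ⟨fun r => (hr r).trans (h.reg r), fun a => (hm a).trans (h.mem a)⟩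

/-- Registers divisible by three belong to the first program, those with residue one to the second;
of residue two are the scratch registers `2`, `5` and the pointer `8`. Letting `R` differ from the
old registers at `2` and `5` absorbs the computation of addresses. -/
theorem FstSim.set {s S : State} (h : FstSim s S) (r : ℕ) (k : ℤ) {R : ℕ → ℤ}
    (hR : ∀ i, i ≠ 2 → i ≠ 5 → R i = S.reg i) :
    FstSim { s with reg := Function.update s.reg r k }
      { S with reg := Function.update R (3 * r) k } where
  reg i := by
    by_cases hi : i = r
    · subst hi; simp
    · simp only [Function.update_apply, hi, if_false]
      rw [if_neg (by omega), hR _ (by omega) (by omega), h.reg]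
  mem := h.mem
  ptr := by
    simp only [Function.update_apply]
    rw [if_neg (by omega), hR _ (by omega) (by omega), h.ptr]
  out := h.out
  snd := h.snd.congr (fun i => by
    simp only [Function.update_apply]
    rw [if_neg (by omega), hR _ (by omega) (by omega)]) fun _ => rfl

theorem SndSim.set {s S : State} (h : SndSim s S) (r : ℕ) (k : ℤ) {R : ℕ → ℤ}
    (hR : ∀ i, i ≠ 2 → i ≠ 5 → R i = S.reg i) :
    SndSim { s with reg := Function.update s.reg r k }
      { S with reg := Function.update R (3 * r + 1) k } where
  reg i := by
    by_cases hi : i = r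
    · subst hi; simp
    · simp only [Function.update_apply, hi, if_false]
      rw [if_neg (by omega), hR _ (by omega) (by omega), h.reg]
  mem := h.mem

/-- When the first program prints, the future input of the second grows by one entry; this is the
corresponding change of its initial memory. -/
theorem init_concat_mem (l : List ℤ) (x a : ℤ) :
    (State.init (l ++ [x])).mem a = Function.update (State.init l).mem l.length x a := by
  simp only [State.init, Function.update_apply]
  by_cases h : 0 ≤ a
  · lift a to ℕ using h
    simp only [Nat.cast_nonneg, if_true, Int.toNat_natCast, Nat.cast_inj]
    split_ifs with h'
    · simp [h']
    · rcases lt_or_gt_of_ne h' with h' | h'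
      · simp [List.getD_eq_getElem?_getD, List.getElem?_append_left h']
      · rw [List.getD_eq_default _ _ (by simp; omega), List.getD_eq_default _ _ (by omega)]
  · simp [h]; omega

/-- The factor `6` is the cost of the slowest translated instruction: five steps for an address and
one for the access. -/
theorem run_fstProg {p : Program} {s s' : State} {t : ℕ} (h : Run p s t s') :
    ∀ S, FstSim s S → ∃ t' ≤ 6 * t, ∃ S', Run (fstProg p) S t' S' ∧ FstSim s' S' := by
  induction h with
  | const r k s => exact fun S hS => ⟨1, by omega, _, .const .., hS.set r k fun _ _ _ => rfl⟩
  | add r a b s =>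
    intro S hS
    refine ⟨1, by omega, _, .add .., ?_⟩
    rw [hS.reg, hS.reg]
    exact hS.set r _ fun _ _ _ => rfl
  | sub r a b s =>
    intro S hS
    refine ⟨1, by omega, _, .sub .., ?_⟩
    rw [hS.reg, hS.reg]
    exact hS.set r _ fun _ _ _ => rfl
  | load r a s =>
    intro S hS
    obtain ⟨t, ht, R, h₂, hR, hrun⟩ := run_fstAddrProg (a := 3 * a) (by omega) (by omega) S
    refine ⟨t + 1, by omega, _, .seq hrun (.load ..), ?_⟩
    simp only [h₂, hS.reg, hS.mem]
    exact hS.set r _ hR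
  | store a b s =>
    intro S hS
    obtain ⟨t, ht, R, h₂, hR, hrun⟩ := run_fstAddrProg (a := 3 * a) (by omega) (by omega) S
    refine ⟨t + 1, by omega, _, .seq hrun (.store ..), ?_⟩
    simp only [h₂, hS.reg, hR (3 * b) (by omega) (by omega)]
    refine ⟨fun r => ?_, fun i => ?_, ?_, hS.out, hS.snd.congr (fun r => ?_) fun i => ?_⟩
    · exact (hR _ (by omega) (by omega)).trans (hS.reg r)
    · simp only [Function.update_apply, fstAddr_inj, hS.mem]
    · exact (hR _ (by omega) (by omega)).trans hS.ptr
    · exact hR _ (by omega) (by omega)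
    · simp only [Function.update_apply]
      rw [if_neg (fstAddr_ne_sndAddr _ _).symm]
  | print r s =>
    intro S hS
    refine ⟨_, ?_, _, .seq (.store ..) (.seq (.const ..) (.seq (.sub ..) (.seq (.const ..)
      (.add ..)))), ?_⟩
    · omega
    have e : S.reg 8 = sndAddr s.out.length := by
      rw [hS.ptr, sndAddr, if_pos (by omega)]; ring
    refine ⟨fun i => ?_, fun i => ?_, ?_, hS.out, ⟨fun i => ?_, fun i => ?_⟩⟩
    · have : 3 * i ≠ 1 ∧ 3 * i ≠ 2 ∧ 3 * i ≠ 8 := by omega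
      simp [this, hS.reg]
    · simp only [Function.update_apply, e]
      rw [if_neg (fstAddr_ne_sndAddr _ _), hS.mem]
    · simp [hS.ptr]; ring
    -- Register `0` of the second program is register `1` here, which counts the printed integers
    -- and so remains the length of its input.
    · rcases i with _ | i
      · have := hS.snd.reg 0
        simp [State.init] at this
        simp [State.init, this]
      · have := hS.snd.reg (i + 1)
        simp [State.init] at this
        have h' : 3 * (i + 1) + 1 ≠ 1 ∧ 3 * (i + 1) + 1 ≠ 2 ∧ 3 * (i + 1) + 1 ≠ 8 := by omega
        simp [State.init, this, h']
    · simp only [init_concat_mem]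
      simp only [Function.update_apply, e, sndAddr_inj, hS.snd.mem, hS.reg]
  | seq _ _ ih₁ ih₂ =>
    intro S hS
    obtain ⟨t₁, h₁, S₁, r₁, hS₁⟩ := ih₁ S hS
    obtain ⟨t₂, h₂, S₂, r₂, hS₂⟩ := ih₂ S₁ hS₁
    exact ⟨_, by omega, S₂, .seq r₁ r₂, hS₂⟩
  | ite_pos hr _ ih =>
    intro S hS
    obtain ⟨t₁, h₁, S₁, r₁, hS₁⟩ := ih S hS
    exact ⟨_, by omega, S₁, .ite_pos (by rwa [hS.reg]) r₁, hS₁⟩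
  | ite_neg hr _ ih =>
    intro S hS
    obtain ⟨t₁, h₁, S₁, r₁, hS₁⟩ := ih S hS
    exact ⟨_, by omega, S₁, .ite_neg (by rwa [hS.reg]) r₁, hS₁⟩
  | loop_done hr => exact fun S hS => ⟨1, by omega, S, .loop_done (by rwa [hS.reg]), hS⟩
  | loop_step hr _ _ ih₁ ih₂ =>
    intro S hS
    obtain ⟨t₁, h₁, S₁, r₁, hS₁⟩ := ih₁ S hS
    obtain ⟨t₂, h₂, S₂, r₂, hS₂⟩ := ih₂ S₁ hS₁
    exact ⟨_, by omega, S₂, .loop_step (by rwa [hS.reg]) r₁ r₂, hS₂⟩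

theorem run_sndProg {p : Program} {s s' : State} {t : ℕ} (h : Run p s t s') :
    ∀ S, SndSim s S → S.out = s.out →
      ∃ t' ≤ 8 * t, ∃ S', Run (sndProg p) S t' S' ∧ SndSim s' S' ∧ S'.out = s'.out := by
  induction h with
  | const r k s => exact fun S hS ho => ⟨1, by omega, _, .const .., hS.set r k fun _ _ _ => rfl, ho⟩
  | add r a b s =>
    intro S hS ho
    refine ⟨1, by omega, _, .add .., ?_, ho⟩
    rw [hS.reg, hS.reg]
    exact hS.set r _ fun _ _ _ => rfl
  | sub r a b s =>
    intro S hS ho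
    refine ⟨1, by omega, _, .sub .., ?_, ho⟩
    rw [hS.reg, hS.reg]
    exact hS.set r _ fun _ _ _ => rfl
  | load r a s =>
    intro S hS ho
    obtain ⟨t, ht, R, h₂, hR, hrun⟩ := run_sndAddrProg (a := 3 * a + 1) (by omega) S
    refine ⟨t + 1, by omega, _, .seq hrun (.load ..), ?_, ho⟩
    simp only [h₂, hS.reg, hS.mem]
    exact hS.set r _ hR
  | store a b s =>
    intro S hS ho
    obtain ⟨t, ht, R, h₂, hR, hrun⟩ := run_sndAddrProg (a := 3 * a + 1) (by omega) S
    refine ⟨t + 1, by omega, _, .seq hrun (.store ..), ?_, ho⟩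
    simp only [h₂, hS.reg, hR (3 * b + 1) (by omega) (by omega)]
    refine ⟨fun r => ?_, fun i => ?_⟩
    · exact (hR _ (by omega) (by omega)).trans (hS.reg r)
    · simp only [Function.update_apply, sndAddr_inj, hS.mem]
  | print r s =>
    exact fun S hS ho => ⟨1, by omega, _, .print .., ⟨hS.reg, hS.mem⟩,
      by simp only [ho, hS.reg]⟩
  | seq _ _ ih₁ ih₂ =>
    intro S hS ho
    obtain ⟨t₁, h₁, S₁, r₁, hS₁, ho₁⟩ := ih₁ S hS ho
    obtain ⟨t₂, h₂, S₂, r₂, hS₂⟩ := ih₂ S₁ hS₁ ho₁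
    exact ⟨_, by omega, S₂, .seq r₁ r₂, hS₂⟩
  | ite_pos hr _ ih =>
    intro S hS ho
    obtain ⟨t₁, h₁, S₁, r₁, hS₁⟩ := ih S hS ho
    exact ⟨_, by omega, S₁, .ite_pos (by rwa [hS.reg]) r₁, hS₁⟩
  | ite_neg hr _ ih =>
    intro S hS ho
    obtain ⟨t₁, h₁, S₁, r₁, hS₁⟩ := ih S hS ho
    exact ⟨_, by omega, S₁, .ite_neg (by rwa [hS.reg]) r₁, hS₁⟩
  | loop_done hr => exact fun S hS ho => ⟨1, by omega, S, .loop_done (by rwa [hS.reg]), hS, ho⟩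
  | loop_step hr _ _ ih₁ ih₂ =>
    intro S hS ho
    obtain ⟨t₁, h₁, S₁, r₁, hS₁, ho₁⟩ := ih₁ S hS ho
    obtain ⟨t₂, h₂, S₂, r₂, hS₂⟩ := ih₂ S₁ hS₁ ho₁
    exact ⟨_, by omega, S₂, .loop_step (by rwa [hS.reg]) r₁ r₂, hS₂⟩

/-- The program that runs `q` on the output of `p`. -/
def compProg (p q : Program) : Program :=
  .seq (.const 8 (-1)) (.seq (fstProg p) (sndProg q))

theorem run_compProg {p q : Program} {l : List ℤ} {s s' : State} {t t' : ℕ}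
    (hp : Run p (State.init l) t s) (hq : Run q (State.init s.out) t' s') :
    ∃ T ≤ 1 + 6 * t + 8 * t', ∃ S, Run (compProg p q) (State.init l) T S ∧ S.out = s'.out := by
  -- The pointer starts at `-1`, which is `sndAddr 0`.
  have h₀ : FstSim (State.init l)
      { State.init l with reg := Function.update (State.init l).reg 8 (-1) } := by
    refine ⟨fun r => ?_, fun a => ?_, ?_, rfl, fun r => ?_, fun a => ?_⟩
    · have : 3 * r ≠ 8 := by omega
      simp [State.init, this]
    · simp only [State.init, fstAddr]
      by_cases h : 0 ≤ a
      · simp [h]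
      · simp [h]
    · simp [State.init]
    · have : 3 * r + 1 ≠ 8 := by omega
      simp [State.init, this]
    · simp only [State.init, sndAddr]
      -- All addresses of the second program are negative, and there the initial memory is zero.
      rw [if_neg (by split_ifs <;> omega)]
      simp
  obtain ⟨t₁, h₁, S₁, r₁, hS₁⟩ := run_fstProg hp _ h₀
  obtain ⟨t₂, h₂, S₂, r₂, -, ho⟩ := run_sndProg hq S₁ hS₁.snd hS₁.out
  exact ⟨_, by omega, S₂, .seq (.const ..) (.seq r₁ r₂), ho⟩

/-- An instance of `B` is no larger than its description, and this has been printed within the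
running time `t` of the first program. So the second program takes time linear in `t`. -/
theorem LinearTimeComputable.comp {A B C : Problem} {f : A.Inst → B.Inst} {g : B.Inst → C.Inst}
    (hB : ∀ l G, B.Describes l G → B.size G ≤ l.length)
    (hf : LinearTimeComputable A B f) (hg : LinearTimeComputable B C g) :
    LinearTimeComputable A C (g ∘ f) := by
  obtain ⟨p, c, hp⟩ := hf
  obtain ⟨q, d, hq⟩ := hg
  refine ⟨compProg p q, (7 + 8 * d) * c, fun G l hl => ?_⟩
  obtain ⟨t, s, hrun, ht, hs⟩ := hp G l hl
  obtain ⟨t', s', hrun', ht', hs'⟩ := hq (f G) s.out hs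
  obtain ⟨T, hT, S, hS, ho⟩ := run_compProg hrun hrun'
  refine ⟨T, S, hS, ?_, by rw [ho]; exact hs'⟩
  have h₁ := hrun.pos
  have h₂ : B.size (f G) ≤ t := (hB _ _ hs).trans (by simpa [State.init] using hrun.length_out_le)
  calc T ≤ 1 + 6 * t + 8 * t' := hT
    _ ≤ (7 + 8 * d) * t := by
      have := ht'.trans (Nat.mul_le_mul_left d h₂)
      nlinarith
    _ ≤ (7 + 8 * d) * c * A.size G := by rw [mul_assoc]; exact Nat.mul_le_mul_left _ ht

theorem IsLinearTimeReduction.comp {A B C : Problem} {f : A.Inst → B.Inst} {g : B.Inst → C.Inst}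
    (hB : ∀ l G, B.Describes l G → B.size G ≤ l.length)
    (hf : IsLinearTimeReduction A B f) (hg : IsLinearTimeReduction B C g) :
    IsLinearTimeReduction A C (g ∘ f) :=
  ⟨hf.1.comp hB hg.1, fun G => (hf.2 G).trans (hg.2 (f G))⟩

theorem LinearTimeReducible.trans {A B C : TileabilityClass}
    (hB : ∀ T l G, (B.problem T).Describes l G → (B.problem T).size G ≤ l.length)
    (h : LinearTimeReducible A B) (h' : LinearTimeReducible B C) : LinearTimeReducible A C := by
  intro T
  obtain ⟨T', f, hf⟩ := h T
  obtain ⟨T'', g, hg⟩ := h' T'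
  exact ⟨T'', g ∘ f, hf.comp (hB T') hg⟩

theorem card_eq_length {S : Finset Cell} {L : List Cell} (hL : L.Nodup)
    (h : ∀ p, p ∈ L ↔ p ∈ S) : S.card = L.length := by
  have : S = L.toFinset := by ext; simp [h]
  rw [this, List.toFinset_card_of_nodup hL]

theorem Region.Describes.card_le {l : List ℤ} {G : Region} (h : G.Describes l) :
    G.cells.card ≤ l.length := by
  obtain ⟨L, hL, h, rfl⟩ := h
  rw [card_eq_length hL h]
  simp [List.length_flatMap]; omega

theorem LabelledRegion.Describes.card_le {c : ℕ} {l : List ℤ} {G : LabelledRegion (Fin c)}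
    (h : G.Describes l) : G.cells.card ≤ l.length := by
  obtain ⟨L, hL, h, rfl⟩ := h
  rw [card_eq_length hL h]
  simp [List.length_flatMap]; omega

/-! ### Reasoning about programs -/

/-- Started in `s`, the program `p` halts within `T` steps in a state that satisfies `Q`. -/
def Does (p : Program) (s : State) (T : ℕ) (Q : State → Prop) : Prop :=
  ∃ t ≤ T, ∃ s', Run p s t s' ∧ Q s'

namespace Does

variable {p q : Program} {s : State} {T T' : ℕ} {Q Q' : State → Prop}

theorem mono (h : Does p s T Q) (hT : T ≤ T') (hQ : ∀ s', Q s' → Q' s') : Does p s T' Q' :=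
  let ⟨t, ht, s', hr, hs⟩ := h
  ⟨t, ht.trans hT, s', hr, hQ _ hs⟩

theorem const {r : ℕ} {k : ℤ} (h : Q { s with reg := Function.update s.reg r k }) :
    Does (.const r k) s 1 Q := ⟨1, le_rfl, _, .const .., h⟩

theorem add {r a b : ℕ} (h : Q { s with reg := Function.update s.reg r (s.reg a + s.reg b) }) :
    Does (.add r a b) s 1 Q := ⟨1, le_rfl, _, .add .., h⟩

theorem sub {r a b : ℕ} (h : Q { s with reg := Function.update s.reg r (s.reg a - s.reg b) }) :
    Does (.sub r a b) s 1 Q := ⟨1, le_rfl, _, .sub .., h⟩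

theorem load {r a : ℕ} (h : Q { s with reg := Function.update s.reg r (s.mem (s.reg a)) }) :
    Does (.load r a) s 1 Q := ⟨1, le_rfl, _, .load .., h⟩

theorem store {a b : ℕ} (h : Q { s with mem := Function.update s.mem (s.reg a) (s.reg b) }) :
    Does (.store a b) s 1 Q := ⟨1, le_rfl, _, .store .., h⟩

theorem print {r : ℕ} (h : Q { s with out := s.out ++ [s.reg r] }) :
    Does (.print r) s 1 Q := ⟨1, le_rfl, _, .print .., h⟩

theorem seq (h : Does p s T fun s' => Does q s' T' Q) : Does (.seq p q) s (T + T') Q := by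
  obtain ⟨t, ht, s', hr, t', ht', s'', hr', hs⟩ := h
  exact ⟨_, add_le_add ht ht', s'', .seq hr hr', hs⟩

theorem ite_pos {r : ℕ} (hr : 0 < s.reg r) (h : Does p s T Q) :
    Does (.ite r p q) s (T + 1) Q := by
  obtain ⟨t, ht, s', hr', hs⟩ := h
  exact ⟨_, Nat.succ_le_succ ht, s', .ite_pos hr hr', hs⟩

theorem ite_neg {r : ℕ} (hr : ¬ 0 < s.reg r) (h : Does q s T Q) :
    Does (.ite r p q) s (T + 1) Q := by
  obtain ⟨t, ht, s', hr', hs⟩ := h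
  exact ⟨_, Nat.succ_le_succ ht, s', .ite_neg hr hr', hs⟩

/-- A loop with invariant `I` that is run `n` times. -/
theorem loop {r n : ℕ} (I : ℕ → State → Prop)
    (hstep : ∀ k < n, ∀ s, I k s → 0 < s.reg r ∧ Does p s T (I (k + 1)))
    (hdone : ∀ s, I n s → ¬ 0 < s.reg r) {s : State} (hs : I 0 s) :
    Does (.loop r p) s ((T + 1) * n + 1) (I n) := by
  suffices h : ∀ m k, k + m = n → ∀ s, I k s → Does (.loop r p) s ((T + 1) * m + 1) (I n) from
    h n 0 (by omega) s hs
  intro m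
  induction m with
  | zero =>
    rintro k rfl s hs
    exact ⟨1, by omega, s, .loop_done (hdone s hs), hs⟩
  | succ m ih =>
    intro k hk s hs
    obtain ⟨hr, t, ht, s', hrun, hs'⟩ := hstep k (by omega) s hs
    obtain ⟨t', ht', s'', hrun', hs''⟩ := ih (k + 1) (by omega) s' hs'
    refine ⟨_, ?_, s'', .loop_step hr hrun hrun', hs''⟩
    rw [mul_add]
    omega

end Does

/-! ### Programs that treat the input record by record -/

theorem getD_flatMap {α : Type*} {w : ℕ} (f : α → List ℤ) (hf : ∀ a, (f a).length = w)
    (L : List α) {k j : ℕ} (hk : k < L.length) (hj : j < w) :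
    (L.flatMap f).getD (w * k + j) 0 = (f L[k]).getD j 0 := by
  induction L generalizing k with
  | nil => simp at hk
  | cons a L ih =>
    rw [List.flatMap_cons]
    cases k with
    | zero =>
      rw [List.getD_append _ _ _ _ (by rw [hf]; omega)]
      simp
    | succ k =>
      rw [List.getD_append_right _ _ _ _ (by rw [hf]; nlinarith)]
      rw [show w * (k + 1) + j - (f a).length = w * k + j by rw [hf, mul_add]; omega]
      simpa using ih (by simpa using hk)

theorem length_flatMap_const {α : Type*} {w : ℕ} (f : α → List ℤ) (hf : ∀ a, (f a).length = w)
    (L : List α) : (L.flatMap f).length = w * L.length := by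
  simp [List.length_flatMap, hf, mul_comm]

theorem init_mem_flatMap {α : Type*} {w : ℕ} (f : α → List ℤ) (hf : ∀ a, (f a).length = w)
    (L : List α) {k j : ℕ} (hk : k < L.length) (hj : j < w) :
    (State.init (L.flatMap f)).mem (w * k + j) = (f L[k]).getD j 0 := by
  have : (w * k + j : ℤ) = ((w * k + j : ℕ) : ℤ) := by push_cast; rfl
  rw [this, State.init]
  simp only [Nat.cast_nonneg, if_true, Int.toNat_natCast]
  exact getD_flatMap f hf L hk hj

/-- Run `p` once for each record of `w` integers in the input; register `1` holds the address of
the record. -/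
def recordLoop (w : ℕ) (p : Program) : Program :=
  .loop 0 (.seq p (.seq (.const 2 w) (.seq (.add 1 1 2) (.sub 0 0 2))))

theorem recordLoop_out {α : Type*} {w : ℕ} (hw : 0 < w) (f : α → List ℤ)
    (hf : ∀ a, (f a).length = w) (g : α → List ℤ) {p : Program} {T : ℕ} (L : List α)
    (hp : ∀ a ∈ L, ∀ s : State, (∀ j < w, s.mem (s.reg 1 + j) = (f a).getD j 0) →
      Does p s T fun s' => s'.mem = s.mem ∧ s'.reg 0 = s.reg 0 ∧ s'.reg 1 = s.reg 1 ∧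
        s'.out = s.out ++ g a) :
    Does (recordLoop w p) (State.init (L.flatMap f)) ((T + 4) * L.length + 1)
      fun s => s.out = L.flatMap g := by
  refine (Does.loop (n := L.length) (T := T + 3) (fun k s =>
    s.mem = (State.init (L.flatMap f)).mem ∧ s.reg 0 = w * (L.length - k) ∧ s.reg 1 = w * k ∧
      s.out = (L.take k).flatMap g) ?_ ?_ ?_).mono le_rfl ?_
  · rintro k hk s ⟨hm, h₀, h₁, ho⟩
    refine ⟨?_, Does.seq ?_⟩
    · rw [h₀]
      exact mul_pos (by omega) (by omega)
    refine (hp L[k] (List.getElem_mem hk) s fun j hj => ?_).mono le_rfl ?_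
    · rw [h₁, hm, init_mem_flatMap f hf L hk hj]
    · rintro s' ⟨hm', h₀', h₁', ho'⟩
      refine Does.seq (T' := 2) (.const (.seq (.add (.sub ?_))))
      refine ⟨hm'.trans hm, ?_, ?_, ?_⟩
      · simp [h₀', h₀]; ring
      · simp [h₁', h₁]; ring
      · have e : L.take (k + 1) = L.take k ++ [L[k]] := by simp
        simp only [ho', ho, e, List.flatMap_append, List.flatMap_singleton]
  · rintro s ⟨-, h₀, -⟩
    simp [h₀]
  · refine ⟨rfl, ?_, by simp [State.init], by simp [State.init]⟩
    simp [State.init, length_flatMap_const f hf, -List.length_flatMap]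
  · rintro s ⟨-, -, -, h⟩
    simpa using h

/-- The program that copies its input to the output. -/
def copyProg : Program := recordLoop 1 (.seq (.load 3 1) (.print 3))

theorem copyProg_out (l : List ℤ) :
    Does copyProg (State.init l) (6 * l.length + 1) fun s => s.out = l := by
  have := recordLoop_out (w := 1) (by omega) (fun a : ℤ => [a]) (fun _ => rfl) (fun a => [a])
    (p := .seq (.load 3 1) (.print 3)) (T := 2) l (by
      intro a _ s hs
      refine Does.seq (T := 1) (.load (.print ⟨rfl, by simp, by simp, ?_⟩))
      simpa using hs 0)
  simpa [copyProg] using this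

/-! ### Local transducers -/

/-- Add `n` times register `a` to register `r`. -/
def addMulNat (r a : ℕ) : ℕ → Program
  | 0 => .const 5 0
  | n + 1 => .seq (.add r r a) (addMulNat r a n)

/-- Subtract `n` times register `a` from register `r`. -/
def subMulNat (r a : ℕ) : ℕ → Program
  | 0 => .const 5 0
  | n + 1 => .seq (.sub r r a) (subMulNat r a n)

/-- Multiplication by a fixed integer costs a fixed number of additions or subtractions, so affine
forms with constant coefficients can be evaluated in constant time. -/
def addMul (r a : ℕ) (k : ℤ) : Program :=
  if 0 ≤ k then addMulNat r a k.natAbs else subMulNat r a k.natAbs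

/-- Register `5` is scratch; writing to it plays the part of the empty program. -/
theorem addMulNat_spec {a : ℕ} (ha : a ≠ 4) (n : ℕ) (s : State) :
    Does (addMulNat 4 a n) s (n + 1) fun s' => s'.mem = s.mem ∧ s'.out = s.out ∧
      s'.reg 4 = s.reg 4 + n * s.reg a ∧ ∀ i, i ≠ 4 → i ≠ 5 → s'.reg i = s.reg i := by
  induction n generalizing s with
  | zero => exact .const ⟨rfl, rfl, by simp, fun i h₄ h₅ => by simp [h₅]⟩
  | succ n ih =>
    refine (Does.seq (.add (ih _))).mono (by omega) ?_
    rintro s' ⟨hm, ho, h₄, hr⟩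
    refine ⟨hm, ho, ?_, fun i h₄ h₅ => by simp [hr i h₄ h₅, h₄]⟩
    rw [h₄]
    simp [ha]
    ring

theorem subMulNat_spec {a : ℕ} (ha : a ≠ 4) (n : ℕ) (s : State) :
    Does (subMulNat 4 a n) s (n + 1) fun s' => s'.mem = s.mem ∧ s'.out = s.out ∧
      s'.reg 4 = s.reg 4 - n * s.reg a ∧ ∀ i, i ≠ 4 → i ≠ 5 → s'.reg i = s.reg i := by
  induction n generalizing s with
  | zero => exact .const ⟨rfl, rfl, by simp, fun i h₄ h₅ => by simp [h₅]⟩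
  | succ n ih =>
    refine (Does.seq (.sub (ih _))).mono (by omega) ?_
    rintro s' ⟨hm, ho, h₄, hr⟩
    refine ⟨hm, ho, ?_, fun i h₄ h₅ => by simp [hr i h₄ h₅, h₄]⟩
    rw [h₄]
    simp [ha]
    ring

theorem addMul_spec {a : ℕ} (ha : a ≠ 4) (k : ℤ) (s : State) :
    Does (addMul 4 a k) s (k.natAbs + 1) fun s' => s'.mem = s.mem ∧ s'.out = s.out ∧
      s'.reg 4 = s.reg 4 + k * s.reg a ∧ ∀ i, i ≠ 4 → i ≠ 5 → s'.reg i = s.reg i := by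
  unfold addMul
  split_ifs with hk
  · refine (addMulNat_spec ha k.natAbs s).mono le_rfl ?_
    rintro s' ⟨hm, ho, h₄, hr⟩
    exact ⟨hm, ho, by rw [h₄, Int.natAbs_of_nonneg hk], hr⟩
  · refine (subMulNat_spec ha k.natAbs s).mono le_rfl ?_
    rintro s' ⟨hm, ho, h₄, hr⟩
    refine ⟨hm, ho, ?_, hr⟩
    rw [h₄, Int.ofNat_natAbs_of_nonpos (by omega)]
    ring

/-- The value of the affine form `e` at the cell `p`. -/
def affine (p : Cell) (e : ℤ × ℤ × ℤ) : ℤ := e.2.2 + e.1 * p.1 + e.2.1 * p.2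

/-- Print the values of affine forms at the cell in registers `10`, `11`. -/
def emitList : List (ℤ × ℤ × ℤ) → Program
  | [] => .const 5 0
  | e :: es => .seq (.seq (.const 4 e.2.2) (.seq (addMul 4 10 e.1) (.seq (addMul 4 11 e.2.1)
      (.print 4)))) (emitList es)

theorem emitList_spec (es : List (ℤ × ℤ × ℤ)) : ∃ T, ∀ s : State,
    Does (emitList es) s T fun s' => s'.mem = s.mem ∧ s'.reg 0 = s.reg 0 ∧ s'.reg 1 = s.reg 1 ∧
      s'.out = s.out ++ es.map (affine (s.reg 10, s.reg 11)) := by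
  induction es with
  | nil => exact ⟨1, fun s => .const ⟨rfl, by simp, by simp, by simp⟩⟩
  | cons e es ih =>
    obtain ⟨T, hT⟩ := ih
    refine ⟨(1 + ((e.1.natAbs + 1) + ((e.2.1.natAbs + 1) + 1))) + T, fun s => ?_⟩
    refine .seq (.seq (.const (.seq ((addMul_spec (by omega) _ _).mono le_rfl ?_))))
    rintro s₁ ⟨hm₁, ho₁, h₁, hr₁⟩
    refine .seq ((addMul_spec (by omega) _ _).mono le_rfl ?_)
    rintro s₂ ⟨hm₂, ho₂, h₂, hr₂⟩
    refine .print ((hT _).mono le_rfl ?_)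
    rintro s₃ ⟨hm₃, h₀₃, h₁₃, ho₃⟩
    refine ⟨by simp [hm₃, hm₂, hm₁], by simp [h₀₃, hr₂, hr₁], by simp [h₁₃, hr₂, hr₁], ?_⟩
    rw [ho₃]
    simp [ho₂, ho₁, hr₂, hr₁, h₂, h₁, affine]

/-- Run `f v` where `v ≤ c` is the value of register `r`. -/
def switchProg (r : ℕ) : ℕ → (ℕ → Program) → Program
  | 0, f => f 0
  | c + 1, f => .ite r (.seq (.const 3 1) (.seq (.sub r r 3)
      (switchProg r c fun v => f (v + 1)))) (f 0)

/-- The register is counted down until it vanishes; the bound does not depend on its value, only on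
the size of the table. -/
theorem switchProg_spec {r : ℕ} (hr : r ≠ 3) {T : ℕ} {Q : State → Prop} (c : ℕ)
    (f : ℕ → Program) (s : State) {v : ℕ} (hv : v ≤ c) (hs : s.reg r = v)
    (hf : ∀ s' : State, s'.mem = s.mem → s'.out = s.out →
      (∀ i, i ≠ 3 → i ≠ r → s'.reg i = s.reg i) → Does (f v) s' T Q) :
    Does (switchProg r c f) s (3 * c + T) Q := by
  induction c generalizing f s v with
  | zero =>
    obtain rfl : v = 0 := by omega
    exact (hf s rfl rfl fun _ _ _ => rfl).mono (by omega) fun _ h => h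
  | succ c ih =>
    cases v with
    | zero =>
      exact (Does.ite_neg (by simp [hs]) (hf s rfl rfl fun _ _ _ => rfl)).mono (by omega)
        fun _ h => h
    | succ v =>
      refine (Does.ite_pos (by rw [hs]; positivity) (.seq (.const (.seq (.sub
        (ih _ _ (v := v) (by omega) ?_ ?_)))))).mono (by omega) fun _ h => h
      · simp [hr, hs]
      · intro s' hm ho hreg
        exact hf s' hm ho fun i h₃ h => by simp [hreg i h₃ h, h₃, h]

/-- The function on the sides with the given values. -/
def sides {α : Type*} (a b c d : α) : Dir → α
  | .right => a
  | .up => b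
  | .left => c
  | .down => d

theorem sides_eta {α : Type*} (f : Dir → α) :
    sides (f .right) (f .up) (f .left) (f .down) = f := by
  funext d; cases d <;> rfl

/-- Load six consecutive integers to the registers `10`, …, `15`. -/
def loadRecord : Program :=
  .seq (.const 3 1) (.seq (.load 10 1) (.seq (.add 5 1 3) (.seq (.load 11 5) (.seq (.add 5 5 3)
    (.seq (.load 12 5) (.seq (.add 5 5 3) (.seq (.load 13 5) (.seq (.add 5 5 3)
      (.seq (.load 14 5) (.seq (.add 5 5 3) (.load 15 5)))))))))))

theorem loadRecord_spec (s : State) : Does loadRecord s 12 fun s' =>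
    s'.mem = s.mem ∧ s'.out = s.out ∧ s'.reg 0 = s.reg 0 ∧ s'.reg 1 = s.reg 1 ∧
    s'.reg 10 = s.mem (s.reg 1) ∧ s'.reg 11 = s.mem (s.reg 1 + 1) ∧
    s'.reg 12 = s.mem (s.reg 1 + 2) ∧ s'.reg 13 = s.mem (s.reg 1 + 3) ∧
    s'.reg 14 = s.mem (s.reg 1 + 4) ∧ s'.reg 15 = s.mem (s.reg 1 + 5) := by
  refine (Does.seq (.const (.seq (.load (.seq (.add (.seq (.load (.seq (.add (.seq (.load (.seq
    (.add (.seq (.load (.seq (.add (.seq (.load (.seq (.add (.load ?_))))))))))))))))))))))).mono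
    le_rfl fun _ h => h
  simp [add_assoc]

/-- The record of a cell with codes of its four sides. -/
def codeRecord (code : Cell → Dir → ℕ) (p : Cell) : List ℤ :=
  [p.1, p.2, code p .right, code p .up, code p .left, code p .down]

/-- A program that replaces the record of each cell by the values at the cell of affine forms that
depend on the codes. -/
theorem exists_transducer (c : ℕ) (g : (Dir → ℕ) → List (ℤ × ℤ × ℤ)) :
    ∃ (prog : Program) (C : ℕ), ∀ (L : List Cell) (code : Cell → Dir → ℕ),
      (∀ p d, code p d ≤ c) → Does prog (State.init (L.flatMap (codeRecord code)))
        (C * L.length + 1) fun s => s.out = L.flatMap fun p => (g (code p)).map (affine p) := by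
  choose T hT using fun es => emitList_spec es
  let I := Finset.range (c + 1)
  -- There are finitely many combinations of codes, so the running times of their output programs
  -- have a common bound.
  obtain ⟨M, hM⟩ : ∃ M, ∀ v₁ ≤ c, ∀ v₂ ≤ c, ∀ v₃ ≤ c, ∀ v₄ ≤ c,
      T (g (sides v₁ v₂ v₃ v₄)) ≤ M := by
    refine ⟨(I ×ˢ I ×ˢ I ×ˢ I).sup fun v => T (g (sides v.1 v.2.1 v.2.2.1 v.2.2.2)), ?_⟩
    intro v₁ h₁ v₂ h₂ v₃ h₃ v₄ h₄
    refine Finset.le_sup (f := fun v : ℕ × ℕ × ℕ × ℕ =>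
      T (g (sides v.1 v.2.1 v.2.2.1 v.2.2.2))) (b := (v₁, v₂, v₃, v₄)) ?_
    simp [I]; omega
  refine ⟨recordLoop 6 (.seq loadRecord (switchProg 12 c fun v₁ => switchProg 13 c fun v₂ =>
    switchProg 14 c fun v₃ => switchProg 15 c fun v₄ => emitList (g (sides v₁ v₂ v₃ v₄)))),
    12 + (3 * c + (3 * c + (3 * c + (3 * c + M)))) + 4, fun L code hc => ?_⟩
  refine recordLoop_out (w := 6) (by omega) _ (fun _ => rfl) _ L ?_
  intro p _ s hs
  have e₀ := hs 0 (by omega)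
  have e₁ := hs 1 (by omega)
  have e₂ := hs 2 (by omega)
  have e₃ := hs 3 (by omega)
  have e₄ := hs 4 (by omega)
  have e₅ := hs 5 (by omega)
  simp only [codeRecord, Nat.cast_ofNat, Nat.cast_zero, add_zero, Nat.cast_one,
    List.getD_eq_getElem?_getD, List.getElem?_cons_succ,
    Option.getD_some, List.getElem?_cons, if_true] at e₀ e₁ e₂ e₃ e₄ e₅
  refine .seq ((loadRecord_spec s).mono le_rfl ?_)
  rintro s₁ ⟨hm₁, ho₁, h₀, h₁, h10, h11, h12, h13, h14, h15⟩
  refine switchProg_spec (by omega) c _ s₁ (hc p .right) (by rw [h12, e₂]) ?_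
  intro s₂ hm₂ ho₂ hr₂
  refine switchProg_spec (by omega) c _ s₂ (hc p .up) (by simp [hr₂, h13, e₃]) ?_
  intro s₃ hm₃ ho₃ hr₃
  refine switchProg_spec (by omega) c _ s₃ (hc p .left) (by simp [hr₃, hr₂, h14, e₄]) ?_
  intro s₄ hm₄ ho₄ hr₄
  refine switchProg_spec (by omega) c _ s₄ (hc p .down) (by simp [hr₄, hr₃, hr₂, h15, e₅]) ?_
  intro s₅ hm₅ ho₅ hr₅
  rw [sides_eta]
  have hM' := hM _ (hc p .right) _ (hc p .up) _ (hc p .left) _ (hc p .down)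
  rw [sides_eta] at hM'
  refine (hT _ s₅).mono hM' ?_
  rintro s' ⟨hm, h₀', h₁', ho⟩
  refine ⟨by rw [hm, hm₅, hm₄, hm₃, hm₂, hm₁], ?_, ?_, ?_⟩
  · simp [h₀', hr₅, hr₄, hr₃, hr₂, h₀]
  · simp [h₁', hr₅, hr₄, hr₃, hr₂, h₁]
  · rw [ho, ho₅, ho₄, ho₃, ho₂, ho₁]
    simp [hr₅, hr₄, hr₃, hr₂, h10, h11, e₀, e₁]

/-! ### Finding the neighbours of the cells of a region -/

section Neighbours

/-- The constants that the program for the neighbours keeps in its registers: `N` is the length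
of the input and `o` is the first cell. -/
structure Constants (N : ℤ) (o : Cell) (s : State) : Prop where
  one : s.reg 20 = 1
  stride : s.reg 21 = N + 1
  len : s.reg 27 = N
  fst : s.reg 30 = o.1
  tab : s.reg 31 = -N - 1
  base : s.reg 32 = (N + 1) * (N + 1) + N - o.2
  two : s.reg 33 = 2

theorem Constants.congr {N : ℤ} {o : Cell} {s s' : State} (h : Constants N o s)
    (h' : ∀ i, 20 ≤ i → s'.reg i = s.reg i) : Constants N o s' where
  one := by rw [h' _ (by omega), h.one]
  stride := by rw [h' _ (by omega), h.stride]
  len := by rw [h' _ (by omega), h.len]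
  fst := by rw [h' _ (by omega), h.fst]
  tab := by rw [h' _ (by omega), h.tab]
  base := by rw [h' _ (by omega), h.base]
  two := by rw [h' _ (by omega), h.two]

/-- The address of the mark of the cell `p`. -/
def markAddr (N : ℤ) (o p : Cell) : ℤ :=
  (p.1 - o.1) * (N + 1) + p.2 + ((N + 1) * (N + 1) + N - o.2)

/-- The table of the multiples of `N + 1`. -/
def HasTable (N : ℤ) (m : ℤ → ℤ) : Prop := ∀ j, |j| ≤ N → m (j + (-N - 1)) = j * (N + 1)

/-- Load the cell at the address in register `1` to the registers `10`, `11`, and the address of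
its mark to register `6`. -/
def markAddrProg : Program :=
  .seq (.load 10 1) (.seq (.add 5 1 20) (.seq (.load 11 5) (.seq (.sub 6 10 30)
    (.seq (.add 6 6 31) (.seq (.load 6 6) (.seq (.add 6 6 11) (.add 6 6 32)))))))

/-- The only product of two variable quantities, column times row length, is looked up in the table.
-/
theorem markAddrProg_spec {N : ℤ} {o p : Cell} {s : State} (hc : Constants N o s)
    (ht : HasTable N s.mem) (h₁ : s.mem (s.reg 1) = p.1) (h₂ : s.mem (s.reg 1 + 1) = p.2)
    (hp : |p.1 - o.1| ≤ N) : Does markAddrProg s 8 fun s' =>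
      s'.mem = s.mem ∧ s'.out = s.out ∧ s'.reg 10 = p.1 ∧ s'.reg 11 = p.2 ∧
      s'.reg 6 = markAddr N o p ∧ s'.reg 0 = s.reg 0 ∧ s'.reg 1 = s.reg 1 ∧
      ∀ i, 20 ≤ i → s'.reg i = s.reg i := by
  refine (Does.seq (.load (.seq (.add (.seq (.load (.seq (.sub (.seq (.add (.seq (.load (.seq
    (.add (.add ?_))))))))))))))).mono le_rfl fun _ h => h
  refine ⟨rfl, rfl, ?_, ?_, ?_, ?_, ?_, ?_⟩
  · simp [h₁]
  · simp [h₂, hc.one]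
  · simp [h₁, h₂, hc.one, hc.fst, hc.tab, hc.base, ht _ hp, markAddr]
  · simp
  · simp
  · intro i hi
    simp [show i ≠ 5 ∧ i ≠ 6 ∧ i ≠ 10 ∧ i ≠ 11 by omega]

/-- Set up the constants; register `26` is the counter of the loop that makes the table. -/
def setupProg : Program :=
  .seq (.const 20 1) (.seq (.const 33 2) (.seq (.add 27 0 1) (.seq (.add 21 27 20)
    (.seq (.load 30 1) (.seq (.sub 31 1 21) (.seq (.add 24 31 1) (.seq (.add 25 31 1)
      (.seq (.add 26 21 1) (.load 34 20)))))))))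

/-- The table of multiples. -/
def tableProg : Program :=
  .loop 26 (.seq (.store 24 22) (.seq (.store 25 23) (.seq (.add 22 22 21) (.seq (.sub 23 23 21)
    (.seq (.add 24 24 20) (.seq (.sub 25 25 20) (.sub 26 26 20)))))))

/-- Positive and negative multiples are written outwards from the address `-n - 1`. The table fills
addresses from `-2 * n - 1` to `-1` and so leaves the input intact; as a by-product register `22`
ends with the square needed for the base address of the marks. -/
theorem tableProg_spec {n : ℕ} {s₀ : State} (h20 : s₀.reg 20 = 1) (h21 : s₀.reg 21 = n + 1)
    (h22 : s₀.reg 22 = 0) (h23 : s₀.reg 23 = 0) (h24 : s₀.reg 24 = -n - 1)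
    (h25 : s₀.reg 25 = -n - 1) (h26 : s₀.reg 26 = n + 1) :
    Does tableProg s₀ (8 * (n + 1) + 1) fun s => HasTable n s.mem ∧
      (∀ a, 0 ≤ a → s.mem a = s₀.mem a) ∧ s.out = s₀.out ∧
      s.reg 22 = (n + 1) * (n + 1) ∧
      ∀ i, i < 22 ∨ 26 < i → s.reg i = s₀.reg i := by
  refine (Does.loop (n := n + 1) (T := 7) (fun k s =>
    (∀ j : ℤ, |j| < k → s.mem (j + (-n - 1)) = j * (n + 1)) ∧
    (∀ a, 0 ≤ a → s.mem a = s₀.mem a) ∧ s.out = s₀.out ∧ s.reg 22 = k * (n + 1) ∧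
    s.reg 23 = -(k * (n + 1)) ∧ s.reg 24 = -n - 1 + k ∧ s.reg 25 = -n - 1 - k ∧
    s.reg 26 = n + 1 - k ∧ ∀ i, i < 22 ∨ 26 < i → s.reg i = s₀.reg i) ?_ ?_ ?_).mono le_rfl ?_
  · rintro k hk s ⟨ht, hm, ho, g22, g23, g24, g25, g26, hr⟩
    have g20 : s.reg 20 = 1 := by rw [hr _ (by omega), h20]
    have g21 : s.reg 21 = n + 1 := by rw [hr _ (by omega), h21]
    refine ⟨by omega, (Does.seq (.store (.seq (.store (.seq (.add (.seq (.sub (.seq (.add (.seq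
      (.sub (.sub ?_))))))))))))).mono le_rfl fun _ h => h⟩
    refine ⟨fun j hj => ?_, fun a ha => ?_, ho, ?_, ?_, ?_, ?_, ?_, ?_⟩
    · simp only [Function.update_apply, g24, g25, g22, g23]
      rw [abs_lt] at hj
      push_cast at hj
      split_ifs with h₁ h₂
      · obtain rfl : j = -k := by omega
        ring
      · obtain rfl : j = k := by omega
        ring
      · exact ht j (by rw [abs_lt]; omega)
    · simp only [Function.update_apply, g24, g25]
      rw [if_neg (by omega), if_neg (by omega), hm a ha]
    · simp [g22, g21]; ring
    · simp [g23, g21]; ring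
    · simp [g24, g20]; ring
    · simp [g25, g20]; ring
    · simp [g26, g20]; ring
    · intro i hi
      simp [show i ≠ 22 ∧ i ≠ 23 ∧ i ≠ 24 ∧ i ≠ 25 ∧ i ≠ 26 by omega, hr i hi]
  · rintro s ⟨-, -, -, -, -, -, -, g26, -⟩
    simp [g26]
  · refine ⟨fun j hj => ?_, fun _ _ => rfl, rfl, by simp [h22], by simp [h23], by simp [h24],
      by simp [h25], by simp [h26], fun _ _ => rfl⟩
    exact absurd hj (by simp)
  · rintro s ⟨ht, hm, ho, g22, -, -, -, -, hr⟩
    exact ⟨fun j hj => ht j (by push_cast; omega), hm, ho, by simpa using g22, hr⟩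

/-- Mark the cells. -/
def markProg : Program :=
  .loop 0 (.seq markAddrProg (.seq (.store 6 20) (.seq (.add 1 1 33) (.sub 0 0 33))))

/-- Print the code of the neighbour whose mark stands at the address in register `7`. -/
def printAbsent : Program := .seq (.load 8 7) (.seq (.sub 8 20 8) (.print 8))

/-- Print the records of the cells. -/
def printProg : Program :=
  .loop 0 (.seq markAddrProg (.seq (.print 10) (.seq (.print 11)
    (.seq (.add 7 6 21) (.seq printAbsent
    (.seq (.add 7 6 20) (.seq printAbsent
    (.seq (.sub 7 6 21) (.seq printAbsent
    (.seq (.sub 7 6 20) (.seq printAbsent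
    (.seq (.add 1 1 33) (.sub 0 0 33)))))))))))))

/-- The program that finds the boundary edges of a region. -/
def neighbourProg : Program :=
  .seq setupProg (.seq tableProg (.seq (.add 32 22 27) (.seq (.sub 32 32 34) (.seq markProg
    (.seq (.const 1 0) (.seq (.add 0 27 1) printProg))))))

/-- The summand `(N + 1) * (N + 1) + N` outweighs the most negative offset, so that the marks stand
behind the input of length `N`. -/
theorem markAddr_ge {N : ℤ} {o p : Cell} (h₁ : |p.1 - o.1| ≤ N) (h₂ : |p.2 - o.2| ≤ N) :
    N ≤ markAddr N o p := by
  rw [abs_le] at h₁ h₂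
  unfold markAddr
  nlinarith

/-- The second coordinates differ by at most `2 * n`, less than the row length `2 * n + 1`; hence
the address determines first the column and then the height. -/
theorem markAddr_inj {n : ℤ} {o p q : Cell} (hp₁ : |p.1 - o.1| ≤ n) (hp₂ : |p.2 - o.2| ≤ n)
    (hq₁ : |q.1 - o.1| ≤ n) (hq₂ : |q.2 - o.2| ≤ n)
    (h : markAddr (2 * n) o p = markAddr (2 * n) o q) : p = q := by
  rw [abs_le] at hp₁ hp₂ hq₁ hq₂
  unfold markAddr at h
  have h₁ : p.1 = q.1 := by
    by_contra hne
    rcases lt_or_gt_of_ne hne with hlt | hlt <;> nlinarith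
  rw [h₁] at h
  exact Prod.ext h₁ (by linarith)

/-- The memory holds the cells of `L`, the table, and the marks of the cells of `L'`. -/
structure Marked (L L' : List Cell) (o : Cell) (m : ℤ → ℤ) : Prop where
  tab : HasTable (2 * L.length) m
  fst : ∀ (k : ℕ) (hk : k < L.length), m (2 * k) = L[k].1
  snd : ∀ (k : ℕ) (hk : k < L.length), m (2 * k + 1) = L[k].2
  mark : ∀ a : ℤ, 2 * L.length ≤ a →
    m a = if ∃ p ∈ L', markAddr (2 * L.length) o p = a then 1 else 0

variable {L : List Cell} {o : Cell}

theorem markProg_spec (hL : ∀ p ∈ L, |p.1 - o.1| < L.length ∧ |p.2 - o.2| < L.length)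
    {s : State} (hc : Constants (2 * L.length) o s) (hm : Marked L [] o s.mem)
    (h₀ : s.reg 0 = 2 * L.length) (h₁ : s.reg 1 = 0) (ho : s.out = []) :
    Does markProg s (12 * L.length + 1) fun s' => Constants (2 * L.length) o s' ∧
      Marked L L o s'.mem ∧ s'.out = [] := by
  refine (Does.loop (n := L.length) (T := 11) (fun k s => Constants (2 * L.length) o s ∧
    Marked L (L.take k) o s.mem ∧ s.reg 0 = 2 * (L.length - k) ∧ s.reg 1 = 2 * k ∧ s.out = [])
    ?_ ?_ ⟨hc, by simpa using hm, by simp [h₀], by simp [h₁], ho⟩).mono le_rfl ?_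
  · rintro k hk s ⟨hc, hm, h₀, h₁, ho⟩
    refine ⟨by omega, ?_⟩
    have hb := hL L[k] (List.getElem_mem hk)
    have hge := markAddr_ge (N := 2 * L.length) (o := o) (p := L[k]) (by omega) (by omega)
    refine Does.seq (T := 8) (T' := 3) ((markAddrProg_spec hc hm.tab (p := L[k])
      (by rw [h₁, hm.fst k hk]) (by rw [h₁, hm.snd k hk]) (by omega)).mono le_rfl ?_)
    rintro s' ⟨hm', ho', -, -, h₆', h₀', h₁', hr'⟩
    have hc' := hc.congr hr'
    refine (Does.seq (.store (.seq (.add (.sub ?_))))).mono le_rfl fun _ h => h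
    refine ⟨hc'.congr fun i hi => ?_, ⟨fun j hj => ?_, fun i hi => ?_, fun i hi => ?_,
      fun a ha => ?_⟩, ?_, ?_, ?_⟩
    · simp [show i ≠ 0 ∧ i ≠ 1 by omega]
    · rw [abs_le] at hj
      simp only [Function.update_apply, h₆', hm']
      rw [if_neg (by omega)]
      exact hm.tab j (by rw [abs_le]; omega)
    · simp only [Function.update_apply, h₆', hm']
      rw [if_neg (by omega), hm.fst i hi]
    · simp only [Function.update_apply, h₆', hm']
      rw [if_neg (by omega), hm.snd i hi]
    · have e : L.take (k + 1) = L.take k ++ [L[k]] := by simp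
      simp only [Function.update_apply, h₆', hm', hc'.one, e, List.mem_append,
        List.mem_singleton, or_and_right, exists_or, exists_eq_left]
      rw [hm.mark a ha]
      by_cases h : markAddr (2 * L.length) o L[k] = a
      · simp [h]
      · simp only [h, Ne.symm h, or_false, if_false]
    · simp [h₀', h₀, hc'.two]; ring
    · simp [h₁', h₁, hc'.two]; ring
    · simp [ho', ho]
  · rintro s ⟨-, -, h₀, -, -⟩
    simp [h₀]
  · rintro s ⟨hc, hm, -, -, ho⟩
    exact ⟨hc, by simpa using hm, ho⟩

/-- The code of a side: `1` if there is no neighbour across it, and `0` if there is one. -/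
def absentCode (L : List Cell) (p : Cell) (d : Dir) : ℕ := if p + d.vec ∈ L then 0 else 1

theorem Marked.eq_absent (hL : ∀ p ∈ L, |p.1 - o.1| < L.length ∧ |p.2 - o.2| < L.length)
    {m : ℤ → ℤ} (hm : Marked L L o m) {p : Cell} (hp : p ∈ L) (d : Dir) :
    1 - m (markAddr (2 * L.length) o (p + d.vec)) = absentCode L p d := by
  have hb := hL p hp
  have hd := d.vec_bound
  rw [abs_lt, abs_lt] at hb
  -- The bound for cells of the region is strict, which leaves room for their neighbours.
  have h₁ : |(p + d.vec).1 - o.1| ≤ L.length := by rw [abs_le]; simp; omega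
  have h₂ : |(p + d.vec).2 - o.2| ≤ L.length := by rw [abs_le]; simp; omega
  have hge : 2 * (L.length : ℤ) ≤ markAddr (2 * L.length) o (p + d.vec) :=
    markAddr_ge (by omega) (by omega)
  rw [hm.mark _ hge, absentCode]
  have : (∃ q ∈ L, markAddr (2 * L.length) o q = markAddr (2 * L.length) o (p + d.vec)) ↔
      p + d.vec ∈ L := by
    constructor
    · rintro ⟨q, hq, h⟩
      rwa [← markAddr_inj (hL q hq).1.le (hL q hq).2.le h₁ h₂ h]
    · exact fun h => ⟨_, h, rfl⟩
  simp only [this]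
  split_ifs <;> simp

theorem printAbsent_spec (s : State) (h : s.reg 20 = 1) : Does printAbsent s 3 fun s' =>
    s'.mem = s.mem ∧ s'.out = s.out ++ [1 - s.mem (s.reg 7)] ∧
      ∀ i, i ≠ 8 → s'.reg i = s.reg i := by
  refine (Does.seq (.load (.seq (.sub (.print ?_))))).mono le_rfl fun _ h => h
  refine ⟨rfl, by simp [h], fun i hi => by simp [hi]⟩

theorem printProg_spec (hL : ∀ p ∈ L, |p.1 - o.1| < L.length ∧ |p.2 - o.2| < L.length)
    {s : State} (hc : Constants (2 * L.length) o s) (hm : Marked L L o s.mem)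
    (h₀ : s.reg 0 = 2 * L.length) (h₁ : s.reg 1 = 0) (ho : s.out = []) :
    Does printProg s (29 * L.length + 1) fun s' =>
      s'.out = L.flatMap (codeRecord (absentCode L)) := by
  refine (Does.loop (n := L.length) (T := 28) (fun k s => Constants (2 * L.length) o s ∧
    Marked L L o s.mem ∧ s.reg 0 = 2 * (L.length - k) ∧ s.reg 1 = 2 * k ∧
    s.out = (L.take k).flatMap (codeRecord (absentCode L)))
    ?_ ?_ ⟨hc, by simpa using hm, by simp [h₀], by simp [h₁], by simp [ho]⟩).mono le_rfl ?_
  · rintro k hk s ⟨hc, hm, h₀, h₁, ho⟩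
    refine ⟨by omega, ?_⟩
    have hp := List.getElem_mem hk
    have hb := hL L[k] hp
    refine (Does.seq ((markAddrProg_spec hc hm.tab (p := L[k]) (by rw [h₁, hm.fst k hk])
      (by rw [h₁, hm.snd k hk]) (by omega)).mono le_rfl ?_)).mono
      (T := 8 + (1 + (1 + (1 + (3 + (1 + (3 + (1 + (3 + (1 + (3 + 2)))))))))))
      (by omega)
      fun _ h => h
    rintro s' ⟨hm', ho', h10, h11, h₆', h₀', h₁', hr'⟩
    have hc' := hc.congr hr'
    refine .seq (.print (.seq (.print ?_)))
    refine .seq (.add (.seq ((printAbsent_spec _ ?_).mono le_rfl ?_)))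
    · simp [hc'.one]
    rintro s₁ ⟨hm₁, ho₁, hr₁⟩
    refine .seq (.add (.seq ((printAbsent_spec _ ?_).mono le_rfl ?_)))
    · simp [hr₁, hc'.one]
    rintro s₂ ⟨hm₂, ho₂, hr₂⟩
    refine .seq (.sub (.seq ((printAbsent_spec _ ?_).mono le_rfl ?_)))
    · simp [hr₂, hr₁, hc'.one]
    rintro s₃ ⟨hm₃, ho₃, hr₃⟩
    refine .seq (.sub (.seq ((printAbsent_spec _ ?_).mono le_rfl ?_)))
    · simp [hr₃, hr₂, hr₁, hc'.one]
    rintro s₄ ⟨hm₄, ho₄, hr₄⟩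
    refine (Does.seq (.add (.sub ?_))).mono le_rfl fun _ h => h
    simp only at hm₁ hm₂ hm₃ hm₄
    refine ⟨hc'.congr fun i hi => ?_, ?_, ?_, ?_, ?_⟩
    · simp [show i ≠ 0 ∧ i ≠ 1 ∧ i ≠ 7 ∧ i ≠ 8 by omega, hr₄, hr₃, hr₂, hr₁]
    · simpa [hm₄, hm₃, hm₂, hm₁, hm'] using hm
    · simp [hr₄, hr₃, hr₂, hr₁, h₀', h₀, hc'.two]; ring
    · simp [hr₄, hr₃, hr₂, hr₁, h₁', h₁, hc'.two]; ring
    · have e : L.take (k + 1) = L.take k ++ [L[k]] := by simp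
      have e₁ := hm.eq_absent hL hp .right
      have e₂ := hm.eq_absent hL hp .up
      have e₃ := hm.eq_absent hL hp .left
      have e₄ := hm.eq_absent hL hp .down
      rw [e]
      simp only [List.flatMap_append, List.flatMap_singleton, codeRecord, ← e₁, ← e₂, ← e₃, ← e₄]
      simp [ho₄, ho₃, ho₂, ho₁, ho', ho, h10, h11, h₆', hm₃, hm₂, hm₁, hm', hr₃, hr₂, hr₁,
        hc'.one, hc'.stride, Dir.vec, markAddr]
      refine ⟨?_, ?_, ?_, ?_⟩ <;> · congr 1; ring
  · rintro s ⟨-, -, h₀, -, -⟩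
    simp [h₀]
  · rintro s ⟨-, -, -, -, ho⟩
    simpa using ho

theorem neighbourProg_out (hL₀ : L ≠ [])
    (hL : ∀ p ∈ L, ∀ q ∈ L, |q.1 - p.1| < L.length ∧ |q.2 - p.2| < L.length) :
    Does neighbourProg (State.init (L.flatMap fun p => [p.1, p.2])) (90 * L.length) fun s =>
      s.out = L.flatMap (codeRecord (absentCode L)) := by
  have hlen : 0 < L.length := List.length_pos_iff.2 hL₀
  have hl : (L.flatMap fun p => [p.1, p.2]).length = 2 * L.length :=
    length_flatMap_const (w := 2) (fun p : Cell => [p.1, p.2]) (fun _ => rfl) L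
  have hf : ∀ (k : ℕ) (hk : k < L.length),
      (State.init (L.flatMap fun p => [p.1, p.2])).mem (2 * k) = L[k].1 := by
    intro k hk
    simpa using init_mem_flatMap (w := 2) (fun p : Cell => [p.1, p.2]) (fun _ => rfl) L hk
      (j := 0) (by omega)
  have hs : ∀ (k : ℕ) (hk : k < L.length),
      (State.init (L.flatMap fun p => [p.1, p.2])).mem (2 * k + 1) = L[k].2 := by
    intro k hk
    simpa using init_mem_flatMap (w := 2) (fun p : Cell => [p.1, p.2]) (fun _ => rfl) L hk
      (j := 1) (by omega)
  have h0 : (State.init (L.flatMap fun p => [p.1, p.2])).reg 0 = 2 * L.length := by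
    simp [State.init, hl, -List.length_flatMap]
  have hr : ∀ i, i ≠ 0 → (State.init (L.flatMap fun p => [p.1, p.2])).reg i = 0 := by
    intro i hi; simp [State.init, hi]
  have hz : ∀ a, 2 * (L.length : ℤ) ≤ a →
      (State.init (L.flatMap fun p => [p.1, p.2])).mem a = 0 := by
    intro a ha
    simp only [State.init]
    rw [if_pos (by omega), List.getD_eq_default]
    omega
  have hout : (State.init (L.flatMap fun p => [p.1, p.2])).out = [] := rfl
  generalize State.init (L.flatMap fun p => [p.1, p.2]) = s at *
  set o := L[0]
  have hLo : ∀ p ∈ L, |p.1 - o.1| < L.length ∧ |p.2 - o.2| < L.length :=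
    fun p hp => hL o (List.getElem_mem _) p hp
  have hf₀ : s.mem 0 = o.1 := by simpa using hf 0 hlen
  have hs₀ : s.mem 1 = o.2 := by simpa using hs 0 hlen
  refine Does.mono (T := 10 + ((8 * (2 * L.length + 1) + 1) + (1 + (1 + ((12 * L.length + 1) +
    (1 + (1 + (29 * L.length + 1)))))))) ?_ (by omega) fun _ h => h
  refine .seq ((Does.seq (.const (.seq (.const (.seq (.add (.seq (.add (.seq (.load (.seq
    (.sub (.seq (.add (.seq (.add (.seq (.add (.load ?_))))))))))))))))))).mono le_rfl
    fun _ h => h)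
  refine .seq ((tableProg_spec (n := 2 * L.length) ?_ ?_ ?_ ?_ ?_ ?_ ?_).mono le_rfl ?_)
  · simp
  · simp [hr, h0]
  · simp [hr]
  · simp [hr]
  · simp [hr, h0]; ring
  · simp [hr, h0]; ring
  · simp [hr, h0]
  rintro s₁ ⟨ht, hm₁, ho₁, g22, hr₁⟩
  push_cast at ht g22
  refine .seq (.add (.seq (.sub (.seq ((markProg_spec (L := L) (o := o) hLo ?_ ?_ ?_ ?_ ?_).mono
    le_rfl ?_)))))
  · constructor
    · simp [hr₁]
    · simp [hr₁, hr, h0]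
    · simp [hr₁, hr, h0]
    · simp [hr₁, hr, hf₀]
    · simp [hr₁, hr, h0]; ring
    · simp [hr₁, hr, h0, g22, hs₀]
    · simp [hr₁]
  · refine ⟨ht, fun k hk => ?_, fun k hk => ?_, fun a ha => ?_⟩
    · exact (hm₁ _ (by omega)).trans (hf k hk)
    · exact (hm₁ _ (by omega)).trans (hs k hk)
    · simpa using (hm₁ _ (by omega)).trans (hz a ha)
  · simp [hr₁, h0]
  · simp [hr₁, hr]
  · simpa using ho₁.trans hout
  rintro s₂ ⟨hc₂, hm₂, ho₂⟩
  refine .seq (.const (.seq (.add (printProg_spec hLo (hc₂.congr fun i hi => ?_) hm₂ ?_ ?_ ho₂))))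
  · simp [show i ≠ 0 ∧ i ≠ 1 by omega]
  · simp [hc₂.len]
  · simp

end Neighbours

/-! ### Descriptions of labelled regions and reductions between them -/

/-- The code of a side as a natural number. -/
def LabelledRegion.natCode {c : ℕ} (G : LabelledRegion (Fin c)) (p : Cell) (d : Dir) : ℕ :=
  if h : p ∈ G.cells ∧ p + d.vec ∉ G.cells then (G.label ⟨(p, d), h⟩ : ℕ) + 1 else 0

section

variable {c : ℕ} (G : LabelledRegion (Fin c))

theorem LabelledRegion.natCode_le (p : Cell) (d : Dir) : G.natCode p d ≤ c := by
  unfold natCode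
  split_ifs with h
  · exact (G.label ⟨(p, d), h⟩).isLt
  · omega

theorem LabelledRegion.natCode_of_mem {p : Cell} {d : Dir} (h : p + d.vec ∈ G.cells) :
    G.natCode p d = 0 := by
  simp [natCode, h]

theorem LabelledRegion.natCode_of_notMem {p : Cell} {d : Dir} (hp : p ∈ G.cells)
    (h : p + d.vec ∉ G.cells) : G.natCode p d = G.label ⟨(p, d), hp, h⟩ + 1 := by
  simp [natCode, hp, h]

theorem LabelledRegion.natCode_outside {p : Cell} {d : Dir} (hp : p ∉ G.cells) :
    G.natCode p d = 0 := by
  simp [natCode, hp]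

theorem LabelledRegion.sideCode_eq (p : Cell) (d : Dir) : G.sideCode p d = G.natCode p d := by
  unfold sideCode natCode
  split_ifs <;> simp

theorem LabelledRegion.describes_iff {l : List ℤ} : G.Describes l ↔
    ∃ L : List Cell, L.Nodup ∧ (∀ p, p ∈ L ↔ p ∈ G.cells) ∧
      l = L.flatMap (codeRecord G.natCode) := by
  simp only [LabelledRegion.Describes, G.sideCode_eq]
  rfl

end

theorem Region.card_pos (G : Region) : 0 < G.cells.card := by
  obtain ⟨⟨p, hp⟩⟩ := G.connected.nonempty
  exact Finset.card_pos.2 ⟨p, hp⟩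

/-- A map given by a local transducer is computable in linear time. -/
theorem linearTimeComputable_of_transducer {c : ℕ} {Y : LabelledRegion (Fin c) → Prop}
    {B : Problem} (f : LabelledRegion (Fin c) → B.Inst) (g : (Dir → ℕ) → List (ℤ × ℤ × ℤ))
    (h : ∀ (G : LabelledRegion (Fin c)) (L : List Cell), L.Nodup → (∀ p, p ∈ L ↔ p ∈ G.cells) →
      B.Describes (L.flatMap fun p => (g (G.natCode p)).map (affine p)) (f G)) :
    LinearTimeComputable
      ⟨LabelledRegion (Fin c), fun G => G.cells.card, fun l G => G.Describes l, Y⟩ B f := by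
  obtain ⟨prog, C, hprog⟩ := exists_transducer c g
  refine ⟨prog, C + 1, fun G l hl => ?_⟩
  obtain ⟨L, hL, hmem, rfl⟩ := G.describes_iff.1 hl
  obtain ⟨t, ht, s, hrun, hs⟩ := hprog L G.natCode G.natCode_le
  refine ⟨t, s, hrun, ?_, by rw [hs]; exact h G L hL hmem⟩
  have h₁ := card_eq_length hL hmem
  -- A region has at least one cell, which pays for the constant term of the running time.
  have h₂ := G.card_pos
  simp only
  rw [← h₁] at ht
  nlinarith

/-- A map that preserves descriptions is computable in linear time. -/
theorem linearTimeComputable_of_copy {A B : Problem} {C : ℕ} (f : A.Inst → B.Inst)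
    (hA : ∀ l G, A.Describes l G → 0 < A.size G ∧ l.length ≤ C * A.size G)
    (h : ∀ l G, A.Describes l G → B.Describes l (f G)) : LinearTimeComputable A B f := by
  refine ⟨copyProg, 6 * C + 1, fun G l hl => ?_⟩
  obtain ⟨t, ht, s, hrun, hs⟩ := copyProg_out l
  refine ⟨t, s, hrun, ?_, by rw [hs]; exact h l G hl⟩
  obtain ⟨h₁, h₂⟩ := hA l G hl
  nlinarith

theorem Region.Describes.length_le {l : List ℤ} {G : Region} (h : G.Describes l) :
    l.length ≤ 2 * G.cells.card := by
  obtain ⟨L, hL, h, rfl⟩ := h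
  rw [card_eq_length hL h]
  exact (length_flatMap_const (w := 2) _ (fun _ => rfl) L).le

theorem LabelledRegion.Describes.length_le {c : ℕ} {l : List ℤ} {G : LabelledRegion (Fin c)}
    (h : G.Describes l) : l.length ≤ 6 * G.cells.card := by
  obtain ⟨L, hL, h, rfl⟩ := h
  rw [card_eq_length hL h]
  exact (length_flatMap_const (w := 6) _ (fun _ => rfl) L).le

/-! ### From rectangles to ordinary tiles -/

theorem rectangles_reducible_ordinaryTiles : LinearTimeReducible rectangles ordinaryTiles :=
  fun T => ⟨T.1, id, linearTimeComputable_of_copy (A := rectangles.problem T) (C := 2) id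
    (fun _ G hl => ⟨G.card_pos, hl.length_le⟩) fun _ _ hl => hl, fun _ => Iff.rfl⟩

/-! ### From ordinary tiles to generalized Wang tiles -/

/-- A region with one colour on its boundary. -/
def Region.monochrome (G : Region) : LabelledRegion (Fin 1) := { G with label := fun _ => 0 }

/-- A tile with one colour on its boundary. -/
def Tile.monochrome (t : Tile) : WangTile (Fin 1) := { t with label := fun _ => 0 }

/-- The underlying tile. -/
def WangTile.toTile {C : Type} (t : WangTile C) : Tile := { t with }

theorem monochrome_toTile (t : WangTile (Fin 1)) : t.toTile.monochrome = t := by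
  obtain ⟨⟨r, l⟩, n⟩ := t
  have : l = fun _ => 0 := funext fun _ => Subsingleton.elim _ _
  subst this
  rfl

theorem Tile.toTile_monochrome (t : Tile) : t.monochrome.toTile = t := rfl

def monochromeEquiv : Tile ≃ WangTile (Fin 1) where
  toFun := Tile.monochrome
  invFun := WangTile.toTile
  left_inv := Tile.toTile_monochrome
  right_inv := monochrome_toTile

theorem IsTiling.map {τ τ' : Type} {shape : τ → Finset Cell} {shape' : τ' → Finset Cell}
    (e : τ ≃ τ') (he : ∀ t, shape' (e t) = shape t) {S : Finset Cell} {P : Finset (τ × Cell)}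
    (h : IsTiling shape S P) :
    IsTiling shape' S (P.map (e.prodCongr (Equiv.refl Cell)).toEmbedding) := by
  refine ⟨fun a ha p hp => ?_, fun p hp => ?_⟩
  · obtain ⟨a, ha', rfl⟩ := Finset.mem_map.1 ha
    exact h.1 a ha' p (by simpa [he] using hp)
  · obtain ⟨a, ⟨ha, hpa⟩, hu⟩ := h.2 p hp
    refine ⟨(e a.1, a.2), ⟨Finset.mem_map.2 ⟨a, ha, rfl⟩, by simpa [he] using hpa⟩, ?_⟩
    rintro b ⟨hb, hpb⟩
    obtain ⟨b, hb', rfl⟩ := Finset.mem_map.1 hb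
    rw [hu b ⟨hb', by simpa [he] using hpb⟩]
    rfl

theorem tileable_iff_monochrome (T : Finset Tile) (G : Region) :
    Tileable T G ↔ WangTileable (T.map monochromeEquiv.toEmbedding) G.monochrome := by
  constructor
  · rintro ⟨P, hP, ht⟩
    refine ⟨_, fun a ha => ?_, ht.map monochromeEquiv fun t => rfl,
      fun _ _ _ _ _ _ _ _ => Subsingleton.elim _ _, fun _ _ _ _ _ _ => Subsingleton.elim _ _⟩
    obtain ⟨a, ha', rfl⟩ := Finset.mem_map.1 ha
    exact Finset.mem_map.2 ⟨_, hP a ha', rfl⟩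
  · rintro ⟨P, hP, ht, -⟩
    refine ⟨_, fun a ha => ?_, ht.map monochromeEquiv.symm fun t => rfl⟩
    obtain ⟨a, ha', rfl⟩ := Finset.mem_map.1 ha
    obtain ⟨t, h, h'⟩ := Finset.mem_map.1 (hP a ha')
    have : monochromeEquiv.symm a.1 = t := by rw [← h']; exact monochromeEquiv.symm_apply_apply t
    simpa [this] using h

/-- With one colour the code of a side is `1` on the boundary and `0` elsewhere, which is exactly
what the search for neighbours prints. -/
theorem monochrome_describes {G : Region} {L : List Cell} (hL : L.Nodup)
    (h : ∀ p, p ∈ L ↔ p ∈ G.cells) :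
    G.monochrome.Describes (L.flatMap (codeRecord (absentCode L))) := by
  refine G.monochrome.describes_iff.2 ⟨L, hL, h, ?_⟩
  have key : ∀ p ∈ L, ∀ d, absentCode L p d = G.monochrome.natCode p d := by
    intro p hp d
    rw [absentCode]
    split_ifs with h'
    · exact (G.monochrome.natCode_of_mem ((h _).1 h')).symm
    · rw [G.monochrome.natCode_of_notMem ((h _).1 hp) (mt (h _).2 h')]
      simp
  refine List.flatMap_congr fun p hp => ?_
  simp [codeRecord, key p hp]

theorem ordinaryTiles_reducible_generalizedWangTiles :
    LinearTimeReducibleSameCard ordinaryTiles generalizedWangTiles := by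
  intro T
  refine ⟨⟨1, T.map monochromeEquiv.toEmbedding⟩, Region.monochrome, Finset.card_map _, ?_,
    tileable_iff_monochrome T⟩
  refine ⟨neighbourProg, 90, fun G l hl => ?_⟩
  obtain ⟨L, hL, h, rfl⟩ := hl
  have hc := card_eq_length hL h
  have hpos := G.card_pos
  obtain ⟨t, ht, s, hrun, hs⟩ := neighbourProg_out (L := L)
    (List.length_pos_iff.1 (by omega)) fun p hp q hq => by
      rw [← hc]; exact G.abs_sub_lt ((h p).1 hp) ((h q).1 hq)
  refine ⟨t, s, hrun, ?_, by rw [hs]; exact monochrome_describes hL h⟩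
  rw [← hc] at ht
  exact ht

/-! ### Unit Wang tiles -/

theorem cell_zero : ((0, 0) : Cell) = 0 := rfl

theorem box_one : box 0 1 1 = {(0, 0)} := by
  ext ⟨x, y⟩
  simp only [mem_box, Finset.mem_singleton, Prod.mk.injEq, Prod.fst_zero, Prod.snd_zero]
  omega

/-- The unit square as a Wang tile with given colours. -/
def unitWang {C : Type} (col : Dir → C) : WangTile C where
  cells := {(0, 0)}
  connected := by
    rw [← box_one]; exact box_connected (by omega) (by omega) 0
  noHoles := by rw [← box_one]; exact box_noHoles 0 1 1
  label e := col e.1.2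
  normal := by simp [InNormalPosition]

theorem exists_eq_unitWang {C : Type} (t : WangTile C) (ht : t.cells = {(0, 0)}) :
    ∃ col, t = unitWang col := by
  obtain ⟨⟨⟨S, hS, hS'⟩, l⟩, n⟩ := t
  simp only at ht
  subst ht
  have hd : ∀ d : Dir, ((0, 0) : Cell) ∈ ({(0, 0)} : Finset Cell) ∧
      (0, 0) + d.vec ∉ ({(0, 0)} : Finset Cell) := by
    intro d; cases d <;> simp [Dir.vec]
  refine ⟨fun d => l ⟨((0, 0), d), hd d⟩, ?_⟩
  simp only [unitWang]
  congr
  funext e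
  congr 1
  obtain ⟨⟨p, d⟩, he⟩ := e
  have : p = (0, 0) := by simpa using he.1
  subst this
  rfl

/-- A tiling by unit Wang tiles is an assignment of colours to the sides of the cells. -/
theorem unitWang_tileable_iff {C : Type} {T : Finset (WangTile C)}
    (hT : ∀ t ∈ T, t.cells = {(0, 0)}) (G : LabelledRegion C) :
    WangTileable T G ↔ ∃ φ : Cell → Dir → C, (∀ p ∈ G.cells, unitWang (φ p) ∈ T) ∧
      (∀ p ∈ G.cells, ∀ d : Dir, p + d.vec ∈ G.cells → φ p d = φ (p + d.vec) d.opp) ∧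
      ∀ e : BoundaryEdge G.cells, φ e.1.1 e.1.2 = G.label e := by
  have hmem : ∀ d : Dir, ((0, 0) : Cell) ∈ ({(0, 0)} : Finset Cell) ∧
      (0, 0) + d.vec ∉ ({(0, 0)} : Finset Cell) := by
    intro d; cases d <;> simp [Dir.vec]
  constructor
  · rintro ⟨P, hP, ht, hint, hbd⟩
    have key : ∀ p : G.cells, ∃ col, (unitWang col, p.1) ∈ P := by
      intro p
      obtain ⟨⟨t, v⟩, ⟨ha, hpa⟩, -⟩ := ht.2 p.1 p.2
      obtain ⟨col, rfl⟩ := exists_eq_unitWang t (hT _ (hP _ ha))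
      have : p.1 = v := sub_eq_zero.1 (by simpa [unitWang, cell_zero] using hpa)
      exact ⟨col, by rw [this]; exact ha⟩
    choose ψ hψ using key
    have hφ : ∀ p : Cell, ∃ col : Dir → C, ∀ hp : p ∈ G.cells, col = ψ ⟨p, hp⟩ := by
      intro p
      by_cases hp : p ∈ G.cells
      · exact ⟨ψ ⟨p, hp⟩, fun _ => rfl⟩
      · obtain ⟨q⟩ := G.connected.nonempty
        exact ⟨ψ ⟨q.1, q.2⟩, fun h => absurd h hp⟩
    choose φ hφ using hφ
    refine ⟨φ, fun p hp => ?_, fun p hp d hd => ?_, fun e => ?_⟩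
    · rw [hφ p hp]; exact hP _ (hψ ⟨p, hp⟩)
    · rw [hφ p hp, hφ _ hd]
      exact hint _ (hψ ⟨p, hp⟩) _ (hψ ⟨_, hd⟩) ⟨((0, 0), d), hmem d⟩ ⟨((0, 0), d.opp), hmem d.opp⟩
        (by simp; abel) rfl
    · rw [hφ _ e.2.1]
      exact hbd _ (hψ ⟨_, e.2.1⟩) ⟨((0, 0), e.1.2), hmem _⟩ e (by simp) rfl
  · rintro ⟨φ, hφ, hint, hbd⟩
    have hinj : Function.Injective fun p : Cell => (unitWang (φ p), p) :=
      fun p q h => (Prod.ext_iff.1 h).2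
    have hlab : ∀ {p : Cell} (e : BoundaryEdge (unitWang (φ p)).cells), e.1.1 = (0, 0) := by
      intro p e; simpa [unitWang] using e.2.1
    refine ⟨G.cells.map ⟨_, hinj⟩, ?_, ⟨?_, fun p hp => ?_⟩, ?_, ?_⟩
    · intro a ha
      obtain ⟨p, hp, rfl⟩ := Finset.mem_map.1 ha
      exact hφ p hp
    · intro a ha q hq
      obtain ⟨p, hp, rfl⟩ := Finset.mem_map.1 ha
      have : q = 0 := by simpa [unitWang, cell_zero] using hq
      simpa [this] using hp
    · refine ⟨(unitWang (φ p), p), ⟨Finset.mem_map.2 ⟨p, hp, rfl⟩,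
        by simp [unitWang, cell_zero]⟩, ?_⟩
      rintro a ⟨ha, hpa⟩
      obtain ⟨q, hq, rfl⟩ := Finset.mem_map.1 ha
      have : p = q := sub_eq_zero.1 (by simpa [unitWang, cell_zero] using hpa)
      rw [this]
      rfl
    · intro a ha b hb e e' h h'
      obtain ⟨p, hp, rfl⟩ := Finset.mem_map.1 ha
      obtain ⟨q, hq, rfl⟩ := Finset.mem_map.1 hb
      have h₁ := hlab e
      have h₂ := hlab e'
      have hq' : q = p + e.1.2.vec := by
        rw [h₁, h₂] at h
        simpa [cell_zero] using h
      subst hq'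
      change φ p e.1.2 = φ _ e'.1.2
      rw [h']
      exact hint p hp _ hq
    · intro a ha e g h h'
      obtain ⟨p, hp, rfl⟩ := Finset.mem_map.1 ha
      have hg : g.1.1 = p := by
        rw [hlab e] at h
        simpa [cell_zero] using h
      change φ p e.1.2 = _
      rw [← hbd g, hg, h']

theorem WangTile.ext_natCode {c : ℕ} {t t' : WangTile (Fin c)} (h : t.cells = t'.cells)
    (h' : ∀ p ∈ t.cells, ∀ d, t.natCode p d = t'.natCode p d) : t = t' := by
  obtain ⟨⟨⟨S, hS, hS'⟩, l⟩, n⟩ := t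
  obtain ⟨⟨⟨S₁, hS₁, hS₁'⟩, l₁⟩, n₁⟩ := t'
  simp only at h
  subst h
  congr
  funext ⟨⟨p, d⟩, he⟩
  have := h' p he.1 d
  rw [LabelledRegion.natCode_of_notMem _ he.1 he.2,
    LabelledRegion.natCode_of_notMem _ he.1 he.2] at this
  exact Fin.ext (by simpa using this)

theorem unitWang_injective {c : ℕ} {col col' : Dir → Fin c} (h : unitWang col = unitWang col') :
    col = col' := by
  funext d
  have hd : (0, 0) + d.vec ∉ ({(0, 0)} : Finset Cell) := by cases d <;> simp [Dir.vec]
  have : (unitWang col).natCode (0, 0) d = (unitWang col').natCode (0, 0) d := by rw [h]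
  rw [LabelledRegion.natCode_of_notMem _ (Finset.mem_singleton_self _) hd,
    LabelledRegion.natCode_of_notMem _ (Finset.mem_singleton_self _) hd] at this
  exact Fin.ext (by simpa [unitWang] using this)

/-! ### From generalized Wang tiles to ordinary Wang tiles -/

/-- The name of a unit edge of the lattice: the cell on its left or below it, and whether the edge
is vertical. -/
def edgeKey (p : Cell) : Dir → Cell × Bool
  | .right => (p, true)
  | .up => (p, false)
  | .left => (p + Dir.left.vec, true)
  | .down => (p + Dir.down.vec, false)

theorem edgeKey_opp (p : Cell) (d : Dir) : edgeKey (p + d.vec) d.opp = edgeKey p d := by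
  cases d <;> simp only [edgeKey, Dir.opp] <;> congr 1 <;>
    simp only [Dir.vec, Prod.ext_iff, Prod.fst_add, Prod.snd_add] <;> omega

theorem eq_of_edgeKey_eq {p q : Cell} {d : Dir} (h : edgeKey p d = edgeKey q d.opp) :
    q = p + d.vec := by
  cases d <;> simp only [edgeKey, Dir.opp, Dir.vec, Prod.ext_iff, Prod.fst_add, Prod.snd_add,
    and_true] at h ⊢ <;> omega

theorem edgeKey_fst (p : Cell) (d : Dir) :
    (edgeKey p d).1 = p ∨ (edgeKey p d).1 = p + d.vec := by
  cases d <;> simp [edgeKey]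

theorem Dir.opp_opp (d : Dir) : d.opp.opp = d := by cases d <;> rfl

theorem Dir.vec_add_opp (p : Cell) (d : Dir) : p + d.vec + d.opp.vec = p := by
  rw [Dir.vec_opp]; abel

/-- Elements outside `K` all receive the last index; the indices of `K` are never that one. -/
theorem exists_index {α : Type*} (K : Finset α) : ∃ (N : ℕ) (idx : α → Fin (N + 1)),
    Set.InjOn idx K := by
  classical
  refine ⟨K.card, fun a => if h : a ∈ K then (K.equivFin ⟨a, h⟩).castSucc else Fin.last _, ?_⟩
  intro a ha b hb h
  have ha' : a ∈ K := ha
  have hb' : b ∈ K := hb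
  simpa [ha', hb'] using h

section Cut

variable {c N : ℕ} (idx : WangTile (Fin c) × Cell × Bool → Fin (N + 1))

/-- The colour of the side `d` of the cell `p` when the tile `t` is cut into unit squares. -/
def cutColour (t : WangTile (Fin c)) (p : Cell) (d : Dir) : Fin (c + (N + 1)) :=
  if h : p ∈ t.cells ∧ p + d.vec ∉ t.cells then Fin.castAdd (N + 1) (t.label ⟨(p, d), h⟩)
  else Fin.natAdd c (idx (t, edgeKey p d))

variable {idx}

theorem cutColour_of_mem {t : WangTile (Fin c)} {p : Cell} {d : Dir} (h : p + d.vec ∈ t.cells) :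
    cutColour idx t p d = Fin.natAdd c (idx (t, edgeKey p d)) := by
  simp [cutColour, h]

theorem cutColour_of_notMem {t : WangTile (Fin c)} {p : Cell} {d : Dir} (hp : p ∈ t.cells)
    (h : p + d.vec ∉ t.cells) :
    cutColour idx t p d = Fin.castAdd (N + 1) (t.label ⟨(p, d), hp, h⟩) := by
  simp [cutColour, hp, h]

theorem castAdd_ne_natAdd {m : ℕ} (i : Fin c) (j : Fin m) : Fin.castAdd m i ≠ Fin.natAdd c j := by
  intro h
  have := congrArg Fin.val h
  simp at this
  omega

variable (idx) in
open Classical in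
/-- The unit squares of the tiles of `T`. -/
noncomputable def cutTiles (T : Finset (WangTile (Fin c))) :
    Finset (WangTile (Fin (c + (N + 1)))) :=
  T.biUnion fun t => t.cells.image fun p => unitWang (cutColour idx t p)

theorem mem_cutTiles {T : Finset (WangTile (Fin c))} {u : WangTile (Fin (c + (N + 1)))} :
    u ∈ cutTiles idx T ↔ ∃ t ∈ T, ∃ p ∈ t.cells, unitWang (cutColour idx t p) = u := by
  simp [cutTiles]

/-- The region with the colours regarded as colours of the unit squares. -/
def cutRegion (N : ℕ) (G : LabelledRegion (Fin c)) : LabelledRegion (Fin (c + (N + 1))) where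
  toRegion := G.toRegion
  label e := Fin.castAdd (N + 1) (G.label e)

theorem cutRegion_describes {l : List ℤ} {G : LabelledRegion (Fin c)} (h : G.Describes l) :
    (cutRegion N G).Describes l := by
  obtain ⟨L, hL, hm, rfl⟩ := G.describes_iff.1 h
  exact (cutRegion N G).describes_iff.2 ⟨L, hL, hm, rfl⟩

/-- Each cell takes the colours of its place in the copy that covers it. Inside a copy the two sides
of an edge agree because the colour is attached to `edgeKey`, the name of the edge itself; between
copies, and on the boundary, the colours are the original labels. -/
theorem cut_tileable {T : Finset (WangTile (Fin c))} {G : LabelledRegion (Fin c)}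
    (h : WangTileable T G) : WangTileable (cutTiles idx T) (cutRegion N G) := by
  obtain ⟨P, hP, ht, hint, hbd⟩ := h
  rw [unitWang_tileable_iff (fun t h => by
    obtain ⟨_, _, _, _, rfl⟩ := mem_cutTiles.1 h
    rfl)]
  obtain ⟨p₀, hp₀⟩ := G.connected.nonempty
  obtain ⟨a₀, -, -⟩ := ht.2 p₀ hp₀
  have : Nonempty (WangTile (Fin c) × Cell) := ⟨a₀⟩
  choose! a ha hu using ht.2
  refine ⟨fun p => cutColour idx (a p).1 (p - (a p).2), fun p hp => ?_, fun p hp d hd => ?_, ?_⟩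
  · exact mem_cutTiles.2 ⟨_, hP _ (ha p hp).1, _, (ha p hp).2, rfl⟩
  · simp only
    by_cases h : a (p + d.vec) = a p
    · rw [h]
      have hd' := (ha _ hd).2
      rw [h] at hd'
      rw [cutColour_of_mem, cutColour_of_mem]
      · rw [← edgeKey_opp (p - (a p).2) d]
        congr 3
        abel_nf
      · convert (ha p hp).2 using 1
        rw [Dir.vec_opp]; abel
      · convert hd' using 1
        abel
    · have h₁ : p - (a p).2 + d.vec ∉ (a p).1.cells := by
        intro h'
        refine h (hu _ hd (a p) ⟨(ha p hp).1, ?_⟩).symm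
        convert h' using 1
        abel
      have h₂ : p + d.vec - (a (p + d.vec)).2 + d.opp.vec ∉ (a (p + d.vec)).1.cells := by
        intro h'
        refine h (hu _ hp (a (p + d.vec)) ⟨(ha _ hd).1, ?_⟩)
        convert h' using 1
        rw [Dir.vec_opp]; abel
      rw [cutColour_of_notMem (ha p hp).2 h₁, cutColour_of_notMem (ha _ hd).2 h₂]
      rw [hint _ (ha p hp).1 _ (ha _ hd).1 ⟨(_, d), (ha p hp).2, h₁⟩
        ⟨(_, d.opp), (ha _ hd).2, h₂⟩ (by simp) rfl]
  · rintro ⟨⟨p, d⟩, hp, hd⟩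
    have hp : p ∈ G.cells := hp
    have hd : p + d.vec ∉ G.cells := hd
    simp only
    have h₁ : p - (a p).2 + d.vec ∉ (a p).1.cells := by
      intro h'
      refine hd ?_
      convert ht.1 _ (ha p hp).1 _ h' using 1
      abel
    rw [cutColour_of_notMem (ha p hp).2 h₁]
    rw [hbd _ (ha p hp).1 ⟨(_, d), (ha p hp).2, h₁⟩ ⟨(p, d), hp, hd⟩ (by simp) rfl]
    rfl

/-- The colour of an inner edge occurs at that edge of that tile only. So a square showing it forces
its neighbour to be the adjacent square of the same tile, and as tiles are connected, a single
square forces the whole copy. -/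
theorem tileable_of_cut {T : Finset (WangTile (Fin c))}
    (hidx : Set.InjOn idx {x | x.1 ∈ T ∧ x.2.1 ∈ x.1.cells}) {G : LabelledRegion (Fin c)}
    (h : WangTileable (cutTiles idx T) (cutRegion N G)) : WangTileable T G := by
  classical
  rw [unitWang_tileable_iff (fun t h => by
    obtain ⟨_, _, _, _, rfl⟩ := mem_cutTiles.1 h
    rfl)] at h
  obtain ⟨φ, hφ, hint, hbd⟩ := h
  have key : ∀ p, p ∈ G.cells → ∃ x : WangTile (Fin c) × Cell,
      x.1 ∈ T ∧ x.2 ∈ x.1.cells ∧ φ p = cutColour idx x.1 x.2 := by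
    intro p hp
    obtain ⟨t, ht, q, hq, h⟩ := mem_cutTiles.1 (hφ p hp)
    exact ⟨(t, q), ht, hq, (unitWang_injective h).symm⟩
  obtain ⟨p₀, hp₀⟩ := G.connected.nonempty
  obtain ⟨a₀, -, -⟩ := key p₀ hp₀
  have : Nonempty (WangTile (Fin c) × Cell) := ⟨a₀⟩
  choose! x hxT hx hφx using key
  have step : ∀ p ∈ G.cells, ∀ d : Dir, (x p).2 + d.vec ∈ (x p).1.cells →
      p + d.vec ∈ G.cells ∧ x (p + d.vec) = ((x p).1, (x p).2 + d.vec) := by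
    intro p hp d hd
    have h₁ : φ p d = Fin.natAdd c (idx ((x p).1, edgeKey (x p).2 d)) := by
      rw [hφx p hp, cutColour_of_mem hd]
    -- The prescribed colours of the region are original ones, so an inner colour cannot face the
    -- boundary.
    have hpd : p + d.vec ∈ G.cells := by
      by_contra h
      have := hbd ⟨(p, d), hp, h⟩
      simp only [h₁] at this
      exact castAdd_ne_natAdd _ _ this.symm
    refine ⟨hpd, ?_⟩
    have h₂ := hint p hp d hpd
    rw [h₁, hφx _ hpd] at h₂
    have hd' : (x (p + d.vec)).2 + d.opp.vec ∈ (x (p + d.vec)).1.cells := by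
      by_contra h
      rw [cutColour_of_notMem (hx _ hpd) h] at h₂
      exact castAdd_ne_natAdd _ _ h₂.symm
    rw [cutColour_of_mem hd', Fin.natAdd_inj] at h₂
    have := hidx ⟨hxT p hp, ?_⟩ ⟨hxT _ hpd, ?_⟩ h₂
    · simp only [Prod.mk.injEq] at this
      refine Prod.ext this.1.symm (eq_of_edgeKey_eq this.2)
    · rcases edgeKey_fst (x p).2 d with h | h <;> simp only [h]
      exacts [hx p hp, hd]
    · rcases edgeKey_fst (x (p + d.vec)).2 d.opp with h | h <;> simp only [h]
      exacts [hx _ hpd, hd']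
  have walk : ∀ (t : WangTile (Fin c)) {a b : (t.cells : Set Cell)}
      (_ : (grid.induce (t.cells : Set Cell)).Walk a b), ∀ p ∈ G.cells, x p = (t, a.1) →
      p + (b.1 - a.1) ∈ G.cells ∧ x (p + (b.1 - a.1)) = (t, b.1) := by
    intro t a b W
    induction W with
    | nil => intro p hp h; simpa [h] using hp
    | @cons a b e hab W ih =>
      intro p hp h
      obtain ⟨d, hd⟩ : grid.Adj a.1 b.1 := by simpa using hab
      obtain ⟨h₁, h₂⟩ := step p hp d (by rw [h]; simp [← hd])
      rw [h] at h₂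
      obtain ⟨h₃, h₄⟩ := ih _ h₁ (by rw [h₂, hd])
      have e' : p + d.vec + (e.1 - b.1) = p + (e.1 - a.1) := by rw [hd]; abel
      rw [e'] at h₃ h₄
      exact ⟨h₃, h₄⟩
  have spread : ∀ p ∈ G.cells, ∀ q ∈ (x p).1.cells,
      p - (x p).2 + q ∈ G.cells ∧ x (p - (x p).2 + q) = ((x p).1, q) := by
    intro p hp q hq
    obtain ⟨W⟩ := (x p).1.connected.preconnected ⟨_, hx p hp⟩ ⟨q, hq⟩
    have := walk (x p).1 W p hp rfl
    simp only at this
    rwa [show p + (q - (x p).2) = p - (x p).2 + q by abel] at this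
  -- Every cell names the copy that it belongs to; by `spread` all cells of a copy name the same
  -- one.
  refine ⟨G.cells.image fun p => ((x p).1, p - (x p).2), ?_, ⟨?_, fun p hp => ?_⟩, ?_, ?_⟩
  · intro a ha
    obtain ⟨p, hp, rfl⟩ := Finset.mem_image.1 ha
    exact hxT p hp
  · intro a ha q hq
    obtain ⟨p, hp, rfl⟩ := Finset.mem_image.1 ha
    rw [add_comm]
    exact (spread p hp q hq).1
  · refine ⟨((x p).1, p - (x p).2), ⟨Finset.mem_image_of_mem _ hp, by simpa using hx p hp⟩, ?_⟩
    rintro a ⟨ha, hpa⟩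
    obtain ⟨q, hq, rfl⟩ := Finset.mem_image.1 ha
    obtain ⟨-, h⟩ := spread q hq _ hpa
    simp only [add_sub_cancel] at h
    rw [h]
    simp
  · intro a ha b hb e e' h h'
    obtain ⟨p, hp, rfl⟩ := Finset.mem_image.1 ha
    obtain ⟨q, hq, rfl⟩ := Finset.mem_image.1 hb
    obtain ⟨⟨r, d⟩, hr, hrd⟩ := e
    obtain ⟨⟨r', d'⟩, hr', hrd'⟩ := e'
    simp only at h h' hr hrd hr' hrd'
    subst h'
    obtain ⟨g₁, g₂⟩ := spread p hp r hr
    obtain ⟨g₃, g₄⟩ := spread q hq r' hr'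
    have e : q - (x q).2 + r' = p - (x p).2 + r + d.vec := by
      rw [add_comm, h]; abel
    rw [e] at g₃ g₄
    have := hint _ g₁ d g₃
    rw [hφx _ g₁, hφx _ g₃, g₂, g₄] at this
    simp only at this
    rw [cutColour_of_notMem hr hrd, cutColour_of_notMem hr' hrd'] at this
    exact (Fin.castAdd_inj.1 this)
  · intro a ha e g h h'
    obtain ⟨p, hp, rfl⟩ := Finset.mem_image.1 ha
    obtain ⟨⟨r, d⟩, hr, hrd⟩ := e
    obtain ⟨⟨z, d'⟩, hz, hzd⟩ := g
    simp only at h h' hr hrd hz hzd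
    subst h'
    obtain ⟨g₁, g₂⟩ := spread p hp r hr
    have e : z = p - (x p).2 + r := by rw [h]; abel
    have h₁ : φ z d' = Fin.castAdd (N + 1) (G.label ⟨(z, d'), hz, hzd⟩) :=
      hbd ⟨(z, d'), hz, hzd⟩
    have h₂ : φ z d' = Fin.castAdd (N + 1) ((x p).1.label ⟨(r, d'), hr, hrd⟩) := by
      rw [← cutColour_of_notMem (idx := idx) hr hrd, e, hφx _ g₁, g₂]
    exact Fin.castAdd_inj.1 (h₂.symm.trans h₁)

end Cut

theorem generalizedWangTiles_reducible_ordinaryWangTiles :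
    LinearTimeReducible generalizedWangTiles ordinaryWangTiles := by
  classical
  rintro ⟨c, T⟩
  obtain ⟨N, idx, hidx⟩ := exists_index
    (T.biUnion fun t => (t.cells ×ˢ (Finset.univ : Finset Bool)).image (Prod.mk t))
  refine ⟨⟨c + (N + 1), cutTiles idx T, fun t h => ?_⟩, cutRegion N, ?_, fun G =>
    ⟨cut_tileable, tileable_of_cut ?_⟩⟩
  · obtain ⟨_, _, _, _, rfl⟩ := mem_cutTiles.1 h
    rfl
  · exact linearTimeComputable_of_copy (A := generalizedWangTiles.problem ⟨c, T⟩) (C := 6) _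
      (fun _ G hl => ⟨G.card_pos, hl.length_le⟩) fun _ _ hl => cutRegion_describes hl
  · refine hidx.mono ?_
    rintro ⟨t, p, b⟩ ⟨ht, hp⟩
    simp only [Finset.coe_biUnion, Set.mem_iUnion]
    exact ⟨t, ht, by simpa using hp⟩

/-! ### From ordinary Wang tiles to relational Wang tiles -/

section Relational

variable {c : ℕ} {κ : Type} (col : κ → Dir → Fin c)

/-- Whether `y` may stand across the side `d` of `x`, where `x`, `y` are tiles with the colours
`col` or boundary tiles, made for a colour and a side. -/
def Across (d : Dir) : κ ⊕ (Fin c × Dir) → κ ⊕ (Fin c × Dir) → Prop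
  | .inl t, .inl t' => col t d = col t' d.opp
  | .inl t, .inr x => x.2 = d ∧ col t d = x.1
  | .inr x, .inl t => x.2 = d.opp ∧ col t d.opp = x.1
  | .inr _, .inr _ => False

theorem across_opp (d : Dir) (x y : κ ⊕ (Fin c × Dir)) :
    Across col d.opp x y ↔ Across col d y x := by
  rcases x with t | x <;> rcases y with t' | y <;> simp [Across, Dir.opp_opp, eq_comm]

variable {n : ℕ} (e : κ ⊕ (Fin c × Dir) ≃ Fin n)

/-- The relational Wang tiles made from tiles with the colours `col`. -/
def relSet : RelWangSet where
  n := n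
  H x y := Across col .right (e.symm x) (e.symm y)
  V x y := Across col .down (e.symm x) (e.symm y)

theorem relSet_allowed (d : Dir) (x y : Fin n) :
    (relSet col e).Allowed d x y ↔ Across col d (e.symm x) (e.symm y) := by
  cases d with
  | right => exact Iff.rfl
  | down => exact Iff.rfl
  | left => exact (across_opp col .right _ _).symm
  | up => exact (across_opp col .down _ _).symm

/-- The region with boundary tiles instead of colours. -/
def relRegion (G : LabelledRegion (Fin c)) : LabelledRegion (Fin n) where
  toRegion := G.toRegion
  label b := e (.inr (G.label b, b.1.2))

theorem relRegion_tileable_iff_across (G : LabelledRegion (Fin c)) :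
    RelWangTileable (relSet col e) (relRegion e G) ↔
      ∃ ψ : {p : Cell // p ∈ G.cells} → κ ⊕ (Fin c × Dir),
        (∀ (p q : {p : Cell // p ∈ G.cells}) (d : Dir), q.1 = p.1 + d.vec →
          Across col d (ψ p) (ψ q)) ∧
        ∀ b : BoundaryEdge G.cells,
          Across col b.1.2 (ψ ⟨b.1.1, b.2.1⟩) (.inr (G.label b, b.1.2)) := by
  constructor
  · rintro ⟨φ, hint, hbd⟩
    refine ⟨fun p => e.symm (φ p), fun p q d h => (relSet_allowed col e d _ _).1 (hint p q d h),
      fun b => ?_⟩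
    have h : Across col b.1.2 (e.symm (φ ⟨b.1.1, b.2.1⟩))
        (e.symm (e (.inr (G.label b, b.1.2)))) := (relSet_allowed col e b.1.2 _ _).1 (hbd b)
    rwa [e.symm_apply_apply] at h
  · rintro ⟨ψ, hint, hbd⟩
    refine ⟨fun p => e (ψ p), fun p q d h => (relSet_allowed col e d _ _).2 ?_,
      fun b => (relSet_allowed col e _ _ _).2 ?_⟩
    · rw [e.symm_apply_apply, e.symm_apply_apply]
      exact hint p q d h
    · have h : Across col b.1.2 (e.symm (e (ψ ⟨b.1.1, b.2.1⟩)))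
          (e.symm (e (.inr (G.label b, b.1.2)))) := by
        rw [e.symm_apply_apply, e.symm_apply_apply]
        exact hbd b
      exact h

/-- A boundary tile records the side of a cell across which it stands, so it only admits a neighbour
in the opposite direction. Placed in a cell of the region, it would also have a neighbour in the
recorded direction, which `Across` forbids; hence the cells carry proper tiles only. -/
theorem relRegion_tileable_iff (G : LabelledRegion (Fin c)) :
    RelWangTileable (relSet col e) (relRegion e G) ↔ ∃ φ : Cell → κ,
      (∀ p ∈ G.cells, ∀ d : Dir, p + d.vec ∈ G.cells →
        col (φ p) d = col (φ (p + d.vec)) d.opp) ∧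
      ∀ b : BoundaryEdge G.cells, col (φ b.1.1) b.1.2 = G.label b := by
  rw [relRegion_tileable_iff_across]
  constructor
  · rintro ⟨φ, hint, hbd⟩
    have key : ∀ p : {p : Cell // p ∈ G.cells}, ∃ t, φ p = .inl t := by
      intro p
      rcases h : φ p with t | x
      · exact ⟨t, rfl⟩
      exfalso
      by_cases hp : p.1 + x.2.vec ∈ G.cells
      · have := hint p ⟨_, hp⟩ x.2 rfl
        rw [h] at this
        rcases h' : φ ⟨_, hp⟩ with t | y
        · rw [h'] at this
          have := this.1
          revert this
          cases x.2 <;> simp [Dir.opp]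
        · rw [h'] at this
          exact this
      · have := hbd ⟨(p.1, x.2), p.2, hp⟩
        simp only [h] at this
        exact this
    obtain ⟨p₀⟩ := G.connected.nonempty
    obtain ⟨t₀, -⟩ := key ⟨p₀.1, p₀.2⟩
    choose ψ hψ using key
    refine ⟨fun p => if hp : p ∈ G.cells then ψ ⟨p, hp⟩ else t₀, fun p hp d hd => ?_, fun b => ?_⟩
    · have := hint ⟨p, hp⟩ ⟨_, hd⟩ d rfl
      rw [hψ, hψ] at this
      simpa [hp, hd] using (show col _ d = col _ d.opp from this)
    · have := hbd b
      rw [hψ] at this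
      simpa [b.2.1] using this.2
  · rintro ⟨φ, hint, hbd⟩
    refine ⟨fun p => .inl (φ p.1), fun p q d h => ?_, fun b => ⟨rfl, hbd b⟩⟩
    have := hint p.1 p.2 d (h ▸ q.2)
    rw [← h] at this
    exact this

/-- The code of a boundary tile. -/
def relCode (v : ℕ) (d : Dir) : ℤ :=
  if h : 0 < v ∧ v - 1 < c then ((e (.inr (⟨v - 1, h.2⟩, d)) : ℕ) : ℤ) + 1 else 0

theorem relCode_natCode (G : LabelledRegion (Fin c)) (p : Cell) (d : Dir) :
    relCode e (G.natCode p d) d = ((relRegion e G).natCode p d : ℤ) := by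
  by_cases h : p ∈ G.cells ∧ p + d.vec ∉ G.cells
  · rw [LabelledRegion.natCode_of_notMem G h.1 h.2,
      LabelledRegion.natCode_of_notMem (relRegion e G) h.1 h.2,
      relCode, dif_pos ⟨by omega, by simp⟩]
    rfl
  · have h' : ¬ (p ∈ (relRegion e G).cells ∧ p + d.vec ∉ (relRegion e G).cells) := h
    simp [LabelledRegion.natCode, h, h', relCode]

end Relational

theorem ordinaryWangTiles_reducible_relationalWangTiles :
    LinearTimeReducible ordinaryWangTiles relationalWangTiles := by
  classical
  rintro ⟨c, T, hT⟩
  choose col hcol using fun t : T => exists_eq_unitWang t.1 (hT t.1 t.2)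
  have : Fintype Dir := ⟨{.right, .up, .left, .down}, by intro d; cases d <;> simp⟩
  let e := Fintype.equivFin (T ⊕ (Fin c × Dir))
  refine ⟨relSet col e, relRegion e, ?_, fun G => ?_⟩
  · refine linearTimeComputable_of_transducer (B := relWangProblem (relSet col e)) (relRegion e)
      (fun v =>
      [(1, 0, 0), (0, 1, 0), (0, 0, relCode e (v .right) .right), (0, 0, relCode e (v .up) .up),
        (0, 0, relCode e (v .left) .left), (0, 0, relCode e (v .down) .down)]) ?_
    intro G L hL hm
    refine (relRegion e G).describes_iff.2 ⟨L, hL, hm, ?_⟩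
    refine List.flatMap_congr fun p _ => ?_
    simp [codeRecord, affine, relCode_natCode]
  · refine (unitWang_tileable_iff hT G).trans (Iff.trans ?_ (relRegion_tileable_iff col e G).symm)
    constructor
    · rintro ⟨φ, hφ, hint, hbd⟩
      obtain ⟨p₀⟩ := G.connected.nonempty
      have hc : ∀ p (hp : p ∈ G.cells), col ⟨_, hφ p hp⟩ = φ p := fun p hp =>
        unitWang_injective (hcol ⟨_, hφ p hp⟩).symm
      refine ⟨fun p => if hp : p ∈ G.cells then ⟨_, hφ p hp⟩ else ⟨_, hφ p₀.1 p₀.2⟩, ?_, ?_⟩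
      · intro p hp d hd
        simpa [hp, hd, hc] using hint p hp d hd
      · intro b
        simpa [b.2.1, hc] using hbd b
    · rintro ⟨φ, hint, hbd⟩
      exact ⟨fun p => col (φ p), fun p _ => by rw [← hcol]; exact (φ p).2, hint, hbd⟩

/-! ### Jigsaw regions -/

section Owner

/-- The point `v` of the cell `q` of the lattice scaled by `K`. -/
def scaled (K : ℤ) (q v : Cell) : Cell := (K * q.1 + v.1, K * q.2 + v.2)

/-- The directions to the left and down. -/
def back : Bool → Dir
  | true => .left
  | false => .down

/-- The position `k` on the left or lower side of a cell. -/
def slotPos (k : ℤ) : Bool → Cell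
  | true => (0, k)
  | false => (k, 0)

variable (K : ℤ) (off : Cell → Bool → ℤ)

/-- Each cell `q`, scaled by `K`, cedes the position `off q b` on its side `back b` to the
neighbour across that side. -/
def owner (z : Cell) : Cell :=
  let q : Cell := (z.1 / K, z.2 / K)
  if z.1 % K = 0 ∧ z.2 % K = off q true then q + (back true).vec
  else if z.2 % K = 0 ∧ z.1 % K = off q false then q + (back false).vec
  else q

variable {K off}

theorem exists_scaled (hK : 4 ≤ K) (z : Cell) :
    ∃ q v, z = scaled K q v ∧ (0 ≤ v.1 ∧ v.1 < K) ∧ 0 ≤ v.2 ∧ v.2 < K := by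
  refine ⟨(z.1 / K, z.2 / K), (z.1 % K, z.2 % K), ?_, ⟨?_, ?_⟩, ?_, ?_⟩
  · simp only [scaled, Int.mul_ediv_add_emod]
  · exact Int.emod_nonneg _ (by omega)
  · exact Int.emod_lt_of_pos _ (by omega)
  · exact Int.emod_nonneg _ (by omega)
  · exact Int.emod_lt_of_pos _ (by omega)

theorem owner_scaled {q v : Cell} (h₁ : 0 ≤ v.1 ∧ v.1 < K) (h₂ : 0 ≤ v.2 ∧ v.2 < K) :
    owner K off (scaled K q v) = if v.1 = 0 ∧ v.2 = off q true then q + (back true).vec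
      else if v.2 = 0 ∧ v.1 = off q false then q + (back false).vec else q := by
  have hK : K ≠ 0 := by omega
  have e₁ : (K * q.1 + v.1) / K = q.1 := by
    rw [Int.mul_add_ediv_left _ _ hK, Int.ediv_eq_zero_of_lt h₁.1 h₁.2, add_zero]
  have e₂ : (K * q.2 + v.2) / K = q.2 := by
    rw [Int.mul_add_ediv_left _ _ hK, Int.ediv_eq_zero_of_lt h₂.1 h₂.2, add_zero]
  have e₃ : (K * q.1 + v.1) % K = v.1 := by
    rw [Int.mul_add_emod_self_left, Int.emod_eq_of_lt h₁.1 h₁.2]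
  have e₄ : (K * q.2 + v.2) % K = v.2 := by
    rw [Int.mul_add_emod_self_left, Int.emod_eq_of_lt h₂.1 h₂.2]
  simp only [owner, scaled, e₁, e₂, e₃, e₄]

variable (hoff : ∀ q b, 2 ≤ off q b ∧ off q b ≤ K - 2)
include hoff

/-- Ceded positions keep a distance of at least two from the ends of a side, so the corner, like the
inner cells, always stays with its own scaled cell. -/
theorem owner_core {q v : Cell} (h₁ : 0 ≤ v.1 ∧ v.1 < K) (h₂ : 0 ≤ v.2 ∧ v.2 < K)
    (hv : v.1 = 0 ↔ v.2 = 0) : owner K off (scaled K q v) = q := by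
  have := hoff q true
  have := hoff q false
  rw [owner_scaled h₁ h₂, if_neg (by omega), if_neg (by omega)]

theorem owner_slot {q : Cell} {b : Bool} {k : ℤ} (h₁ : 1 ≤ k) (h₂ : k < K) :
    owner K off (scaled K q (slotPos k b)) = if k = off q b then q + (back b).vec else q := by
  have := hoff q true
  have := hoff q false
  cases b
  · rw [owner_scaled (by simp [slotPos]; omega) (by simp [slotPos]; omega)]
    simp only [slotPos]
    rw [if_neg (by omega)]
    simp
  · rw [owner_scaled (by simp [slotPos]; omega) (by simp [slotPos]; omega)]
    simp only [slotPos]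
    by_cases h : k = off q true
    · simp [h]
    · rw [if_neg (by omega), if_neg h]; exact if_neg (by omega)

end Owner

/-- All later arguments treat two kinds of small cells: the corner and the interior of a scaled
cell, whose owner is fixed, and the slots on its left and lower sides, whose owner depends on `off`.
-/
theorem cell_cases {K : ℤ} (hK : 4 ≤ K) (z : Cell) :
    (∃ q v, z = scaled K q v ∧ (0 ≤ v.1 ∧ v.1 < K) ∧ (0 ≤ v.2 ∧ v.2 < K) ∧ (v.1 = 0 ↔ v.2 = 0)) ∨
      ∃ q b k, z = scaled K q (slotPos k b) ∧ 1 ≤ k ∧ k < K := by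
  obtain ⟨q, ⟨i, j⟩, rfl, h₁, h₂⟩ := exists_scaled hK z
  simp only at h₁ h₂
  by_cases hi : i = 0
  · by_cases hj : j = 0
    · exact .inl ⟨q, (i, j), rfl, h₁, h₂, by simp [hi, hj]⟩
    · exact .inr ⟨q, true, j, by simp [slotPos, hi], by omega, by omega⟩
  · by_cases hj : j = 0
    · exact .inr ⟨q, false, i, by simp [slotPos, hj], by omega, by omega⟩
    · exact .inl ⟨q, (i, j), rfl, h₁, h₂, by simp [hi, hj]⟩

/-! ### Connectedness of the scaled cells after the exchange of slots -/

section Fibres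

variable {K : ℤ} {off : Cell → Bool → ℤ}

theorem scaled_back (q v : Cell) (b : Bool) :
    scaled K (q + (back b).vec) v = scaled K q (v + (K * (back b).vec.1, K * (back b).vec.2)) := by
  simp only [scaled, Prod.fst_add, Prod.snd_add, mul_add]
  congr 1 <;> ring

theorem adj_scaled {q v w : Cell} (h : grid.Adj v w) :
    grid.Adj (scaled K q v) (scaled K q w) := by
  obtain ⟨d, rfl⟩ := h
  refine ⟨d, Prod.ext ?_ ?_⟩ <;> simp [scaled, add_assoc]

variable (hK : 4 ≤ K) (hoff : ∀ q b, 2 ≤ off q b ∧ off q b ≤ K - 2)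
include hK hoff

/-- Kept and received slots are adjacent to the interior block of the scaled cell. The corner
reaches that block through the slot at position `1`, which is never ceded. -/
theorem owner_fibre_connected (p : Cell) :
    (grid.induce (owner K off ⁻¹' {p})).Connected := by
  set S := owner K off ⁻¹' {p} with hS
  have core : ∀ v : Cell, 1 ≤ v.1 → v.1 < K → 1 ≤ v.2 → v.2 < K → scaled K p v ∈ S := by
    intro v h₁ h₂ h₃ h₄
    exact owner_core hoff (by omega) (by omega) (by omega)
  have hbox : ∀ v w : Cell, 1 ≤ v.1 → v.1 < K → 1 ≤ v.2 → v.2 < K → 1 ≤ w.1 → w.1 < K →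
      1 ≤ w.2 → w.2 < K → Joined S (scaled K p v) (scaled K p w) := by
    intro v w h₁ h₂ h₃ h₄ h₅ h₆ h₇ h₈
    refine joined_box (I := Set.Ico (K * p.1 + 1) (K * p.1 + K))
      (J := Set.Ico (K * p.2 + 1) (K * p.2 + K)) ?_ ?_ ?_
    · rintro ⟨x, y⟩ ⟨⟨hx₁, hx₂⟩, hy₁, hy₂⟩
      simp only at hx₁ hx₂ hy₁ hy₂
      have := core (x - K * p.1, y - K * p.2) (by simp only; omega) (by simp only; omega)
        (by simp only; omega) (by simp only; omega)
      simpa [scaled] using this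
    · simp only [scaled, Set.mem_prod, Set.mem_Ico]; omega
    · simp only [scaled, Set.mem_prod, Set.mem_Ico]; omega
  have key : ∀ z ∈ S, Joined S z (scaled K p (1, 1)) := by
    intro z hz
    have hz' : owner K off z = p := hz
    have viaCore : ∀ v, grid.Adj z (scaled K p v) → 1 ≤ v.1 → v.1 < K → 1 ≤ v.2 → v.2 < K →
        Joined S z (scaled K p (1, 1)) := fun v hadj h₁ h₂ h₃ h₄ =>
      (Joined.of_adj hz (core v h₁ h₂ h₃ h₄) hadj).trans
        (hbox _ _ h₁ h₂ h₃ h₄ le_rfl (by omega) le_rfl (by omega))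
    rcases cell_cases hK z with
      ⟨q, v, rfl, h₁, h₂, hv⟩ | ⟨q, b, k, rfl, h₁, h₂⟩
    · rw [owner_core hoff h₁ h₂ hv] at hz'
      subst hz'
      by_cases h : v.1 = 0
      · have hv0 : v = (0, 0) := Prod.ext h (hv.1 h)
        subst hv0
        have h' : scaled K q (1, 0) ∈ S := by
          have := owner_slot hoff (q := q) (b := false) (k := 1) le_rfl (by omega)
          have h2 := hoff q false
          rw [if_neg (by omega)] at this
          exact this
        exact (Joined.of_adj hz h' (adj_scaled (adj_right 0 0))).trans
          (Joined.of_adj h' (core (1, 1) (by simp) (by simp only; omega) (by simp)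
            (by simp only; omega)) (adj_scaled (adj_up 1 0)))
      · exact hbox _ _ (by omega) (by omega) (by omega) (by omega) le_rfl (by simp only; omega)
          le_rfl (by simp only; omega)
    · rw [owner_slot hoff h₁ h₂] at hz'
      have hk := hoff q b
      split_ifs at hz' with h
      · cases b
        · refine viaCore (k, K - 1) ?_ (by simp only; omega) (by simp only; omega)
            (by simp only; omega) (by simp only; omega)
          rw [← hz', scaled_back]
          refine adj_scaled ?_
          refine ⟨.down, ?_⟩
          simp [slotPos, back, Dir.vec]
          ring
        · refine viaCore (K - 1, k) ?_ (by simp only; omega) (by simp only; omega)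
            (by simp only; omega) (by simp only; omega)
          rw [← hz', scaled_back]
          refine adj_scaled ?_
          refine ⟨.left, ?_⟩
          simp [slotPos, back, Dir.vec]
          ring
      · subst hz'
        cases b
        · exact viaCore (k, 1) (adj_scaled (adj_up k 0)) (by simp only; omega)
            (by simp only; omega) (by simp only; omega) (by simp only; omega)
        · exact viaCore (1, k) (adj_scaled (adj_right 0 k)) (by simp only; omega)
            (by simp only; omega) (by simp only; omega) (by simp only; omega)
  refine connected_iff_joined.2 ⟨⟨_, core (1, 1) (by simp) (by simp only; omega) (by simp)
    (by simp only; omega)⟩, fun z hz w hw => (key z hz).trans (key w hw).symm⟩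

/-- The slot at position `1` is kept, so there the two scaled cells touch along their original
common side. -/
theorem owner_touch_back (q : Cell) (b : Bool) :
    ∃ z w, grid.Adj z w ∧ owner K off z = q ∧ owner K off w = q + (back b).vec := by
  have hk := hoff q b
  refine ⟨scaled K q (slotPos 1 b), scaled K q (slotPos 1 b + (back b).vec), ?_, ?_, ?_⟩
  · exact adj_scaled (adj_vec _ _)
  · rw [owner_slot hoff le_rfl (by omega), if_neg (by omega)]
  · have : scaled K q (slotPos 1 b + (back b).vec) = scaled K (q + (back b).vec)
        (slotPos 1 b + (back b).vec - (K * (back b).vec.1, K * (back b).vec.2)) := by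
      rw [scaled_back]; congr 1; abel
    rw [this]
    cases b
    · rw [owner_core hoff] <;> simp [slotPos, back, Dir.vec] <;> omega
    · rw [owner_core hoff] <;> simp [slotPos, back, Dir.vec] <;> omega

theorem owner_touch (q : Cell) (d : Dir) :
    ∃ z w, grid.Adj z w ∧ owner K off z = q ∧ owner K off w = q + d.vec := by
  have swap : ∀ d : Dir, (∃ b, d.opp = back b) →
      ∃ z w, grid.Adj z w ∧ owner K off z = q ∧ owner K off w = q + d.vec := by
    rintro d ⟨b, hb⟩
    obtain ⟨z, w, h, hz, hw⟩ := owner_touch_back hK hoff (q + d.vec) b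
    refine ⟨w, z, h.symm, ?_, hz⟩
    rw [hw, ← hb, Dir.vec_add_opp]
  cases d
  · exact swap .right ⟨true, rfl⟩
  · exact swap .up ⟨false, rfl⟩
  · exact owner_touch_back hK hoff q true
  · exact owner_touch_back hK hoff q false

theorem owner_preimage_connected {S : Set Cell} (hS : (grid.induce S).Connected) :
    (grid.induce (owner K off ⁻¹' S)).Connected :=
  connected_preimage (owner_fibre_connected hK hoff) (owner_touch hK hoff) hS

end Fibres

/-- A preimage of a region under a map whose fibres are listed is described by the lists of the
fibres. -/
theorem describes_preimage {own : Cell → Cell} {F : Cell → List Cell} {S : Finset Cell}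
    {G : Region} (hF : ∀ p ∈ S, (F p).Nodup) (hmem : ∀ p ∈ S, ∀ z, z ∈ F p ↔ own z = p)
    (hG : ∀ z, z ∈ G.cells ↔ own z ∈ S) {L : List Cell} (hL : L.Nodup)
    (h : ∀ p, p ∈ L ↔ p ∈ S) :
    G.Describes (L.flatMap fun p => (F p).flatMap fun z => [z.1, z.2]) := by
  refine ⟨L.flatMap F, ?_, fun z => ?_, by rw [List.flatMap_assoc]⟩
  · rw [List.nodup_flatMap]
    refine ⟨fun p hp => hF p ((h p).1 hp), hL.imp_of_mem ?_⟩
    intro p q hp hq hpq z hz hz'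
    rw [hmem p ((h p).1 hp)] at hz
    rw [hmem q ((h q).1 hq)] at hz'
    exact hpq (hz.symm.trans hz')
  · rw [List.mem_flatMap, hG]
    constructor
    · rintro ⟨p, hp, hz⟩
      rw [hmem p ((h p).1 hp)] at hz
      rw [hz]
      exact (h p).1 hp
    · exact fun hz => ⟨own z, (h _).2 hz, (hmem _ hz z).2 rfl⟩

section Piece

/-- The cells of a scaled cell that has ceded the positions `v left`, `v down` and received the
positions `v right`, `v up`. -/
noncomputable def piece (K : ℤ) (v : Dir → ℤ) : Finset Cell :=
  (box 0 K K).filter (fun w => w ≠ (0, v .left) ∧ w ≠ (v .down, 0)) ∪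
    {(K, v .right), (v .up, K)}

theorem mem_piece {K : ℤ} {v : Dir → ℤ} {w : Cell} : w ∈ piece K v ↔
    (((0 ≤ w.1 ∧ w.1 < K) ∧ 0 ≤ w.2 ∧ w.2 < K) ∧ w ≠ (0, v .left) ∧ w ≠ (v .down, 0)) ∨
      w = (K, v .right) ∨ w = (v .up, K) := by
  simp [piece, mem_box]
  tauto

theorem scaled_injective {K : ℤ} (q : Cell) : Function.Injective (scaled K q) := by
  intro v w h
  simp only [scaled, Prod.mk.injEq, add_right_inj] at h
  exact Prod.ext h.1 h.2

/-- This lists the fibre relative to the corner of the scaled cell. Only four numbers enter, so a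
program that sees the record of one cell can print it. -/
theorem owner_eq_iff {K : ℤ} {off : Cell → Bool → ℤ} (hK : 4 ≤ K)
    (hoff : ∀ q b, 2 ≤ off q b ∧ off q b ≤ K - 2) {v : Dir → ℤ} {p : Cell}
    (hr : v .right = off (p + Dir.right.vec) true) (hu : v .up = off (p + Dir.up.vec) false)
    (hl : v .left = off p true) (hd : v .down = off p false) (z : Cell) :
    owner K off z = p ↔ ∃ w ∈ piece K v, scaled K p w = z := by
  constructor
  · intro hz
    rcases cell_cases hK z with ⟨q, w, rfl, h₁, h₂, hw⟩ | ⟨q, b, k, rfl, h₁, h₂⟩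
    · rw [owner_core hoff h₁ h₂ hw] at hz
      subst hz
      have := hoff q true
      have := hoff q false
      refine ⟨w, mem_piece.2 (.inl ⟨⟨h₁, h₂⟩, ?_, ?_⟩), rfl⟩
      · rintro rfl; simp [hl] at hw; omega
      · rintro rfl; simp [hd] at hw; omega
    · rw [owner_slot hoff h₁ h₂] at hz
      split_ifs at hz with h
      · cases b
        · refine ⟨(v .up, K), mem_piece.2 (by simp), ?_⟩
          rw [← hz, scaled_back, hu, h, ← hz]
          simp only [back, Dir.vec_add_opp q .down, show Dir.up = Dir.opp .down from rfl]
          congr 1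
          simp [slotPos, Dir.vec]
        · refine ⟨(K, v .right), mem_piece.2 (by simp), ?_⟩
          rw [← hz, scaled_back, hr, h, ← hz]
          simp only [back, Dir.vec_add_opp q .left, show Dir.right = Dir.opp .left from rfl]
          congr 1
          simp [slotPos, Dir.vec]
      · subst hz
        refine ⟨slotPos k b, mem_piece.2 (.inl ?_), rfl⟩
        cases b <;> simp [slotPos, hl, hd] <;> omega
  · rintro ⟨w, hw, rfl⟩
    rcases mem_piece.1 hw with ⟨⟨h₁, h₂⟩, h₃, h₄⟩ | rfl | rfl
    · rw [owner_scaled h₁ h₂, if_neg, if_neg]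
      · rintro ⟨h, h'⟩; exact h₄ (Prod.ext (by simp [h', hd]) h)
      · rintro ⟨h, h'⟩; exact h₃ (Prod.ext h (by simp [h', hl]))
    · have e : scaled K p (K, v .right) =
          scaled K (p + Dir.right.vec) (slotPos (off (p + Dir.right.vec) true) true) := by
        rw [hr]; simp [scaled, slotPos, Dir.vec]; ring
      have := hoff (p + Dir.right.vec) true
      rw [e, owner_slot hoff (by omega) (by omega), if_pos rfl]
      exact Dir.vec_add_opp p .right
    · have e : scaled K p (v .up, K) =
          scaled K (p + Dir.up.vec) (slotPos (off (p + Dir.up.vec) false) false) := by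
        rw [hu]; simp [scaled, slotPos, Dir.vec]; ring
      have := hoff (p + Dir.up.vec) false
      rw [e, owner_slot hoff (by omega) (by omega), if_pos rfl]
      exact Dir.vec_add_opp p .up

end Piece

/-! ### The jigsaw of a labelled region -/

section Jigsaw

variable {c : ℕ}

/-- The position ceded on the side `d` of the cell `q`. -/
def LabelledRegion.edge (X : LabelledRegion (Fin c)) (q : Cell) (d : Dir) : ℤ :=
  X.natCode q d + X.natCode (q + d.vec) d.opp + 2

variable (X : LabelledRegion (Fin c))

/-- The formula for `edge` treats the two cells at an edge alike; at most one of the two codes is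
nonzero, since a boundary edge has the region on one side only. -/
theorem LabelledRegion.edge_opp (q : Cell) (d : Dir) :
    X.edge (q + d.vec) d.opp = X.edge q d := by
  simp only [edge, Dir.vec_add_opp, Dir.opp_opp]
  ring

theorem LabelledRegion.edge_of_mem {q : Cell} (hq : q ∈ X.cells) (d : Dir) :
    X.edge q d = X.natCode q d + 2 := by
  have : X.natCode (q + d.vec) d.opp = 0 := X.natCode_of_mem (by rwa [Dir.vec_add_opp])
  simp [edge, this]

theorem LabelledRegion.edge_bound (q : Cell) (d : Dir) :
    2 ≤ X.edge q d ∧ X.edge q d ≤ (c + 4 : ℤ) - 2 := by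
  have h₁ := X.natCode_le q d
  have h₂ := X.natCode_le (q + d.vec) d.opp
  by_cases hq : q ∈ X.cells
  · rw [X.edge_of_mem hq]; omega
  · rw [edge, X.natCode_outside hq]; omega

theorem LabelledRegion.off_bound (q : Cell) (b : Bool) :
    2 ≤ X.edge q (back b) ∧ X.edge q (back b) ≤ (c + 4 : ℤ) - 2 := X.edge_bound q _

theorem LabelledRegion.owner_eq_iff (p z : Cell) :
    owner (c + 4) (fun q b => X.edge q (back b)) z = p ↔
      ∃ w ∈ piece (c + 4) (X.edge p), scaled (c + 4) p w = z :=
  Tileability.owner_eq_iff (by omega) X.off_bound (X.edge_opp p .right).symm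
    (X.edge_opp p .up).symm rfl rfl z

theorem LabelledRegion.mem_biUnion_piece (z : Cell) :
    z ∈ X.cells.biUnion (fun p => (piece (c + 4) (X.edge p)).image (scaled (c + 4) p)) ↔
      owner (c + 4) (fun q b => X.edge q (back b)) z ∈ X.cells := by
  simp only [Finset.mem_biUnion, Finset.mem_image, ← X.owner_eq_iff]
  simp

/-- The region with the colours turned into the shape of the boundary. -/
noncomputable def jigsaw : Region where
  cells := X.cells.biUnion fun p => (piece (c + 4) (X.edge p)).image (scaled (c + 4) p)
  connected := by
    have := owner_preimage_connected (by omega) X.off_bound X.connected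
    convert this using 2
    all_goals (ext z; simp only [Finset.mem_coe, X.mem_biUnion_piece, Set.mem_preimage])
  noHoles := by
    have := owner_preimage_connected (by omega) X.off_bound X.noHoles
    convert this using 2
    all_goals
      (ext z; simp only [Set.mem_compl_iff, Finset.mem_coe, X.mem_biUnion_piece, Set.mem_preimage])

theorem mem_jigsaw {z : Cell} : z ∈ (jigsaw X).cells ↔
    owner (c + 4) (fun q b => X.edge q (back b)) z ∈ X.cells := X.mem_biUnion_piece z

theorem mem_jigsaw_core {q v : Cell} (h₁ : 0 ≤ v.1 ∧ v.1 < (c + 4 : ℤ))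
    (h₂ : 0 ≤ v.2 ∧ v.2 < (c + 4 : ℤ)) (hv : v.1 = 0 ↔ v.2 = 0) :
    scaled (c + 4) q v ∈ (jigsaw X).cells ↔ q ∈ X.cells := by
  rw [mem_jigsaw, owner_core X.off_bound h₁ h₂ hv]

theorem mem_jigsaw_corner {q : Cell} : scaled (c + 4) q 0 ∈ (jigsaw X).cells ↔ q ∈ X.cells :=
  mem_jigsaw_core X (by simp; omega) (by simp; omega) Iff.rfl

theorem mem_jigsaw_slot {q : Cell} {b : Bool} {k : ℤ} (h₁ : 1 ≤ k) (h₂ : k < (c + 4 : ℤ)) :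
    scaled (c + 4) q (slotPos k b) ∈ (jigsaw X).cells ↔
      if k = X.edge q (back b) then q + (back b).vec ∈ X.cells else q ∈ X.cells := by
  rw [mem_jigsaw, owner_slot X.off_bound h₁ h₂]
  split_ifs <;> rfl

/-- The affine forms of the cells of the jigsaw piece of a cell with the given codes. -/
noncomputable def jigsawForms (c : ℕ) (v : Dir → ℕ) : List (ℤ × ℤ × ℤ) :=
  (piece (c + 4) fun d => (v d : ℤ) + 2).toList.flatMap fun w =>
    [(c + 4, 0, w.1), (0, c + 4, w.2)]

/-- For a cell of the region the codes on the far sides of its edges vanish, so its piece depends on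
its own four codes alone and a local transducer suffices. -/
theorem jigsaw_computable {Y : LabelledRegion (Fin c) → Prop} (T : Finset Tile) :
    LinearTimeComputable
      ⟨LabelledRegion (Fin c), fun G => G.cells.card, fun l G => G.Describes l, Y⟩
      (tileProblem T) jigsaw := by
  refine linearTimeComputable_of_transducer (B := tileProblem T) jigsaw (jigsawForms c) ?_
  intro G L hL hm
  have := describes_preimage (G := jigsaw G) (S := G.cells)
    (F := fun p => (piece (c + 4) (G.edge p)).toList.map (scaled (c + 4) p))
    (fun p _ => (Finset.nodup_toList _).map (scaled_injective p))
    (fun p _ z => by rw [G.owner_eq_iff]; simp) (fun z => mem_jigsaw G) hL hm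
  change (jigsaw G).Describes _
  convert this using 1
  refine List.flatMap_congr fun p hp => ?_
  have e : (fun d => (G.natCode p d : ℤ) + 2) = G.edge p :=
    funext fun d => (G.edge_of_mem ((hm p).1 hp) d).symm
  rw [jigsawForms, e, List.map_flatMap, List.flatMap_map]
  refine List.flatMap_congr fun w _ => ?_
  simp [affine, scaled]
  constructor <;> ring

theorem scaled_sub (K : ℤ) (q v w : Cell) :
    scaled K q w - scaled K v 0 = scaled K (q - v) w := by
  refine Prod.ext ?_ ?_ <;> simp [scaled] <;> ring

/-- The jigsaw tile of a Wang tile. -/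
noncomputable def jigsawTile (t : WangTile (Fin c)) : Tile where
  toRegion := jigsaw t.toLabelledRegion
  normal := by
    refine ⟨fun z hz => ?_, ?_, ?_⟩
    · rw [mem_jigsaw] at hz
      obtain ⟨w, hw, h⟩ := (t.owner_eq_iff _ z).1 rfl
      have := t.normal.1 _ hz
      generalize owner _ _ z = p at *
      have h₁ := t.edge_bound p .right
      have h₂ := t.edge_bound p .up
      have hw' : 0 ≤ w.1 ∧ 0 ≤ w.2 := by
        rcases mem_piece.1 hw with h | rfl | rfl
        · exact ⟨h.1.1.1, h.1.2.1⟩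
        · simp only; omega
        · simp only; omega
      rw [← h]
      simp only [scaled]
      exact ⟨by nlinarith [mul_nonneg (show (0 : ℤ) ≤ c + 4 by omega) this.1],
        by nlinarith [mul_nonneg (show (0 : ℤ) ≤ c + 4 by omega) this.2]⟩
    · obtain ⟨p, hp, h⟩ := t.normal.2.1
      exact ⟨_, (mem_jigsaw_corner _).2 hp, by simp [scaled, h]⟩
    · obtain ⟨p, hp, h⟩ := t.normal.2.2
      exact ⟨_, (mem_jigsaw_corner _).2 hp, by simp [scaled, h]⟩

/-- The ceded slot of a boundary edge can be seen in the set of small cells. For a left or lower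
side it lies in the scaled cell itself, for a right or upper side in the scaled cell across, which
is why both are compared. -/
theorem edge_eq_of_jigsaw {X Y : LabelledRegion (Fin c)} {q q' : Cell} {d : Dir}
    (h : ∀ b k, scaled (c + 4) q (slotPos k b) ∈ (jigsaw X).cells ↔
      scaled (c + 4) q' (slotPos k b) ∈ (jigsaw Y).cells)
    (h' : ∀ b k, scaled (c + 4) (q + d.vec) (slotPos k b) ∈ (jigsaw X).cells ↔
      scaled (c + 4) (q' + d.vec) (slotPos k b) ∈ (jigsaw Y).cells)
    (hX : q ∈ X.cells) (hX' : q + d.vec ∉ X.cells) (hY : q' ∈ Y.cells)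
    (hY' : q' + d.vec ∉ Y.cells) : X.edge q d = Y.edge q' d := by
  have fwd : ∀ b, d = back b → X.edge q d = Y.edge q' d := by
    rintro b rfl
    have hb := X.edge_bound q (back b)
    have := h b (X.edge q (back b))
    rw [mem_jigsaw_slot _ (by omega) (by omega), mem_jigsaw_slot _ (by omega) (by omega)] at this
    by_contra hne
    simp [hX', hne, hY] at this
  have bwd : ∀ b, d.opp = back b → X.edge q d = Y.edge q' d := by
    intro b hb
    have hb' := X.edge_bound q d
    have := h' b (X.edge q d)
    rw [mem_jigsaw_slot _ (by omega) (by omega), mem_jigsaw_slot _ (by omega) (by omega),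
      ← hb, X.edge_opp, Y.edge_opp, Dir.vec_add_opp, Dir.vec_add_opp] at this
    by_contra hne
    simp [hX, hne, hY'] at this
  cases d
  · exact bwd true rfl
  · exact bwd false rfl
  · exact fwd true rfl
  · exact fwd false rfl

theorem jigsawTile_injective : Function.Injective (jigsawTile (c := c)) := by
  intro t t' h
  have hc : (jigsaw t.toLabelledRegion).cells = (jigsaw t'.toLabelledRegion).cells :=
    congrArg (fun t : Tile => t.cells) h
  have hm : ∀ q, q ∈ t.cells ↔ q ∈ t'.cells := by
    intro q
    rw [← mem_jigsaw_corner, hc, mem_jigsaw_corner]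
  refine WangTile.ext_natCode (Finset.ext hm) fun p hp d => ?_
  by_cases hd : p + d.vec ∈ t.cells
  · rw [LabelledRegion.natCode_of_mem _ hd, LabelledRegion.natCode_of_mem _ ((hm _).1 hd)]
  · have := edge_eq_of_jigsaw (X := t.toLabelledRegion) (Y := t'.toLabelledRegion) (q := p)
      (q' := p) (d := d) (fun _ _ => by rw [hc]) (fun _ _ => by rw [hc]) hp hd ((hm _).1 hp)
      (mt (hm _).2 hd)
    rw [LabelledRegion.edge_of_mem _ hp, LabelledRegion.edge_of_mem _ ((hm _).1 hp)] at this
    omega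

/-! ### From generalized Wang tiles to ordinary tiles -/

noncomputable def jigsawEmb : WangTile (Fin c) ↪ Tile := ⟨jigsawTile, jigsawTile_injective⟩

theorem scaled_zero_injective {K : ℤ} (hK : 0 < K) :
    Function.Injective fun v : Cell => scaled K v 0 := by
  intro v w h
  simp only [scaled, Prod.fst_zero, Prod.snd_zero, add_zero, Prod.mk.injEq] at h
  exact Prod.ext (mul_left_cancel₀ hK.ne' h.1) (mul_left_cancel₀ hK.ne' h.2)

/-- Placements of Wang tiles as placements of jigsaw tiles. -/
noncomputable def jigsawPlace : WangTile (Fin c) × Cell ↪ Tile × Cell :=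
  jigsawEmb.prodMap ⟨fun v => scaled (c + 4) v 0, scaled_zero_injective (by omega)⟩

theorem jigsawPlace_apply (t : WangTile (Fin c)) (v : Cell) :
    jigsawPlace (t, v) = (jigsawTile t, scaled (c + 4) v 0) := rfl

theorem jigsawTile_cells (t : WangTile (Fin c)) :
    (jigsawTile t).cells = (jigsaw t.toLabelledRegion).cells := rfl

/-- On an edge where copies meet each other or the boundary, the colours agree, hence so do the
ceded positions of everything that is separated there. On other edges the position is irrelevant to
a copy, or to the region, because it contains both sides or neither. -/
theorem jigsaw_tileable {T : Finset (WangTile (Fin c))} {G : LabelledRegion (Fin c)}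
    (h : WangTileable T G) : Tileable (T.map jigsawEmb) (jigsaw G) := by
  obtain ⟨P, hP, ht, hint, hbd⟩ := h
  have edge_label : ∀ (Y : LabelledRegion (Fin c)) (q : Cell) (d : Dir) (h₁ : q ∈ Y.cells)
      (h₂ : q + d.vec ∉ Y.cells), Y.edge q d = (Y.label ⟨(q, d), h₁, h₂⟩ : ℕ) + 3 := by
    intro Y q d h₁ h₂
    rw [Y.edge_of_mem h₁, Y.natCode_of_notMem h₁ h₂]
    push_cast
    ring
  have inner : ∀ a ∈ P, ∀ b ∈ P, ∀ (q : Cell) (d : Dir), q - a.2 ∈ a.1.cells →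
      q + d.vec - b.2 ∈ b.1.cells → a ≠ b → a.1.edge (q - a.2) d = b.1.edge (q - b.2) d := by
    intro a ha b hb q d hqa hqb hab
    have hq := ht.1 a ha _ hqa
    have hq' := ht.1 b hb _ hqb
    rw [sub_add_cancel] at hq hq'
    have h₁ : q - a.2 + d.vec ∉ a.1.cells := by
      intro h
      refine hab ((ht.2 _ hq').unique ⟨ha, ?_⟩ ⟨hb, hqb⟩)
      convert h using 1; abel
    have e : q + d.vec - b.2 = q - b.2 + d.vec := by abel
    have h₂ : q - b.2 + d.vec + d.opp.vec ∉ b.1.cells := by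
      rw [Dir.vec_add_opp]
      exact fun h => hab ((ht.2 _ hq).unique ⟨ha, hqa⟩ ⟨hb, h⟩)
    rw [e] at hqb
    rw [← b.1.edge_opp, edge_label _ _ _ hqa h₁, edge_label _ _ _ hqb h₂]
    rw [hint a ha b hb ⟨(q - a.2, d), hqa, h₁⟩ ⟨(q - b.2 + d.vec, d.opp), hqb, h₂⟩
      (by simp only; abel) rfl]
  have outer : ∀ a ∈ P, ∀ (q : Cell) (d : Dir), q - a.2 ∈ a.1.cells → q + d.vec ∉ G.cells →
      a.1.edge (q - a.2) d = G.edge q d := by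
    intro a ha q d hqa hqd
    have hq := ht.1 a ha _ hqa
    rw [sub_add_cancel] at hq
    have h₁ : q - a.2 + d.vec ∉ a.1.cells := by
      intro h
      refine hqd ?_
      convert ht.1 a ha _ h using 1; abel
    rw [edge_label _ _ _ hqa h₁, edge_label _ _ _ hq hqd]
    rw [hbd a ha ⟨(q - a.2, d), hqa, h₁⟩ ⟨(q, d), hq, hqd⟩ (by simp) rfl]
  -- One position `e` serves the region and every copy that the edge separates from its outside.
  have edges : ∀ (q : Cell) (d : Dir), ∃ e : ℤ,
      ((q ∈ G.cells ↔ q + d.vec ∉ G.cells) → G.edge q d = e) ∧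
      ∀ a ∈ P, (q - a.2 ∈ a.1.cells ↔ q - a.2 + d.vec ∉ a.1.cells) →
        a.1.edge (q - a.2) d = e := by
    intro q d
    have hcov : ∀ a ∈ P, ∀ p, p - a.2 ∈ a.1.cells → p ∈ G.cells := by
      intro a ha p hp
      simpa using ht.1 a ha _ hp
    by_cases hq : q ∈ G.cells
    · obtain ⟨a, ⟨ha, hqa⟩, hua⟩ := ht.2 q hq
      refine ⟨a.1.edge (q - a.2) d, fun h => (outer a ha q d hqa (h.1 hq)).symm, ?_⟩
      intro b hb hsep
      by_cases hqb : q - b.2 ∈ b.1.cells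
      · rw [hua b ⟨hb, hqb⟩]
      · have hpb : q + d.vec - b.2 ∈ b.1.cells := by
          by_contra hpb
          refine hqb (hsep.2 ?_)
          convert hpb using 2; abel
        exact (inner a ha b hb q d hqa hpb (by rintro rfl; exact hqb hqa)).symm
    · refine ⟨G.edge q d, fun _ => rfl, fun b hb hsep => ?_⟩
      have hqb : q - b.2 ∉ b.1.cells := fun h => hq (hcov b hb q h)
      have hpb : q + d.vec - b.2 ∈ b.1.cells := by
        by_contra hpb
        refine hqb (hsep.2 ?_)
        convert hpb using 2; abel
      have := outer b hb (q + d.vec) d.opp hpb (by rwa [Dir.vec_add_opp])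
      rw [G.edge_opp, show q + d.vec - b.2 = q - b.2 + d.vec by abel, b.1.edge_opp] at this
      exact this
  -- So each small cell `z` can be credited to one cell `r` of the original lattice, simultaneously
  -- for the region and for all copies, and the tiling is transported.
  have key : ∀ z, ∃ r, (z ∈ (jigsaw G).cells ↔ r ∈ G.cells) ∧ ∀ a ∈ P,
      (z - scaled (c + 4) a.2 0 ∈ (jigsaw a.1.toLabelledRegion).cells ↔ r - a.2 ∈ a.1.cells) := by
    intro z
    rcases cell_cases (K := c + 4) (by omega) z with
      ⟨q, v, rfl, h₁, h₂, hv⟩ | ⟨q, b, k, rfl, h₁, h₂⟩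
    · refine ⟨q, mem_jigsaw_core G h₁ h₂ hv, fun a _ => ?_⟩
      rw [scaled_sub, mem_jigsaw_core _ h₁ h₂ hv]
    · obtain ⟨e, he, hea⟩ := edges q (back b)
      refine ⟨if k = e then q + (back b).vec else q, ?_, fun a ha => ?_⟩
      · rw [mem_jigsaw_slot G h₁ h₂]
        by_cases hs : q ∈ G.cells ↔ q + (back b).vec ∉ G.cells
        · rw [he hs]; split_ifs <;> rfl
        · split_ifs <;> tauto
      · rw [scaled_sub, mem_jigsaw_slot _ h₁ h₂]
        by_cases hs : q - a.2 ∈ a.1.cells ↔ q - a.2 + (back b).vec ∉ a.1.cells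
        · rw [hea a ha hs]
          split_ifs
          · rw [show q - a.2 + (back b).vec = q + (back b).vec - a.2 by abel]
          · rfl
        · rw [show q - a.2 + (back b).vec = q + (back b).vec - a.2 by abel] at hs ⊢
          split_ifs <;> tauto
  refine ⟨P.map jigsawPlace, fun a ha => ?_, fun a ha z hz => ?_, fun z hz => ?_⟩
  · obtain ⟨a, ha', rfl⟩ := Finset.mem_map.1 ha
    exact Finset.mem_map.2 ⟨_, hP a ha', rfl⟩
  · obtain ⟨a, ha', rfl⟩ := Finset.mem_map.1 ha
    obtain ⟨r, h₁, h₂⟩ := key (z + scaled (c + 4) a.2 0)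
    have h₃ := (h₂ a ha').1 (by rw [add_sub_cancel_right]; exact hz)
    exact h₁.2 (by simpa using ht.1 a ha' _ h₃)
  · obtain ⟨r, h₁, h₂⟩ := key z
    obtain ⟨a, ⟨ha, hra⟩, hu⟩ := ht.2 r (h₁.1 hz)
    refine ⟨jigsawPlace a, ⟨Finset.mem_map_of_mem _ ha, (h₂ a ha).2 hra⟩, ?_⟩
    rintro b ⟨hb, hzb⟩
    obtain ⟨b, hb', rfl⟩ := Finset.mem_map.1 hb
    rw [hu b ⟨hb', (h₂ b hb').1 hzb⟩]

end Jigsaw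

section Jigsaw

variable {c : ℕ}

theorem mem_place_slot {q : Cell} {b : Bool} {k : ℤ} (h₁ : 1 ≤ k) (h₂ : k < (c + 4 : ℤ))
    (a : WangTile (Fin c) × Cell) :
    scaled (c + 4) q (slotPos k b) - (jigsawPlace a).2 ∈ (jigsawPlace a).1.cells ↔
      if k = a.1.edge (q - a.2) (back b) then q + (back b).vec - a.2 ∈ a.1.cells
      else q - a.2 ∈ a.1.cells := by
  change scaled (c + 4) q (slotPos k b) - scaled (c + 4) a.2 0 ∈
    (jigsaw a.1.toLabelledRegion).cells ↔ _
  rw [scaled_sub, mem_jigsaw_slot _ h₁ h₂, show q - a.2 + (back b).vec = q + (back b).vec - a.2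
    by abel]

theorem mem_place_core {q v : Cell} (h₁ : 0 ≤ v.1 ∧ v.1 < (c + 4 : ℤ))
    (h₂ : 0 ≤ v.2 ∧ v.2 < (c + 4 : ℤ)) (hv : v.1 = 0 ↔ v.2 = 0) (a : WangTile (Fin c) × Cell) :
    scaled (c + 4) q v - (jigsawPlace a).2 ∈ (jigsawPlace a).1.cells ↔ q - a.2 ∈ a.1.cells := by
  change scaled (c + 4) q v - scaled (c + 4) a.2 0 ∈ (jigsaw a.1.toLabelledRegion).cells ↔ _
  rw [scaled_sub, mem_jigsaw_core _ h₁ h₂ hv]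

theorem mem_place_corner {q : Cell} (a : WangTile (Fin c) × Cell) :
    scaled (c + 4) q 0 - (jigsawPlace a).2 ∈ (jigsawPlace a).1.cells ↔ q - a.2 ∈ a.1.cells :=
  mem_place_core (by simp; omega) (by simp; omega) Iff.rfl a

/-! ### Alignment and matching of jigsaw tiles -/

section Aligned

variable {G : LabelledRegion (Fin c)} {P : Finset (Tile × Cell)}
  (ht : IsTiling (fun t : Tile => t.cells) (jigsaw G).cells P)
include ht

theorem IsTiling.mem_of_place {z : Cell} {a : Tile × Cell} (ha : a ∈ P)
    (hz : z - a.2 ∈ a.1.cells) : z ∈ (jigsaw G).cells := by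
  simpa using ht.1 a ha _ hz

theorem IsTiling.place_unique {z : Cell} {a b : Tile × Cell} (ha : a ∈ P) (hb : b ∈ P)
    (hza : z - a.2 ∈ a.1.cells) (hzb : z - b.2 ∈ b.1.cells) : a = b :=
  (ht.2 z (ht.mem_of_place ha hza)).unique ⟨ha, hza⟩ ⟨hb, hzb⟩

/-- Otherwise the slot that `b` claims is not ceded by `a`, and it is covered twice. -/
theorem edge_eq_of_adjacent {a b : WangTile (Fin c) × Cell} (ha : jigsawPlace a ∈ P)
    (hb : jigsawPlace b ∈ P) {q : Cell} {s : Bool} (hqa : q - a.2 ∈ a.1.cells)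
    (hqb : q + (back s).vec - b.2 ∈ b.1.cells) (hab : a ≠ b) :
    a.1.edge (q - a.2) (back s) = b.1.edge (q - b.2) (back s) := by
  by_contra hne
  have hk := b.1.edge_bound (q - b.2) (back s)
  refine hab (jigsawPlace.injective (ht.place_unique (z := scaled (c + 4) q
    (slotPos (b.1.edge (q - b.2) (back s)) s)) ha hb ?_ ?_))
  · rw [mem_place_slot (by omega) (by omega), if_neg (Ne.symm hne)]
    exact hqa
  · rw [mem_place_slot (by omega) (by omega), if_pos rfl]
    exact hqb

/-- Otherwise the slot that the region has ceded to its outside is kept by `a`, which then sticks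
out of the region. -/
theorem edge_eq_of_boundary {a : WangTile (Fin c) × Cell} (ha : jigsawPlace a ∈ P) {q : Cell}
    {s : Bool} (hqa : q - a.2 ∈ a.1.cells) (hq : q + (back s).vec ∉ G.cells) :
    a.1.edge (q - a.2) (back s) = G.edge q (back s) := by
  by_contra hne
  have hk := G.edge_bound q (back s)
  have : scaled (c + 4) q (slotPos (G.edge q (back s)) s) ∈ (jigsaw G).cells := by
    refine ht.mem_of_place ha ?_
    rw [mem_place_slot (by omega) (by omega), if_neg (Ne.symm hne)]
    exact hqa
  rw [mem_jigsaw_slot _ (by omega) (by omega), if_pos rfl] at this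
  exact hq this

theorem edge_eq_of_boundary' {a : WangTile (Fin c) × Cell} (ha : jigsawPlace a ∈ P) {q : Cell}
    {s : Bool} (hqa : q + (back s).vec - a.2 ∈ a.1.cells) (hq : q ∉ G.cells) :
    a.1.edge (q - a.2) (back s) = G.edge q (back s) := by
  by_contra hne
  have hk := a.1.edge_bound (q - a.2) (back s)
  have : scaled (c + 4) q (slotPos (a.1.edge (q - a.2) (back s)) s) ∈ (jigsaw G).cells := by
    refine ht.mem_of_place ha ?_
    rw [mem_place_slot (by omega) (by omega), if_pos rfl]
    exact hqa
  rw [mem_jigsaw_slot _ (by omega) (by omega), if_neg hne] at this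
  exact hq this

/-- In a tiling by jigsaw tiles all tiles are aligned with the scaled lattice. -/
theorem exists_jigsawPlace (hP : ∀ a ∈ P, ∃ t : WangTile (Fin c), a.1 = jigsawTile t)
    {a₀ : Tile × Cell} (ha₀ : a₀ ∈ P) : ∃ b, a₀ = jigsawPlace (c := c) b := by
  classical
  by_contra hbad
  set U := (jigsaw G).cells.filter fun z => ∃ a ∈ P, (∀ b, a ≠ jigsawPlace (c := c) b) ∧
    z - a.2 ∈ a.1.cells with hU
  have hUne : U.Nonempty := by
    obtain ⟨⟨p, hp⟩⟩ := a₀.1.connected.nonempty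
    have hp' : p + a₀.2 - a₀.2 ∈ a₀.1.cells := by simpa using hp
    exact ⟨p + a₀.2, Finset.mem_filter.2 ⟨ht.mem_of_place ha₀ hp', a₀, ha₀,
      fun b hb => hbad ⟨b, hb⟩, hp'⟩⟩
  -- This is the lowest, and among the lowest the leftmost, small cell in a misaligned copy.
  obtain ⟨z, hzU, hmin⟩ := U.exists_min_image (fun z => toLex (z.2, z.1)) hUne
  have hmin' : ∀ w ∈ U, ¬ (w.2 < z.2 ∨ w.2 = z.2 ∧ w.1 < z.1) := by
    intro w hw h
    have := hmin w hw
    rw [Prod.Lex.toLex_le_toLex] at this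
    simp only at this
    omega
  obtain ⟨hzG, a, ha, hna, hza⟩ := Finset.mem_filter.1 hzU
  have hun : ∀ b, jigsawPlace (c := c) b ∈ P →
      z - (jigsawPlace b).2 ∉ (jigsawPlace b).1.cells :=
    fun b hb h => hna b (ht.place_unique ha hb hza h)
  have low : ∀ r ∈ G.cells, ((scaled (c + 4) r 0).2 < z.2 ∨
      (scaled (c + 4) r 0).2 = z.2 ∧ (scaled (c + 4) r 0).1 < z.1) →
      ∃ b, jigsawPlace (c := c) b ∈ P ∧ r - b.2 ∈ b.1.cells := by
    intro r hr hlt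
    have hr' := (mem_jigsaw_corner G).2 hr
    obtain ⟨b, ⟨hb, hrb⟩, -⟩ := ht.2 _ hr'
    by_cases h : ∃ b', b = jigsawPlace (c := c) b'
    · obtain ⟨b, rfl⟩ := h
      exact ⟨b, hb, (mem_place_corner b).1 hrb⟩
    · push Not at h
      exact absurd hlt (hmin' _ (Finset.mem_filter.2 ⟨hr', b, hb, h, hrb⟩))
  -- Every other cell of a jigsaw piece comes after its corner. So the minimal `z` is the corner of
  -- its piece, and were it also a corner of the scaled lattice, the copy would be aligned.
  have hcorner : ∀ r, z ≠ scaled (c + 4) r 0 := by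
    obtain ⟨t, hat⟩ := hP a ha
    rintro r rfl
    rw [hat, jigsawTile_cells, mem_jigsaw] at hza
    obtain ⟨w, hw, hzw⟩ := (t.owner_eq_iff _ (scaled (c + 4) r 0 - a.2)).1 rfl
    set q := owner (c + 4) (fun q b => t.edge q (back b)) (scaled (c + 4) r 0 - a.2)
    have hq : scaled (c + 4) q 0 + a.2 ∈ U := by
      have : scaled (c + 4) q 0 + a.2 - a.2 ∈ a.1.cells := by
        rw [add_sub_cancel_right, hat, jigsawTile_cells]
        exact (mem_jigsaw_corner _).2 hza
      exact Finset.mem_filter.2 ⟨ht.mem_of_place ha this, a, ha, hna, this⟩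
    have h₁ := hmin' _ hq
    have e₁ : (scaled (c + 4) r 0).1 = (scaled (c + 4) q w).1 + a.2.1 := by rw [hzw]; simp
    have e₂ : (scaled (c + 4) r 0).2 = (scaled (c + 4) q w).2 + a.2.2 := by rw [hzw]; simp
    have hw0 : w = 0 := by
      have b₁ := t.edge_bound q .right
      have b₂ := t.edge_bound q .up
      rw [e₁, e₂] at h₁
      simp only [scaled, Prod.fst_add, Prod.snd_add, Prod.fst_zero, Prod.snd_zero] at h₁
      rcases mem_piece.1 hw with ⟨⟨h, h'⟩, -⟩ | rfl | rfl
      · exact Prod.ext (by simp only [Prod.fst_zero]; omega) (by simp only [Prod.snd_zero]; omega)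
      · simp only at h₁; omega
      · simp only at h₁; omega
    refine hna (t, r - q) ?_
    rw [jigsawPlace_apply, ← hat]
    refine Prod.ext rfl ?_
    simp only
    rw [hw0] at hzw
    rw [← scaled_sub, hzw, sub_sub_cancel]
  -- Now the corner of each scaled cell that may own `z` comes before `z`. If it lies in the region,
  -- an aligned copy covers it, and such copies leave no room for `z` in a misaligned one.
  rcases cell_cases (K := c + 4) (by omega) z with ⟨q, v, rfl, h₁, h₂, hv⟩ | ⟨q, s, k, rfl, h₁, h₂⟩
  · by_cases h : v.1 = 0
    · exact hcorner q (by congr 1; exact Prod.ext h (hv.1 h))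
    · obtain ⟨b, hb, hqb⟩ := low q ((mem_jigsaw_core G h₁ h₂ hv).1 hzG) (by
        left; simp only [scaled, Prod.snd_zero]; omega)
      exact hun b hb ((mem_place_core h₁ h₂ hv b).2 hqb)
  · have lq : q ∈ G.cells → ∃ b, jigsawPlace (c := c) b ∈ P ∧ q - b.2 ∈ b.1.cells := by
      refine fun h => low q h ?_
      cases s <;> simp [scaled, slotPos] <;> omega
    have lp : q + (back s).vec ∈ G.cells →
        ∃ b, jigsawPlace (c := c) b ∈ P ∧ q + (back s).vec - b.2 ∈ b.1.cells := by
      refine fun h => low _ h ?_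
      cases s <;> simp [scaled, slotPos, back, Dir.vec, mul_add] <;> omega
    rw [mem_jigsaw_slot G h₁ h₂] at hzG
    simp only [mem_place_slot h₁ h₂] at hun
    by_cases hq : q ∈ G.cells <;> by_cases hp : q + (back s).vec ∈ G.cells
    · obtain ⟨a', ha', hqa⟩ := lq hq
      obtain ⟨b', hb', hqb⟩ := lp hp
      have h₃ := hun a' ha'
      have h₄ := hun b' hb'
      by_cases hab : a' = b'
      · subst hab
        split_ifs at h₃ <;> contradiction
      · rw [edge_eq_of_adjacent ht ha' hb' hqa hqb hab] at h₃
        split_ifs at h₃ h₄ <;> contradiction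
    · obtain ⟨a', ha', hqa⟩ := lq hq
      have h₃ := hun a' ha'
      rw [edge_eq_of_boundary ht ha' hqa hp] at h₃
      split_ifs at h₃ hzG <;> contradiction
    · obtain ⟨b', hb', hqb⟩ := lp hp
      have h₃ := hun b' hb'
      rw [edge_eq_of_boundary' ht hb' hqb hq] at h₃
      split_ifs at h₃ hzG <;> contradiction
    · split_ifs at hzG <;> contradiction

end Aligned

/-- Once the copies are aligned, the corners of the scaled cells show which original cell belongs to
which copy. Equal positions on an edge mean equal colours, because the position is the colour plus
three. -/
theorem tileable_of_jigsaw {T : Finset (WangTile (Fin c))} {G : LabelledRegion (Fin c)}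
    (h : Tileable (T.map jigsawEmb) (jigsaw G)) : WangTileable T G := by
  classical
  obtain ⟨P, hP, ht⟩ := h
  have hal : ∀ a ∈ P, ∃ b, a = jigsawPlace (c := c) b := fun a ha => exists_jigsawPlace ht
    (fun a ha => by
      obtain ⟨t, -, h⟩ := Finset.mem_map.1 (hP a ha)
      exact ⟨t, h.symm⟩) ha
  have hin : ∀ a : WangTile (Fin c) × Cell, jigsawPlace a ∈ P → ∀ q, q - a.2 ∈ a.1.cells →
      q ∈ G.cells := fun a ha q hq =>
    (mem_jigsaw_corner G).1 (ht.mem_of_place ha ((mem_place_corner a).2 hq))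
  have hmem : ∀ a, a ∈ P.preimage jigsawPlace jigsawPlace.injective.injOn ↔
      jigsawPlace (c := c) a ∈ P := fun a => Finset.mem_preimage
  have edge_label : ∀ (Y : LabelledRegion (Fin c)) (q : Cell) (d : Dir) (h₁ : q ∈ Y.cells)
      (h₂ : q + d.vec ∉ Y.cells), Y.edge q d = (Y.label ⟨(q, d), h₁, h₂⟩ : ℕ) + 3 := by
    intro Y q d h₁ h₂
    rw [Y.edge_of_mem h₁, Y.natCode_of_notMem h₁ h₂]
    push_cast
    ring
  have inner : ∀ a b : WangTile (Fin c) × Cell, jigsawPlace a ∈ P → jigsawPlace b ∈ P →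
      ∀ q d, q - a.2 ∈ a.1.cells → q + Dir.vec d - b.2 ∈ b.1.cells → a ≠ b →
      a.1.edge (q - a.2) d = b.1.edge (q + d.vec - b.2) d.opp := by
    intro a b ha hb q d hqa hqb hab
    rw [show q + d.vec - b.2 = q - b.2 + d.vec by abel, b.1.edge_opp]
    have fwd : ∀ s, d = back s → a.1.edge (q - a.2) d = b.1.edge (q - b.2) d := by
      rintro s rfl
      exact edge_eq_of_adjacent ht ha hb hqa hqb hab
    have bwd : ∀ s, d.opp = back s → a.1.edge (q - a.2) d = b.1.edge (q - b.2) d := by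
      intro s hs
      have := edge_eq_of_adjacent ht hb ha (q := q + d.vec) (s := s) hqb
        (by rwa [← hs, Dir.vec_add_opp]) hab.symm
      rw [← hs, show q + d.vec - b.2 = q - b.2 + d.vec by abel, b.1.edge_opp,
        show q + d.vec - a.2 = q - a.2 + d.vec by abel, a.1.edge_opp] at this
      exact this.symm
    cases d
    · exact bwd true rfl
    · exact bwd false rfl
    · exact fwd true rfl
    · exact fwd false rfl
  have outer : ∀ a : WangTile (Fin c) × Cell, jigsawPlace a ∈ P →
      ∀ q d, q - a.2 ∈ a.1.cells → q + Dir.vec d ∉ G.cells →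
      a.1.edge (q - a.2) d = G.edge q d := by
    intro a ha q d hqa hq
    have fwd : ∀ s, d = back s → a.1.edge (q - a.2) d = G.edge q d := by
      rintro s rfl
      exact edge_eq_of_boundary ht ha hqa hq
    have bwd : ∀ s, d.opp = back s → a.1.edge (q - a.2) d = G.edge q d := by
      intro s hs
      have := edge_eq_of_boundary' ht ha (q := q + d.vec) (s := s)
        (by rwa [← hs, Dir.vec_add_opp]) hq
      rwa [← hs, G.edge_opp, show q + d.vec - a.2 = q - a.2 + d.vec by abel,
        a.1.edge_opp] at this
    cases d
    · exact bwd true rfl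
    · exact bwd false rfl
    · exact fwd true rfl
    · exact fwd false rfl
  refine ⟨P.preimage jigsawPlace jigsawPlace.injective.injOn, fun a ha => ?_,
    ⟨fun a ha q hq => ?_, fun q hq => ?_⟩, fun a ha b hb => ?_, fun a ha => ?_⟩
  · obtain ⟨t, ht', h⟩ := Finset.mem_map.1 (hP _ ((hmem a).1 ha))
    rwa [← jigsawEmb.injective h]
  · exact hin a ((hmem a).1 ha) _ (by simpa using hq)
  · obtain ⟨a, ⟨ha, hqa⟩, hu⟩ := ht.2 _ ((mem_jigsaw_corner G).2 hq)
    obtain ⟨a, rfl⟩ := hal a ha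
    refine ⟨a, ⟨(hmem a).2 ha, (mem_place_corner a).1 hqa⟩, ?_⟩
    rintro b ⟨hb, hqb⟩
    exact jigsawPlace.injective (hu _ ⟨(hmem b).1 hb, (mem_place_corner b).2 hqb⟩)
  · rintro ⟨⟨r, d⟩, hr, hrd⟩ ⟨⟨r', d'⟩, hr', hrd'⟩ h h'
    simp only at hr hrd hr' hrd' h h'
    subst h'
    have hab : a ≠ b := by
      rintro rfl
      refine hrd ?_
      convert hr' using 1
      exact (add_right_cancel (h.trans (by abel))).symm
    have e₁ : r' = r + a.2 + d.vec - b.2 := eq_sub_of_add_eq h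
    have := inner a b ((hmem a).1 ha) ((hmem b).1 hb) (r + a.2) d (by simpa using hr)
      (by rwa [← e₁]) hab
    rw [← e₁, add_sub_cancel_right, edge_label _ _ _ hr hrd, edge_label _ _ _ hr' hrd'] at this
    exact Fin.ext (by omega)
  · rintro ⟨⟨r, d⟩, hr, hrd⟩ ⟨⟨q, d'⟩, hq, hqd⟩ h h'
    simp only at hr hrd hq hqd h h'
    subst h' h
    have := outer a ((hmem a).1 ha) (r + a.2) d' (by simpa using hr) hqd
    rw [add_sub_cancel_right, edge_label _ _ _ hr hrd, edge_label _ _ _ hq hqd] at this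
    exact Fin.ext (by omega)

theorem generalizedWangTiles_reducible_ordinaryTiles :
    LinearTimeReducibleSameCard generalizedWangTiles ordinaryTiles := by
  rintro ⟨c, T⟩
  exact ⟨T.map jigsawEmb, jigsaw, Finset.card_map _, jigsaw_computable _, fun G =>
    ⟨jigsaw_tileable, tileable_of_jigsaw⟩⟩

end Jigsaw

/-! ### A tiling of the plane by bricks and chips

The plane is tiled by bricks of about `3 * u` by `4` and chips of about `2 * u` by `2` or `3`, one
brick and one chip for each cell of the lattice. The vertical walls between them are displaced by
small amounts `d`. -/

/-- The abscissa of the wall on the right of the brick of the cell `(a, b)`. -/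
def wall (u : ℤ) (d : ℤ → ℤ → ℤ) (a b : ℤ) : ℤ := u * (3 * a - 2 * b) + d a b

/-- The height of the bottom of the brick of the cell `(a, b)`. -/
def base (a b : ℤ) : ℤ := 5 * a / 2 + 4 * b

/-- The point `(x, y)` lies in the brick of the cell `(a, b)`. -/
def InBrick (u : ℤ) (d : ℤ → ℤ → ℤ) (a b x y : ℤ) : Prop :=
  wall u d (a - 1) b ≤ x ∧ x < wall u d a b ∧ base a b ≤ y ∧ y < base a b + 4

/-- The point `(x, y)` lies in the chip of the cell `(a, b)`. -/
def InChip (u : ℤ) (d : ℤ → ℤ → ℤ) (a b x y : ℤ) : Prop :=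
  wall u d a b ≤ x ∧ x < wall u d a (b - 1) ∧ base a b ≤ y ∧ y < base (a + 1) b

/-- The displacements `d` lie between `0` and `e`, which is small compared to `u`. -/
structure SmallShift (u e : ℤ) (d : ℤ → ℤ → ℤ) : Prop where
  lt : 10 * e < u
  nonneg : ∀ a b, 0 ≤ d a b
  le : ∀ a b, d a b ≤ e

/-- Owing to the slope `5 / 2` the height of a chip reveals the parity of its column. -/
theorem base_succ (a b : ℤ) :
    base (a + 1) b = base a b + 2 ∧ a % 2 = 0 ∨ base (a + 1) b = base a b + 3 ∧ a % 2 = 1 := by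
  unfold base; omega

theorem base_pred_right (a b : ℤ) : base a (b - 1) = base a b - 4 := by
  unfold base; omega

section Shift

variable {u e : ℤ} {d : ℤ → ℤ → ℤ} (hd : SmallShift u e d)
include hd

theorem SmallShift.e_nonneg : 0 ≤ e := (hd.nonneg 0 0).trans (hd.le 0 0)

theorem SmallShift.wall_bounds (a b : ℤ) :
    u * (3 * a - 2 * b) ≤ wall u d a b ∧ wall u d a b ≤ u * (3 * a - 2 * b) + e := by
  unfold wall
  exact ⟨by linarith [hd.nonneg a b], by linarith [hd.le a b]⟩

theorem SmallShift.wall_left (a b : ℤ) :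
    wall u d a b - 3 * u - e ≤ wall u d (a - 1) b ∧
      wall u d (a - 1) b ≤ wall u d a b - 3 * u + e := by
  have h₁ := hd.wall_bounds a b
  have h₂ := hd.wall_bounds (a - 1) b
  constructor <;> linarith

theorem SmallShift.wall_down (a b : ℤ) :
    wall u d a b + 2 * u - e ≤ wall u d a (b - 1) ∧
      wall u d a (b - 1) ≤ wall u d a b + 2 * u + e := by
  have h₁ := hd.wall_bounds a b
  have h₂ := hd.wall_bounds a (b - 1)
  constructor <;> linarith

omit hd in
/-- The row of the cell in column `a` whose brick meets the line at height `y`. -/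
def rowAt (y a : ℤ) : ℤ := (y - 5 * a / 2) / 4

omit hd in
theorem eq_rowAt_iff {a b y : ℤ} : b = rowAt y a ↔ base a b ≤ y ∧ y < base a b + 4 := by
  unfold rowAt base; omega

omit hd in
/-- The left end of the part in column `a` of the line at height `y`. -/
def startAt (u : ℤ) (d : ℤ → ℤ → ℤ) (y a : ℤ) : ℤ := wall u d (a - 1) (rowAt y a)

omit hd in
theorem rowAt_succ (y a : ℤ) :
    y < base (a + 1) (rowAt y a) ∧ rowAt y (a + 1) = rowAt y a - 1 ∨
      base (a + 1) (rowAt y a) ≤ y ∧ rowAt y (a + 1) = rowAt y a := by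
  unfold base rowAt; omega

/-- A horizontal line meets one brick in each column. If it runs below the bottom of the next brick
in the row, the chip follows and the line continues one row lower; otherwise it passes directly into
that next brick. In both cases the part in column `a` ends where that of column `a + 1` starts. -/
theorem inBrick_or_inChip_iff {a b x y : ℤ} :
    InBrick u d a b x y ∨ InChip u d a b x y ↔
      b = rowAt y a ∧ startAt u d y a ≤ x ∧ x < startAt u d y (a + 1) := by
  by_cases hb : b = rowAt y a
  · have h₁ := hd.wall_left a b
    have h₂ := hd.wall_down a b
    have hu := hd.lt
    have he := hd.e_nonneg
    have hy := eq_rowAt_iff.1 hb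
    unfold InBrick InChip startAt
    rcases rowAt_succ y a with ⟨h, h'⟩ | ⟨h, h'⟩ <;> rw [← hb] at h h' <;>
      rw [h', ← hb, add_sub_cancel_right] <;> constructor <;> intro H <;> omega
  · refine iff_of_false ?_ fun h => hb h.1
    have := base_succ a b
    rw [eq_rowAt_iff] at hb
    unfold InBrick InChip
    omega

theorem SmallShift.startAt_lt (y a : ℤ) : startAt u d y a < startAt u d y (a + 1) := by
  have h₁ := hd.wall_left a (rowAt y a)
  have h₂ := hd.wall_down a (rowAt y a)
  have hu := hd.lt
  have he := hd.e_nonneg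
  unfold startAt
  rcases rowAt_succ y a with ⟨-, h'⟩ | ⟨-, h'⟩ <;> rw [h', add_sub_cancel_right] <;> omega

theorem SmallShift.startAt_strictMono (y : ℤ) : StrictMono (startAt u d y) :=
  strictMono_int_of_lt_succ (hd.startAt_lt y)

omit hd in
theorem exists_mem_Ico_of_strictMono {f : ℤ → ℤ} (hf : StrictMono f) (x : ℤ) :
    ∃ a, f a ≤ x ∧ x < f (a + 1) := by
  have grow : ∀ (a : ℤ) (n : ℕ), f a + n ≤ f (a + n) := by
    intro a n
    induction n with
    | zero => simp
    | succ n ih =>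
      have := hf (show a + (n : ℤ) < a + ((n + 1 : ℕ) : ℤ) by push_cast; omega)
      push_cast at this ⊢
      omega
  obtain ⟨a, ha, hmax⟩ := Int.exists_greatest_of_bdd (P := fun a => f a ≤ x)
    ⟨(x - f 0).toNat, fun a ha => by
      by_contra hlt
      have h₁ := grow 0 a.toNat
      rw [zero_add, Int.toNat_of_nonneg (by omega)] at h₁
      omega⟩
    ⟨-((f 0 - x).toNat : ℤ), by
      have h₁ := grow (-((f 0 - x).toNat : ℤ)) (f 0 - x).toNat
      rw [neg_add_cancel] at h₁
      omega⟩
  refine ⟨a, ha, ?_⟩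
  by_contra h
  have := hmax (a + 1) (by omega)
  omega

/-- The bricks and chips tile the plane. -/
theorem SmallShift.existsUnique (z : Cell) :
    ∃! p : Cell, InBrick u d p.1 p.2 z.1 z.2 ∨ InChip u d p.1 p.2 z.1 z.2 := by
  obtain ⟨a, h₁, h₂⟩ := exists_mem_Ico_of_strictMono (hd.startAt_strictMono z.2) z.1
  refine ⟨(a, rowAt z.2 a), (inBrick_or_inChip_iff hd).2 ⟨rfl, h₁, h₂⟩, ?_⟩
  rintro ⟨a', b'⟩ h
  obtain ⟨h₃, h₄, h₅⟩ := (inBrick_or_inChip_iff hd).1 h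
  have e₁ := (hd.startAt_strictMono z.2).lt_iff_lt.1 (h₁.trans_lt h₅)
  have e₂ := (hd.startAt_strictMono z.2).lt_iff_lt.1 (h₄.trans_lt h₂)
  obtain rfl : a' = a := by omega
  rw [← h₃]

omit hd in
open Classical in
/-- The cell whose brick or chip contains a point. -/
noncomputable def holder (u : ℤ) (d : ℤ → ℤ → ℤ) (z : Cell) : Cell :=
  if h : ∃ p : Cell, InBrick u d p.1 p.2 z.1 z.2 ∨ InChip u d p.1 p.2 z.1 z.2 then h.choose else 0

theorem SmallShift.holder_eq_iff {z p : Cell} :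
    holder u d z = p ↔ InBrick u d p.1 p.2 z.1 z.2 ∨ InChip u d p.1 p.2 z.1 z.2 := by
  have h := (hd.existsUnique z).exists
  rw [holder, dif_pos h]
  exact ⟨fun h' => h' ▸ h.choose_spec, fun h' => (hd.existsUnique z).unique h.choose_spec h'⟩

theorem SmallShift.holder_of_brick {a b x y : ℤ} (h : InBrick u d a b x y) :
    holder u d (x, y) = (a, b) := hd.holder_eq_iff.2 (Or.inl h)

theorem SmallShift.holder_of_chip {a b x y : ℤ} (h : InChip u d a b x y) :
    holder u d (x, y) = (a, b) := hd.holder_eq_iff.2 (Or.inr h)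

theorem SmallShift.holder_fibre_connected (p : Cell) :
    (grid.induce (holder u d ⁻¹' {p})).Connected := by
  obtain ⟨a, b⟩ := p
  have h₁ := hd.wall_left a b
  have h₂ := hd.wall_down a b
  have hu := hd.lt
  have he := hd.e_nonneg
  have hb := base_succ a b
  have mem : ∀ z : Cell, z ∈ holder u d ⁻¹' {(a, b)} ↔
      InBrick u d a b z.1 z.2 ∨ InChip u d a b z.1 z.2 := fun z => hd.holder_eq_iff
  have left : (wall u d a b - 1, base a b) ∈ holder u d ⁻¹' {(a, b)} :=
    (mem _).2 (Or.inl ⟨by simp only; omega, by simp, by simp, by simp⟩)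
  have right : (wall u d a b, base a b) ∈ holder u d ⁻¹' {(a, b)} :=
    (mem _).2 (Or.inr ⟨by simp, by simp only; omega, by simp, by simp only; omega⟩)
  have key : ∀ z ∈ holder u d ⁻¹' {(a, b)},
      Joined (holder u d ⁻¹' {(a, b)}) z (wall u d a b, base a b) := by
    intro z hz
    rcases (mem z).1 hz with ⟨k₁, k₂, k₃, k₄⟩ | ⟨k₁, k₂, k₃, k₄⟩
    · refine Joined.trans (q := (wall u d a b - 1, base a b)) ?_
        (Joined.of_adj left right (by simpa using adj_right (wall u d a b - 1) (base a b)))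
      refine joined_box (I := Set.Ico (wall u d (a - 1) b) (wall u d a b))
        (J := Set.Ico (base a b) (base a b + 4)) ?_ ?_ ?_
      · rintro w ⟨⟨l₁, l₂⟩, l₃, l₄⟩
        exact (mem w).2 (Or.inl ⟨l₁, l₂, l₃, l₄⟩)
      · exact ⟨⟨k₁, k₂⟩, k₃, k₄⟩
      · exact ⟨⟨by simp only; omega, by simp⟩, by simp, by simp⟩
    · refine joined_box (I := Set.Ico (wall u d a b) (wall u d a (b - 1)))
        (J := Set.Ico (base a b) (base (a + 1) b)) ?_ ?_ ?_
      · rintro w ⟨⟨l₁, l₂⟩, l₃, l₄⟩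
        exact (mem w).2 (Or.inr ⟨l₁, l₂, l₃, l₄⟩)
      · exact ⟨⟨k₁, k₂⟩, k₃, k₄⟩
      · exact ⟨⟨by simp, by simp only; omega⟩, by simp, by simp only; omega⟩
  exact connected_iff_joined.2 ⟨⟨_, right⟩, fun z hz w hw => (key z hz).trans (key w hw).symm⟩

theorem SmallShift.holder_adj (p : Cell) (t : Dir) :
    ∃ z w, grid.Adj z w ∧ holder u d z = p ∧ holder u d w = p + t.vec := by
  have hu := hd.lt
  have he := hd.e_nonneg
  have right : ∀ a b, ∃ z w, grid.Adj z w ∧ holder u d z = (a, b) ∧ holder u d w = (a + 1, b) := by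
    intro a b
    have h₁ := hd.wall_left a b
    have h₂ := hd.wall_left (a + 1) b
    rw [add_sub_cancel_right] at h₂
    have hb := base_succ a b
    refine ⟨(wall u d a b - 1, base (a + 1) b), (wall u d a b, base (a + 1) b),
      by simpa using adj_right (wall u d a b - 1) (base (a + 1) b),
      hd.holder_of_brick ⟨?_, ?_, ?_, ?_⟩, hd.holder_of_brick ⟨?_, ?_, ?_, ?_⟩⟩ <;>
      try rw [add_sub_cancel_right]
    all_goals omega
  have up : ∀ a b, ∃ z w, grid.Adj z w ∧ holder u d z = (a, b) ∧ holder u d w = (a, b + 1) := by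
    intro a b
    have h₁ := hd.wall_left a b
    have h₂ := hd.wall_down a (b + 1)
    have h₃ := hd.wall_down (a - 1) (b + 1)
    rw [add_sub_cancel_right] at h₂ h₃
    have hb : base a (b + 1) = base a b + 4 := by unfold base; omega
    refine ⟨(wall u d (a - 1) b, base a b + 3), (wall u d (a - 1) b, base a b + 4),
      by simpa [add_assoc] using adj_up (wall u d (a - 1) b) (base a b + 3),
      hd.holder_of_brick ⟨?_, ?_, ?_, ?_⟩, hd.holder_of_brick ⟨?_, ?_, ?_, ?_⟩⟩
    all_goals omega
  obtain ⟨a, b⟩ := p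
  cases t
  · simpa [Dir.vec] using right a b
  · simpa [Dir.vec] using up a b
  · obtain ⟨z, w, h, h₁, h₂⟩ := right (a - 1) b
    exact ⟨w, z, h.symm, by simpa using h₂, by simpa [Dir.vec, sub_eq_add_neg] using h₁⟩
  · obtain ⟨z, w, h, h₁, h₂⟩ := up a (b - 1)
    exact ⟨w, z, h.symm, by simpa using h₂, by simpa [Dir.vec, sub_eq_add_neg] using h₁⟩

end Shift

/-- The lower left corner, the width and the height of the brick of a cell. -/
def brickBox (u : ℤ) (d : ℤ → ℤ → ℤ) (p : Cell) : Cell × ℤ × ℤ :=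
  ((wall u d (p.1 - 1) p.2, base p.1 p.2), wall u d p.1 p.2 - wall u d (p.1 - 1) p.2, 4)

/-- The lower left corner, the width and the height of the chip of a cell. -/
def chipBox (u : ℤ) (d : ℤ → ℤ → ℤ) (p : Cell) : Cell × ℤ × ℤ :=
  ((wall u d p.1 p.2, base p.1 p.2), wall u d p.1 (p.2 - 1) - wall u d p.1 p.2,
    base (p.1 + 1) p.2 - base p.1 p.2)

/-- The cells of a box given by its lower left corner, width and height. -/
noncomputable def boxCells (r : Cell × ℤ × ℤ) : Finset Cell := box r.1 r.2.1 r.2.2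

theorem mem_boxCells {r : Cell × ℤ × ℤ} {z : Cell} :
    z ∈ boxCells r ↔ (r.1.1 ≤ z.1 ∧ z.1 < r.1.1 + r.2.1) ∧
      (r.1.2 ≤ z.2 ∧ z.2 < r.1.2 + r.2.2) := mem_box

theorem mem_brickBox {u : ℤ} {d : ℤ → ℤ → ℤ} {p z : Cell} :
    z ∈ boxCells (brickBox u d p) ↔ InBrick u d p.1 p.2 z.1 z.2 := by
  rw [mem_boxCells]; unfold InBrick brickBox; simp only; omega

theorem mem_chipBox {u : ℤ} {d : ℤ → ℤ → ℤ} {p z : Cell} :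
    z ∈ boxCells (chipBox u d p) ↔ InChip u d p.1 p.2 z.1 z.2 := by
  rw [mem_boxCells]; unfold InChip chipBox; simp only; omega

/-- The union of the bricks and chips of the cells of a region. -/
noncomputable def brickwork {u e : ℤ} {d : ℤ → ℤ → ℤ} (hd : SmallShift u e d) (G : Region) :
    Region :=
  have key : ((G.cells.biUnion fun p =>
      boxCells (brickBox u d p) ∪ boxCells (chipBox u d p) : Finset Cell) : Set Cell) =
      holder u d ⁻¹' G.cells := by
    ext z
    simp only [Finset.coe_biUnion, Set.mem_iUnion, Finset.mem_coe, Finset.mem_union, mem_brickBox,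
      mem_chipBox, Set.mem_preimage]
    exact ⟨fun ⟨p, hp, h⟩ => (hd.holder_eq_iff.2 h).symm ▸ hp,
      fun h => ⟨_, h, hd.holder_eq_iff.1 rfl⟩⟩
  { cells := G.cells.biUnion fun p => boxCells (brickBox u d p) ∪ boxCells (chipBox u d p)
    connected := by
      rw [key]; exact connected_preimage hd.holder_fibre_connected hd.holder_adj G.connected
    noHoles := by
      rw [key, ← Set.preimage_compl]
      exact connected_preimage hd.holder_fibre_connected hd.holder_adj G.noHoles }

theorem mem_brickwork {u e : ℤ} {d : ℤ → ℤ → ℤ} (hd : SmallShift u e d) {G : Region} {z : Cell} :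
    z ∈ (brickwork hd G).cells ↔ holder u d z ∈ G.cells := by
  simp only [brickwork, Finset.mem_biUnion, Finset.mem_union, mem_brickBox, mem_chipBox]
  exact ⟨fun ⟨p, hp, h⟩ => (hd.holder_eq_iff.2 h).symm ▸ hp,
    fun h => ⟨_, h, hd.holder_eq_iff.1 rfl⟩⟩

/-! ### Coding by widths of rectangles -/

/-- Symbols with numbers that can be recovered from sums of three of them. A symbol has a type
that consists of two bits; symbols related by `H` differ in the first bit only, symbols related by
`V` differ in the second bit only. -/
structure BrickCode (u e : ℤ) (I : Type) where
  shift : I → ℤ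
  xbit : I → Bool
  ybit : I → Bool
  H : I → I → Prop
  V : I → I → Prop
  lt : 10 * e < u
  shift_nonneg : ∀ i, 0 ≤ shift i
  shift_le : ∀ i, shift i ≤ e
  sum_eq : ∀ {i j k i' j' k' : I}, shift i + shift j + shift k = shift i' + shift j' + shift k' →
    ({i, j, k} : Multiset I) = {i', j', k'}
  H_bits : ∀ {i j}, H i j → xbit i ≠ xbit j ∧ ybit i = ybit j
  V_bits : ∀ {i j}, V i j → xbit i = xbit j ∧ ybit i ≠ ybit j

namespace BrickCode

variable {u e : ℤ} {I : Type} (K : BrickCode u e I)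

/-- The type of the symbol at each place is the parity of the place. -/
def TypedAt (σ : ℤ → ℤ → I) (a b : ℤ) : Prop :=
  K.xbit (σ a b) = decide (a % 2 = 1) ∧ K.ybit (σ a b) = decide (b % 2 = 1)

/-- The displacements of the walls for a field of symbols. -/
def shifts (σ : ℤ → ℤ → I) (a b : ℤ) : ℤ := K.shift (σ a b)

theorem smallShift (σ : ℤ → ℤ → I) : SmallShift u e (K.shifts σ) :=
  ⟨K.lt, fun _ _ => K.shift_nonneg _, fun _ _ => K.shift_le _⟩

/-- The dimensions of the bricks. -/
def IsBrick (w : ℤ × ℤ) : Prop := ∃ i j, K.H i j ∧ w = (3 * u + K.shift j - K.shift i, 4)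

/-- The dimensions of the chips. -/
def IsChip (w : ℤ × ℤ) : Prop :=
  ∃ i j, K.V i j ∧ w = (2 * u + K.shift j - K.shift i, if K.xbit i then 3 else 2)

variable {K}

theorem IsBrick.bounds {w : ℤ × ℤ} (h : K.IsBrick w) :
    3 * u - e ≤ w.1 ∧ w.1 ≤ 3 * u + e ∧ w.2 = 4 := by
  obtain ⟨i, j, -, rfl⟩ := h
  have := K.shift_nonneg i; have := K.shift_nonneg j
  have := K.shift_le i; have := K.shift_le j
  refine ⟨?_, ?_, rfl⟩ <;> simp only <;> omega

theorem IsChip.bounds {w : ℤ × ℤ} (h : K.IsChip w) :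
    2 * u - e ≤ w.1 ∧ w.1 ≤ 2 * u + e ∧ (w.2 = 2 ∨ w.2 = 3) := by
  obtain ⟨i, j, -, rfl⟩ := h
  have := K.shift_nonneg i; have := K.shift_nonneg j
  have := K.shift_le i; have := K.shift_le j
  refine ⟨?_, ?_, ?_⟩ <;> simp only
  · omega
  · omega
  · split_ifs <;> simp

theorem shift_injective : Function.Injective K.shift := fun i j h => by
  have := K.sum_eq (show K.shift i + K.shift i + K.shift i = K.shift j + K.shift j + K.shift j by
    omega)
  have h' : i ∈ ({j, j, j} : Multiset I) := this ▸ (by simp)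
  simpa using h'

/-- The symbols on a brick and a chip that together fill a gap are determined. -/
theorem decode {i j k l i' j' : I} (h : K.H i j) (h' : K.V k l) (hx : K.xbit i' ≠ K.xbit j')
    (hk : K.xbit k = K.xbit j')
    (hs : K.shift j' - K.shift i' = K.shift j - K.shift i + (K.shift l - K.shift k)) :
    i = i' ∧ k = j ∧ l = j' := by
  -- The differences are rearranged into sums of three so that the multisets of symbols agree; the
  -- type bits then decide which symbol is matched with which.
  have key := K.sum_eq (show K.shift i' + K.shift j + K.shift l =
    K.shift j' + K.shift i + K.shift k by omega)
  have h₁ := K.V_bits h'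
  have e₁ : i' = i := by
    have : i' ∈ ({j', i, k} : Multiset I) := key ▸ (by simp)
    simp only [Multiset.insert_eq_cons, Multiset.mem_cons, Multiset.mem_singleton] at this
    rcases this with rfl | rfl | rfl
    · exact absurd rfl hx
    · rfl
    · exact absurd hk hx
  subst e₁
  have e₂ : k = j := by
    have : k ∈ ({i', j, l} : Multiset I) := key ▸ (by simp)
    simp only [Multiset.insert_eq_cons, Multiset.mem_cons, Multiset.mem_singleton] at this
    rcases this with rfl | rfl | rfl
    · exact absurd hk hx
    · rfl
    · exact absurd rfl h₁.2
  subst e₂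
  exact ⟨rfl, rfl, K.shift_injective (by omega)⟩

end BrickCode

/-! ### Rigidity of tilings of a brickwork by bricks and chips -/

variable {u e : ℤ} {I : Type} {K : BrickCode u e I} {σ₀ σ : ℤ → ℤ → I} {S : Finset Cell}
  {Q : Set (Cell × ℤ × ℤ)}

/-- `Q` is a set of boxes with the dimensions of bricks and chips that tile the brickwork of the
cells in `S` for the field of symbols `σ₀`. -/
structure BoxTiling (K : BrickCode u e I) (σ₀ : ℤ → ℤ → I) (S : Finset Cell)
    (Q : Set (Cell × ℤ × ℤ)) : Prop where
  typed : ∀ a b, K.TypedAt σ₀ a b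
  mem : ∀ r ∈ Q, ∀ z ∈ boxCells r, holder u (K.shifts σ₀) z ∈ S
  cover : ∀ z, holder u (K.shifts σ₀) z ∈ S → ∃ r ∈ Q, z ∈ boxCells r
  unique : ∀ r ∈ Q, ∀ r' ∈ Q, ∀ z ∈ boxCells r, z ∈ boxCells r' → r = r'
  kind : ∀ r ∈ Q, K.IsBrick r.2 ∨ K.IsChip r.2

/-- The brick and the chip of a cell belong to the tiling, and the symbols on them are as
desired. -/
structure Settled (K : BrickCode u e I) (σ₀ : ℤ → ℤ → I) (S : Finset Cell)
    (Q : Set (Cell × ℤ × ℤ)) (σ : ℤ → ℤ → I) (a b : ℤ) : Prop where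
  brick : brickBox u (K.shifts σ) (a, b) ∈ Q
  chip : chipBox u (K.shifts σ) (a, b) ∈ Q
  H : K.H (σ (a - 1) b) (σ a b)
  V : K.V (σ a b) (σ a (b - 1))
  typed : K.TypedAt σ a b
  right : (a + 1, b) ∉ S → σ a b = σ₀ a b
  left : (a - 1, b + 1) ∉ S → σ (a - 1) b = σ₀ (a - 1) b

/-- The field `σ` reads off its symbols on `S` from the right ends of the bricks, and equals `σ₀`
elsewhere. -/
structure IsReading (K : BrickCode u e I) (σ₀ : ℤ → ℤ → I) (S : Finset Cell)
    (Q : Set (Cell × ℤ × ℤ)) (σ : ℤ → ℤ → I) : Prop where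
  off : ∀ a b, (a, b) ∉ S → σ a b = σ₀ a b
  read : ∀ a b, (a, b) ∈ S → ∀ r ∈ Q, ∀ i, r.1.2 = base a b → r.2.2 = 4 →
    r.1.1 + r.2.1 = u * (3 * a - 2 * b) + K.shift i → σ a b = i

theorem BoxTiling.bounds (hQ : BoxTiling K σ₀ S Q) {r : Cell × ℤ × ℤ} (hr : r ∈ Q) :
    3 * u - e ≤ r.2.1 ∧ r.2.1 ≤ 3 * u + e ∧ r.2.2 = 4 ∨
      2 * u - e ≤ r.2.1 ∧ r.2.1 ≤ 2 * u + e ∧ (r.2.2 = 2 ∨ r.2.2 = 3) :=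
  (hQ.kind r hr).imp BrickCode.IsBrick.bounds BrickCode.IsChip.bounds

theorem BrickCode.e_nonneg (K : BrickCode u e I) (i : I) : 0 ≤ e :=
  (K.shift_nonneg i).trans (K.shift_le i)

-- The reading is unambiguous: two boxes of height `4` on the floor of the same place with right
-- ends near the nominal wall share the cell just left of that wall, hence coincide. The field is
-- thus fixed before the induction starts.
open Classical in
theorem BoxTiling.exists_isReading (hQ : BoxTiling K σ₀ S Q) : ∃ σ, IsReading K σ₀ S Q σ := by
  let P : ℤ → ℤ → I → Prop := fun a b i => ∃ r ∈ Q, r.1.2 = base a b ∧ r.2.2 = 4 ∧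
    r.1.1 + r.2.1 = u * (3 * a - 2 * b) + K.shift i
  refine ⟨fun a b => if h : (a, b) ∈ S ∧ ∃ i, P a b i then h.2.choose else σ₀ a b,
    fun a b h => dif_neg fun h' => h h'.1, fun a b h r hr i h₁ h₂ h₃ => ?_⟩
  have h' : (a, b) ∈ S ∧ ∃ i, P a b i := ⟨h, i, r, hr, h₁, h₂, h₃⟩
  rw [dif_pos h']
  obtain ⟨r', hr', k₁, k₂, k₃⟩ := h'.2.choose_spec
  have he := K.e_nonneg i
  have hu := K.lt
  have i₁ := K.shift_nonneg i
  have i₂ := K.shift_le i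
  have i₃ := K.shift_nonneg h'.2.choose
  have i₄ := K.shift_le h'.2.choose
  have b₁ := hQ.bounds hr
  have b₂ := hQ.bounds hr'
  have := hQ.unique r hr r' hr' (u * (3 * a - 2 * b) - 1, base a b)
    (mem_boxCells.2 (by simp only; omega)) (mem_boxCells.2 (by simp only; omega))
  subst this
  exact K.shift_injective (by omega)

section Agree

variable (hσ : IsReading K σ₀ S Q σ)
include hσ

theorem IsReading.agree_left {a b : ℤ} (h : (a - 1, b) ∈ S → Settled K σ₀ S Q σ (a - 1) b)
    (hab : (a, b) ∉ S) : σ (a - 1) b = σ₀ (a - 1) b := by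
  by_cases h' : (a - 1, b) ∈ S
  · exact (h h').right (by simpa using hab)
  · exact hσ.off _ _ h'

/-- The wall of `(a, b - 1)` bounds the chip of `(a, b)` on the right. It is pinned by the place `(a
+ 1, b - 1)`, whose brick stands across this chip, or, if that place is outside, by `(a, b - 1)`
itself. -/
theorem IsReading.agree_down {a b : ℤ} (h : (a, b - 1) ∈ S → Settled K σ₀ S Q σ a (b - 1))
    (h' : (a + 1, b - 1) ∈ S → Settled K σ₀ S Q σ (a + 1) (b - 1)) (hab : (a, b) ∉ S) :
    σ a (b - 1) = σ₀ a (b - 1) := by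
  by_cases k : (a, b - 1) ∈ S
  · by_cases k' : (a + 1, b - 1) ∈ S
    · simpa using (h' k').left (by simpa using hab)
    · exact (h k).right k'
  · exact hσ.off _ _ k

end Agree

namespace BoxTiling

variable (hQ : BoxTiling K σ₀ S Q)
include hQ

/-- A box cannot stand in a gap that is too narrow. -/
theorem no_narrow {x y l R : ℤ} (hx : l ≤ x ∧ x < R) (hlR : R ≤ l + e)
    (hin : holder u (K.shifts σ₀) (x, y) ∈ S)
    (hl : ∀ r ∈ Q, (x, y) ∈ boxCells r → (l - 1, y) ∉ boxCells r)
    (hR : ∀ r ∈ Q, (x, y) ∈ boxCells r → (R, y) ∉ boxCells r) : False := by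
  obtain ⟨r, hr, hz⟩ := hQ.cover _ hin
  have h₁ := hl r hr hz
  have h₂ := hR r hr hz
  have h₃ := hQ.bounds hr
  have h₄ := K.lt
  have h₅ := K.e_nonneg (σ₀ 0 0)
  rw [mem_boxCells] at hz h₁ h₂
  simp only at hz h₁ h₂
  omega

omit hQ in
/-- The segment from `l` to `R` at height `y` is the free floor of a pit: each box that meets it
ends at its right end and does not reach below it. -/
def Pit (K : BrickCode u e I) (σ₀ : ℤ → ℤ → I) (S : Finset Cell) (Q : Set (Cell × ℤ × ℤ))
    (y l R : ℤ) : Prop :=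
  (∀ r ∈ Q, (l, y) ∈ boxCells r → (l - 1, y) ∉ boxCells r) ∧
    ∀ x, l ≤ x → x < R → holder u (K.shifts σ₀) (x, y) ∈ S ∧
      ∀ r ∈ Q, (x, y) ∈ boxCells r → (x, y - 1) ∉ boxCells r ∧ (R, y) ∉ boxCells r

/-- The box over the left end can extend neither to the left, nor below the floor, nor past `R`.
What it leaves free is again a pit, with the box as its left wall. -/
theorem pit_first {y l R : ℤ} (hp : Pit K σ₀ S Q y l R) (hlR : l < R) :
    ∃ r ∈ Q, r.1.1 = l ∧ r.1.2 = y ∧ l + r.2.1 ≤ R ∧ Pit K σ₀ S Q y (l + r.2.1) R := by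
  obtain ⟨hin, h⟩ := hp.2 l le_rfl hlR
  obtain ⟨r, hr, hz⟩ := hQ.cover _ hin
  have h₁ := hp.1 r hr hz
  obtain ⟨h₂, h₃⟩ := h r hr hz
  have hb := hQ.bounds hr
  have hu := K.lt
  have he := K.e_nonneg (σ₀ 0 0)
  rw [mem_boxCells] at hz h₁ h₂ h₃
  simp only at hz h₁ h₂ h₃
  refine ⟨r, hr, by omega, by omega, by omega, fun r' hr' k₁ k₂ => ?_,
    fun x hx hx' => hp.2 x (by omega) hx'⟩
  have := hQ.unique r hr r' hr' _ (mem_boxCells.2 (by simp only; omega)) k₂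
  subst this
  rw [mem_boxCells] at k₁
  simp only at k₁
  omega

theorem pit_narrow {y l R : ℤ} (hp : Pit K σ₀ S Q y l R) (hlR : l < R) : 2 * u - e ≤ R - l := by
  obtain ⟨r, hr, h₁, h₂, h₃, -⟩ := hQ.pit_first hp hlR
  have hb := hQ.bounds hr
  have hu := K.lt
  have he := K.e_nonneg (σ₀ 0 0)
  omega

/-- A pit of the width of a chip is filled by a chip. -/
theorem pit_chip {y l R : ℤ} (hp : Pit K σ₀ S Q y l R) (h : 2 * u - 4 * e ≤ R - l)
    (h' : R - l ≤ 2 * u + 4 * e) :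
    ∃ r ∈ Q, r.1.1 = l ∧ r.1.2 = y ∧ l + r.2.1 = R ∧ K.IsChip r.2 := by
  have hu := K.lt
  have he := K.e_nonneg (σ₀ 0 0)
  obtain ⟨r, hr, h₁, h₂, h₃, hp'⟩ := hQ.pit_first hp (by omega)
  -- A remainder would be at most `5 * e` wide, too narrow for any box as `10 * e < u`.
  have hn : ¬ l + r.2.1 < R := fun hlt => by
    have := hQ.pit_narrow hp' hlt
    have := hQ.bounds hr
    omega
  refine ⟨r, hr, h₁, h₂, by omega, (hQ.kind r hr).resolve_left fun k => ?_⟩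
  have := k.bounds
  omega

/-- A pit of the width of a brick is filled by a brick. -/
theorem pit_brick {y l R : ℤ} (hp : Pit K σ₀ S Q y l R) (h : 3 * u - 4 * e ≤ R - l)
    (h' : R - l ≤ 3 * u + 4 * e) :
    ∃ r ∈ Q, r.1.1 = l ∧ r.1.2 = y ∧ l + r.2.1 = R ∧ K.IsBrick r.2 := by
  have hu := K.lt
  have he := K.e_nonneg (σ₀ 0 0)
  obtain ⟨r, hr, h₁, h₂, h₃, hp'⟩ := hQ.pit_first hp (by omega)
  have hn : ¬ l + r.2.1 < R := fun hlt => by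
    have := hQ.pit_narrow hp' hlt
    have := hQ.bounds hr
    omega
  refine ⟨r, hr, h₁, h₂, by omega, (hQ.kind r hr).resolve_right fun k => ?_⟩
  have := k.bounds
  omega

end BoxTiling

/-- The order in which the cells are settled: row by row, from left to right. -/
def Before (q p : Cell) : Prop := q.2 < p.2 ∨ q.2 = p.2 ∧ q.1 < p.1

namespace BoxTiling

variable {u e : ℤ} {I : Type} {K : BrickCode u e I} {σ₀ σ : ℤ → ℤ → I} {S : Finset Cell}
  {Q : Set (Cell × ℤ × ℤ)}

section Step

variable (hQ : BoxTiling K σ₀ S Q) (hσ : IsReading K σ₀ S Q σ) {a b : ℤ}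
  (hset : ∀ a' b', (a', b') ∈ S → Before (a', b') (a, b) → Settled K σ₀ S Q σ a' b')
include hQ hσ hset

/-- A box that meets the brick or chip of a settled cell is that brick or chip. -/
theorem holder_eq_of_before {r : Cell × ℤ × ℤ} (hr : r ∈ Q) {z z' : Cell} (hz : z ∈ boxCells r)
    (hz' : z' ∈ boxCells r) (h : Before (holder u (K.shifts σ) z) (a, b)) :
    holder u (K.shifts σ) z' = holder u (K.shifts σ) z := by
  have hd := K.smallShift σ
  generalize hq : holder u (K.shifts σ) z = q at h ⊢
  obtain ⟨a', b'⟩ := q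
  have hq' := hd.holder_eq_iff.1 hq
  by_cases hS : (a', b') ∈ S
  · have hs := hset a' b' hS h
    rw [hd.holder_eq_iff]
    rcases hq' with k | k
    · obtain rfl := hQ.unique r hr _ hs.brick z hz (mem_brickBox.2 k)
      exact Or.inl (mem_brickBox.1 hz')
    · obtain rfl := hQ.unique r hr _ hs.chip z hz (mem_chipBox.2 k)
      exact Or.inr (mem_chipBox.1 hz')
  -- For a place outside `S` the three walls of `σ` are those of `σ₀`; the point would lie outside
  -- the brickwork although a box covers it.
  · exfalso
    have e₀ := hσ.off _ _ hS
    have e₁ := hσ.agree_left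
      (fun h' => hset _ _ h' (by unfold Before at h ⊢; simp only at h ⊢; omega)) hS
    have e₂ := hσ.agree_down
      (fun h' => hset _ _ h' (by unfold Before at h ⊢; simp only at h ⊢; omega))
      (fun h' => hset _ _ h' (by unfold Before at h ⊢; simp only at h ⊢; omega)) hS
    have : holder u (K.shifts σ₀) z = (a', b') := by
      rw [(K.smallShift σ₀).holder_eq_iff]
      simpa only [InBrick, InChip, wall, BrickCode.shifts, e₀, e₁, e₂] using hq'
    exact hS (this ▸ hQ.mem r hr z hz)

theorem notMem_of_before {r : Cell × ℤ × ℤ} (hr : r ∈ Q) {z z' p q : Cell} (hz : z ∈ boxCells r)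
    (hp : holder u (K.shifts σ) z = p) (hq : holder u (K.shifts σ) z' = q)
    (h : ¬ Before p (a, b)) (h' : Before q (a, b)) : z' ∉ boxCells r := fun hz' => by
  have := hQ.holder_eq_of_before hσ hset hr hz' hz (by rwa [hq])
  rw [hp, hq] at this
  exact h (this ▸ h')

omit hQ in
/-- The points above the bricks and chips of the cells before `(a', b)`, between the walls, belong
to the brickwork. -/
theorem _root_.Tileability.IsReading.holder_mem {a' x y : ℤ} (hS : (a', b) ∈ S) (hy : base a' b ≤ y)
    (hy' : y < base (a' + 1) b) (hx : wall u (K.shifts σ₀) (a' - 1) b ≤ x)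
    (hx' : x < wall u (K.shifts σ) a' (b - 1)) : holder u (K.shifts σ₀) (x, y) ∈ S := by
  have hd := K.smallShift σ₀
  have hb := base_succ a' b
  by_cases h₁ : x < wall u (K.shifts σ₀) a' b
  · rw [hd.holder_of_brick ⟨hx, h₁, hy, by omega⟩]; exact hS
  by_cases h₂ : x < wall u (K.shifts σ₀) a' (b - 1)
  · rw [hd.holder_of_chip ⟨by omega, h₂, hy, hy'⟩]; exact hS
  have h₃ := hd.wall_bounds a' (b - 1)
  have h₄ := (K.smallShift σ).wall_bounds a' (b - 1)
  have h₅ := hd.wall_bounds (a' + 1) (b - 1)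
  have hu := K.lt
  have he := hd.e_nonneg
  rw [hd.holder_of_brick (a := a' + 1) (b := b - 1) ⟨by rw [add_sub_cancel_right]; omega,
    by linarith, by rw [base_pred_right]; omega, by rw [base_pred_right]; omega⟩]
  by_contra hn
  have := hσ.agree_left (a := a' + 1) (b := b - 1) (fun h' => hset _ _ h' (by
    unfold Before; simp only; omega)) hn
  rw [add_sub_cancel_right] at this
  refine h₂ ?_
  simpa only [wall, BrickCode.shifts, this] using hx'

-- Between the two positions of the left wall, the point belongs to the brick of `(a' - 1, b)` for
-- `σ₀`. If that place is outside `S`, then `σ` and `σ₀` agree there and the two positions coincide.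
omit hQ in
theorem _root_.Tileability.IsReading.holder_mem_floor {a' x : ℤ} (hS : (a', b) ∈ S)
    (hx : wall u (K.shifts σ) (a' - 1) b ≤ x) (hx' : x < wall u (K.shifts σ) a' (b - 1)) :
    holder u (K.shifts σ₀) (x, base a' b) ∈ S := by
  have hd := K.smallShift σ₀
  have hb := base_succ a' b
  have hb' := base_succ (a' - 1) b
  rw [sub_add_cancel] at hb'
  by_cases h : wall u (K.shifts σ₀) (a' - 1) b ≤ x
  · exact hσ.holder_mem hset hS le_rfl (by omega) h hx'
  have h₁ := hd.wall_bounds (a' - 1) b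
  have h₂ := (K.smallShift σ).wall_bounds (a' - 1) b
  have h₃ := hd.wall_bounds (a' - 1 - 1) b
  have hu := K.lt
  have he := hd.e_nonneg
  rw [hd.holder_of_brick (a := a' - 1) (b := b) ⟨by linarith, by omega, by omega, by omega⟩]
  by_contra hn
  refine h ?_
  simpa only [wall, BrickCode.shifts, hσ.off _ _ hn] using hx

/-- If a box crosses the level of the floor of a cell at the right end, then so does one for the
next cell. -/
theorem cross_succ {a' : ℤ} (ha : a < a') (hS : (a', b) ∈ S) {r : Cell × ℤ × ℤ} (hr : r ∈ Q)
    (hz : (wall u (K.shifts σ) (a' - 1) (b - 1) - 1, base a' b) ∈ boxCells r)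
    (hlow : r.1.2 < base a' b) :
    ∃ r ∈ Q, (wall u (K.shifts σ) a' (b - 1) - 1, base (a' + 1) b) ∈ boxCells r ∧
      r.1.2 < base (a' + 1) b := by
  have hd := K.smallShift σ
  have hu := K.lt
  have he := hd.e_nonneg
  have hb := base_succ a' b
  have hb' := base_pred_right a' b
  have hb'' := base_pred_right (a' + 1) b
  have w₁ := hd.wall_left a' (b - 1)
  have w₂ := hd.wall_down (a' - 1) b
  have w₃ := hd.wall_down a' b
  have w₄ := hd.wall_left (a' + 1) (b - 1)
  rw [add_sub_cancel_right] at w₄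
  have floor : ∀ x, wall u (K.shifts σ) (a' - 1) b ≤ x → x < wall u (K.shifts σ) a' (b - 1) →
      holder u (K.shifts σ) (x, base a' b) = (a', b) := by
    intro x h₁ h₂
    rw [hd.holder_eq_iff]
    unfold InBrick InChip
    simp only
    omega
  have under : ∀ x, wall u (K.shifts σ) (a' - 1) (b - 1) ≤ x →
      x < wall u (K.shifts σ) a' (b - 1) →
      holder u (K.shifts σ) (x, base a' b - 1) = (a', b - 1) := fun x h₁ h₂ =>
    hd.holder_of_brick ⟨h₁, h₂, by omega, by omega⟩
  have beside : holder u (K.shifts σ) (wall u (K.shifts σ) a' (b - 1), base a' b) =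
      (a' + 1, b - 1) :=
    hd.holder_of_brick ⟨by simp, by omega, by omega, by omega⟩
  have hn : ¬ Before (a', b) (a, b) := by unfold Before; simp only; omega
  -- The crossing box narrows the floor of the next place from about `5 * u` to about `3 * u`. Only
  -- a brick fits, and its height `4` exceeds the rise to the following floor, at most `3`.
  have hp : Pit K σ₀ S Q (base a' b) (wall u (K.shifts σ) (a' - 1) (b - 1))
      (wall u (K.shifts σ) a' (b - 1)) := by
    refine ⟨fun r' hr' k k' => ?_, fun x hx hx' => ⟨?_, fun r' hr' k => ⟨?_, ?_⟩⟩⟩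
    · obtain rfl := hQ.unique r hr r' hr' _ hz k'
      refine hQ.notMem_of_before hσ hset hr hz (floor _ (by omega) (by omega))
        (under _ le_rfl (by omega)) hn (by unfold Before; simp only; omega) ?_
      rw [mem_boxCells] at k ⊢
      simp only at k ⊢
      omega
    · exact hσ.holder_mem_floor hset hS (by omega) hx'
    · exact hQ.notMem_of_before hσ hset hr' k (floor x (by omega) hx') (under x hx hx') hn
        (by unfold Before; simp only; omega)
    · exact hQ.notMem_of_before hσ hset hr' k (floor x (by omega) hx') beside hn
        (by unfold Before; simp only; omega)
  obtain ⟨r', hr', h₁, h₂, h₃, h₄⟩ := hQ.pit_brick hp (by omega) (by omega)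
  have := h₄.bounds
  refine ⟨r', hr', mem_boxCells.2 ?_, by omega⟩
  simp only
  omega

/-- No box crosses the level of the floor of the next cell at the right end. -/
theorem le_of_cross {r : Cell × ℤ × ℤ} (hr : r ∈ Q)
    (hz : (wall u (K.shifts σ) a (b - 1) - 1, base (a + 1) b) ∈ boxCells r) :
    base (a + 1) b ≤ r.1.2 := by
  by_contra! hlow
  -- A crossing would reproduce itself in every place further to the right, although `S` is finite.
  have chain : ∀ n : ℕ, (a + n + 1, b) ∈ S ∧ ∃ r ∈ Q,
      (wall u (K.shifts σ) (a + n) (b - 1) - 1, base (a + n + 1) b) ∈ boxCells r ∧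
        r.1.2 < base (a + n + 1) b := by
    have key : ∀ a' : ℤ, (∃ r ∈ Q,
        (wall u (K.shifts σ) a' (b - 1) - 1, base (a' + 1) b) ∈ boxCells r) → (a' + 1, b) ∈ S := by
      rintro a' ⟨r, hr, hz⟩
      have hd := K.smallShift σ₀
      have w₁ := (K.smallShift σ).wall_bounds a' (b - 1)
      have w₂ := hd.wall_bounds a' b
      have w₃ := hd.wall_bounds (a' + 1) b
      have hu := K.lt
      have he := hd.e_nonneg
      rw [← hd.holder_of_brick (a := a' + 1) (b := b)
        (x := wall u (K.shifts σ) a' (b - 1) - 1) (y := base (a' + 1) b)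
        ⟨by rw [add_sub_cancel_right]; linarith, by linarith, le_rfl, by omega⟩]
      exact hQ.mem r hr _ hz
    intro n
    induction n with
    | zero =>
      exact ⟨by simpa using key a ⟨r, hr, hz⟩, r, hr, by simpa using hz, by simpa using hlow⟩
    | succ n ih =>
      obtain ⟨hS, r, hr, hz, hlow⟩ := ih
      have := hQ.cross_succ hσ hset (a' := a + n + 1) (by omega) hS hr
        (by rwa [add_sub_cancel_right]) hlow
      push_cast
      rw [← add_assoc]
      obtain ⟨r, hr, hz, hlow⟩ := this
      exact ⟨key _ ⟨r, hr, hz⟩, r, hr, hz, hlow⟩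
  refine Set.infinite_of_injective_forall_mem (s := (S : Set Cell))
    (f := fun n : ℕ => ((a + n + 1, b) : Cell)) (fun m n h => ?_) (fun n => (chain n).1)
    S.finite_toSet
  simp only [Prod.mk.injEq] at h
  omega

end Step

end BoxTiling

theorem decide_odd_sub_one (a : ℤ) : decide ((a - 1) % 2 = 1) = !decide (a % 2 = 1) := by
  rw [← decide_not]
  exact decide_eq_decide.2 (by omega)

theorem chip_height (a b : ℤ) :
    base (a + 1) b - base a b = if decide (a % 2 = 1) then 3 else 2 := by
  rcases base_succ a b with ⟨h, h'⟩ | ⟨h, h'⟩ <;> simp [h, h']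

namespace BoxTiling

variable {u e : ℤ} {I : Type} {K : BrickCode u e I} {σ₀ σ : ℤ → ℤ → I} {S : Finset Cell}
  {Q : Set (Cell × ℤ × ℤ)} (hQ : BoxTiling K σ₀ S Q) (hσ : IsReading K σ₀ S Q σ)
include hQ hσ

section Step

variable {a b : ℤ}
  (hset : ∀ a' b', (a', b') ∈ S → Before (a', b') (a, b) → Settled K σ₀ S Q σ a' b')
include hset

theorem typedAt_of_before {a' b' : ℤ} (h : Before (a', b') (a, b)) : K.TypedAt σ a' b' := by
  by_cases hS : (a', b') ∈ S
  · exact (hset _ _ hS h).typed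
  · have := hQ.typed a' b'
    unfold BrickCode.TypedAt at this ⊢
    rwa [hσ.off _ _ hS]

/-- The floor of the first cell that is not settled is filled by a brick and a chip. -/
theorem exists_brick_chip (hS : (a, b) ∈ S) :
    ∃ r ∈ Q, ∃ r' ∈ Q, r.1 = (wall u (K.shifts σ) (a - 1) b, base a b) ∧ K.IsBrick r.2 ∧
      r'.1 = (wall u (K.shifts σ) (a - 1) b + r.2.1, base a b) ∧ K.IsChip r'.2 ∧
      wall u (K.shifts σ) (a - 1) b + r.2.1 + r'.2.1 = wall u (K.shifts σ) a (b - 1) ∧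
      r'.2.2 = base (a + 1) b - base a b := by
  have hd := K.smallShift σ
  have hu := K.lt
  have he := hd.e_nonneg
  have hb := base_succ a b
  have hb₁ := base_succ (a - 1) b
  rw [sub_add_cancel] at hb₁
  have hb₂ := base_pred_right a b
  have hb₃ := base_pred_right (a + 1) b
  have w₁ := hd.wall_left a b
  have w₂ := hd.wall_down a b
  have w₃ := hd.wall_left (a - 1) b
  have w₄ := hd.wall_left (a + 1) (b - 1)
  rw [add_sub_cancel_right] at w₄
  have inside : ∀ x y, wall u (K.shifts σ) (a - 1) b ≤ x → x < wall u (K.shifts σ) a (b - 1) →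
      base a b ≤ y → y < base (a + 1) b → holder u (K.shifts σ) (x, y) = (a, b) := by
    intro x y h₁ h₂ h₃ h₄
    rw [hd.holder_eq_iff]
    unfold InBrick InChip
    simp only
    omega
  have beside : ∀ y, base a b ≤ y → y < base (a + 1) b →
      holder u (K.shifts σ) (wall u (K.shifts σ) a (b - 1), y) = (a + 1, b - 1) := fun y h₁ h₂ =>
    hd.holder_of_brick ⟨by simp, by omega, by omega, by omega⟩
  have hn : ¬ Before (a, b) (a, b) := by unfold Before; simp only; omega
  have beside' : ∀ r ∈ Q, ∀ x y, wall u (K.shifts σ) (a - 1) b ≤ x →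
      x < wall u (K.shifts σ) a (b - 1) → base a b ≤ y → y < base (a + 1) b →
      (x, y) ∈ boxCells r → (wall u (K.shifts σ) a (b - 1), y) ∉ boxCells r :=
    fun r hr x y h₁ h₂ h₃ h₄ k => hQ.notMem_of_before hσ hset hr k (inside x y h₁ h₂ h₃ h₄)
      (beside y h₃ h₄) hn (by unfold Before; simp only; omega)
  have hp : Pit K σ₀ S Q (base a b) (wall u (K.shifts σ) (a - 1) b)
      (wall u (K.shifts σ) a (b - 1)) := by
    refine ⟨fun r hr k => ?_, fun x hx hx' => ⟨hσ.holder_mem_floor hset hS hx hx',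
      fun r hr k => ⟨?_, beside' r hr x _ hx hx' le_rfl (by omega) k⟩⟩⟩
    · exact hQ.notMem_of_before hσ hset hr k (inside _ _ le_rfl (by omega) le_rfl (by omega))
        (hd.holder_of_brick (a := a - 1) (b := b) ⟨by omega, by omega, by omega, by omega⟩) hn
        (Or.inr ⟨rfl, sub_one_lt a⟩)
    · by_cases h : x < wall u (K.shifts σ) (a - 1) (b - 1)
      · exact hQ.notMem_of_before hσ hset hr k (inside _ _ hx hx' le_rfl (by omega))
          (hd.holder_of_chip (a := a - 1) (b := b)
            ⟨by omega, by omega, by omega, by rw [sub_add_cancel]; omega⟩) hn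
          (Or.inr ⟨rfl, sub_one_lt a⟩)
      · exact hQ.notMem_of_before hσ hset hr k (inside _ _ hx hx' le_rfl (by omega))
          (hd.holder_of_brick (a := a) (b := b - 1) ⟨by omega, by omega, by omega, by omega⟩) hn
          (by unfold Before; simp only; omega)
  have cross : ∀ r ∈ Q, r.1.1 < wall u (K.shifts σ) a (b - 1) →
      r.1.1 + r.2.1 = wall u (K.shifts σ) a (b - 1) → r.1.2 < base (a + 1) b →
      r.1.2 + r.2.2 ≤ base (a + 1) b := by
    intro r hr h₁ h₂ h₃
    by_contra h₄
    have := hQ.le_of_cross hσ hset hr (mem_boxCells.2 (by simp only; omega))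
    omega
  -- The floor is about `5 * u` wide, so its boxes are a brick and a chip in one order or the other.
  obtain ⟨r, hr, h₁, h₂, h₃, hp'⟩ := hQ.pit_first hp (by omega)
  rcases hQ.kind r hr with k | k
  · have kb := k.bounds
    obtain ⟨r', hr', l₁, l₂, l₃, k'⟩ := hQ.pit_chip hp' (by omega) (by omega)
    have kb' := k'.bounds
    refine ⟨r, hr, r', hr', Prod.ext h₁ h₂, k, Prod.ext l₁ l₂, k', l₃, ?_⟩
    have c₁ := cross r' hr' (by omega) (by omega) (by omega)
    -- By `c₁` the chip is not too high. If it were too low, its top would be a pit one unit deep,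
    -- and the chip filling that pit would rise above the next floor.
    by_contra hne
    have hp'' : Pit K σ₀ S Q (base a b + 2) (wall u (K.shifts σ) (a - 1) b + r.2.1)
        (wall u (K.shifts σ) a (b - 1)) := by
      refine ⟨fun r'' hr'' m m' => ?_, fun x hx hx' => ⟨?_, fun r'' hr'' m => ⟨fun m' => ?_, ?_⟩⟩⟩
      · obtain rfl := hQ.unique r hr r'' hr'' _ (mem_boxCells.2 (by simp only; omega)) m'
        rw [mem_boxCells] at m
        simp only at m
        omega
      · have w₅ := (K.smallShift σ₀).wall_bounds (a - 1) b
        have w₆ := hd.wall_bounds (a - 1) b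
        exact hσ.holder_mem hset hS (by omega) (by omega) (by omega) hx'
      · obtain rfl := hQ.unique r' hr' r'' hr'' _ (mem_boxCells.2 (by simp only; omega)) m'
        rw [mem_boxCells] at m
        simp only at m
        omega
      · exact beside' r'' hr'' x _ (by omega) hx' (by omega) (by omega) m
    obtain ⟨r'', hr'', m₁, m₂, m₃, k''⟩ := hQ.pit_chip hp'' (by omega) (by omega)
    have kb'' := k''.bounds
    have := cross r'' hr'' (by omega) (by omega) (by omega)
    omega
  -- A chip on the left would leave a brick on the right, which crosses the next floor.
  · exfalso
    have kb := k.bounds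
    obtain ⟨r', hr', l₁, l₂, l₃, k'⟩ := hQ.pit_brick hp' (by omega) (by omega)
    have kb' := k'.bounds
    have := cross r' hr' (by omega) (by omega) (by omega)
    omega

/-- If all cells before a cell are settled, then so is the cell. -/
theorem settled_of_before (hS : (a, b) ∈ S) : Settled K σ₀ S Q σ a b := by
  obtain ⟨r, hr, r', hr', h₁, ⟨i, j, hH, hw⟩, h₂, ⟨k, l, hV, hw'⟩, h₃, h₄⟩ :=
    hQ.exists_brick_chip hσ hset hS
  have t₁ := hQ.typedAt_of_before hσ hset (a' := a - 1) (b' := b)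
    (Or.inr ⟨rfl, sub_one_lt a⟩)
  have t₂ := hQ.typedAt_of_before hσ hset (a' := a) (b' := b - 1)
    (by unfold Before; simp only; omega)
  -- The height of the chip must be the rise between the floors, which gives away the parity of the
  -- column.
  have hk : K.xbit k = decide (a % 2 = 1) := by
    have := chip_height a b
    rw [← h₄, hw'] at this
    simp only at this
    cases hx : K.xbit k <;> cases hx' : decide (a % 2 = 1) <;> simp [hx, hx'] at this ⊢
  have hs : K.shift (σ a (b - 1)) - K.shift (σ (a - 1) b) =
      K.shift j - K.shift i + (K.shift l - K.shift k) := by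
    rw [hw, hw'] at h₃
    unfold wall BrickCode.shifts at h₃
    simp only at h₃
    linarith
  obtain ⟨rfl, rfl, rfl⟩ := K.decode hH hV
    (by rw [t₁.1, t₂.1, decide_odd_sub_one]; simp) (by rw [hk, t₂.1]) hs
  have hk' : σ a b = k := by
    refine hσ.read a b hS r hr k (by rw [h₁]) (by rw [hw]) ?_
    rw [h₁, hw]
    unfold wall BrickCode.shifts
    ring
  subst hk'
  have hw₁ : wall u (K.shifts σ) (a - 1) b + r.2.1 = wall u (K.shifts σ) a b := by
    rw [hw]
    unfold wall BrickCode.shifts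
    ring
  rw [hw₁] at h₂ h₃
  have hB : r = brickBox u (K.shifts σ) (a, b) :=
    Prod.ext h₁ (Prod.ext (by unfold brickBox; simp only; omega) (by rw [hw]; rfl))
  have hC : r' = chipBox u (K.shifts σ) (a, b) :=
    Prod.ext h₂ (Prod.ext (by unfold chipBox; simp only; omega) h₄)
  have d₀ := K.smallShift σ₀
  have d₁ := K.smallShift σ
  have hu := K.lt
  have he := d₀.e_nonneg
  have hb := base_succ a b
  have hb₁ := base_succ (a - 1) b
  rw [sub_add_cancel] at hb₁
  have rmem : ∀ x y, InBrick u (K.shifts σ) a b x y → (x, y) ∈ boxCells r := fun x y h => by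
    rw [hB]; exact mem_brickBox.2 h
  have runique : ∀ r'' ∈ Q, ∀ x y, InBrick u (K.shifts σ) a b x y → (x, y) ∈ boxCells r'' →
      ∀ x' y', (x', y') ∈ boxCells r'' → InBrick u (K.shifts σ) a b x' y' := by
    intro r'' hr'' x y h h' x' y' h''
    obtain rfl := hQ.unique r hr r'' hr'' _ (rmem x y h) h'
    rw [hB] at h''
    exact mem_brickBox.1 h''
  refine ⟨hB ▸ hr, hC ▸ hr', hH, hV, ?_, fun hn => ?_, fun hn => ?_⟩
  · have g₁ := K.H_bits hH
    rw [t₁.1, t₁.2, decide_odd_sub_one] at g₁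
    exact ⟨by
      have := g₁.1
      cases h : K.xbit (σ a b) <;> cases h' : decide (a % 2 = 1) <;> simp [h, h'] at this ⊢,
      g₁.2.symm⟩
  · refine K.shift_injective ?_
    have w₀ : wall u (K.shifts σ) a b - wall u (K.shifts σ₀) a b =
      K.shift (σ a b) - K.shift (σ₀ a b) := by unfold wall BrickCode.shifts; ring
    have w₁ := d₀.wall_left (a + 1) b
    have w₂ := d₀.wall_left a b
    have w₃ := d₁.wall_left a b
    have w₄ := d₀.wall_bounds a b
    have w₅ := d₁.wall_bounds a b
    rw [add_sub_cancel_right] at w₁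
    -- At the height of the bottom of the brick of `(a + 1, b)` the border of the region is the wall
    -- of `σ₀`. If the wall of `σ` is left of it, a gap of width at most `e` remains; if it is right
    -- of it, the brick sticks out.
    rcases lt_trichotomy (K.shift (σ a b)) (K.shift (σ₀ a b)) with h | h | h
    · exfalso
      refine hQ.no_narrow (x := wall u (K.shifts σ) a b) (y := base (a + 1) b)
        (l := wall u (K.shifts σ) a b) (R := wall u (K.shifts σ₀) a b) (by omega) (by omega) ?_
        (fun r'' hr'' k k' => ?_) (fun r'' hr'' k k' => ?_)
      · rwa [d₀.holder_of_brick (a := a) (b := b) ⟨by omega, by omega, by omega, by omega⟩]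
      · have := runique r'' hr'' _ _ ⟨by omega, by omega, by omega, by omega⟩ k' _ _ k
        exact absurd this.2.1 (lt_irrefl _)
      · have := hQ.mem r'' hr'' _ k'
        rw [d₀.holder_of_brick (a := a + 1) (b := b)
          ⟨by simp, by omega, by omega, by omega⟩] at this
        exact hn this
    · exact h
    · exfalso
      have := hQ.mem r hr _ (rmem (wall u (K.shifts σ) a b - 1) (base (a + 1) b)
        ⟨by omega, by omega, by omega, by omega⟩)
      rw [d₀.holder_of_brick (a := a + 1) (b := b)
          ⟨by rw [add_sub_cancel_right]; omega, by omega, by omega, by omega⟩] at this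
      exact hn this
  · refine K.shift_injective ?_
    have w₀ : wall u (K.shifts σ) (a - 1) b - wall u (K.shifts σ₀) (a - 1) b =
      K.shift (σ (a - 1) b) - K.shift (σ₀ (a - 1) b) := by unfold wall BrickCode.shifts; ring
    have w₂ := d₀.wall_left a b
    have w₃ := d₁.wall_left a b
    have w₄ := d₀.wall_bounds (a - 1) b
    have w₅ := d₁.wall_bounds (a - 1) b
    have w₆ := d₀.wall_down (a - 1) (b + 1)
    rw [add_sub_cancel_right] at w₆
    have hb₂ := base_pred_right (a - 1) (b + 1)
    have hb₃ := base_pred_right a (b + 1)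
    rw [add_sub_cancel_right] at hb₂ hb₃
    have chip₀ : ∀ x, wall u (K.shifts σ₀) (a - 1) (b + 1) ≤ x →
        x < wall u (K.shifts σ₀) (a - 1) b →
        holder u (K.shifts σ₀) (x, base a b + 3) = (a - 1, b + 1) := fun x h h' =>
      d₀.holder_of_chip ⟨h, by rw [add_sub_cancel_right]; exact h', by omega,
        by rw [sub_add_cancel]; omega⟩
    -- Now the border is on the left, against the chip of `(a - 1, b + 1)`, in the top row of the
    -- brick; the roles of the two cases are exchanged.
    rcases lt_trichotomy (K.shift (σ (a - 1) b)) (K.shift (σ₀ (a - 1) b)) with h | h | h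
    · exfalso
      have := hQ.mem r hr _ (rmem (wall u (K.shifts σ) (a - 1) b) (base a b + 3)
        ⟨by omega, by omega, by omega, by omega⟩)
      rw [chip₀ _ (by omega) (by omega)] at this
      exact hn this
    · exact h
    · exfalso
      refine hQ.no_narrow (x := wall u (K.shifts σ₀) (a - 1) b) (y := base a b + 3)
        (l := wall u (K.shifts σ₀) (a - 1) b) (R := wall u (K.shifts σ) (a - 1) b) (by omega)
        (by omega) ?_ (fun r'' hr'' k k' => ?_) (fun r'' hr'' k k' => ?_)
      · rwa [d₀.holder_of_brick (a := a) (b := b) ⟨by omega, by omega, by omega, by omega⟩]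
      · have := hQ.mem r'' hr'' _ k'
        rw [chip₀ _ (by omega) (by omega)] at this
        exact hn this
      · have := runique r'' hr'' _ _ ⟨by omega, by omega, by omega, by omega⟩ k' _ _ k
        have := this.1
        omega

end Step

theorem settled {a b : ℤ} (h : (a, b) ∈ S) : Settled K σ₀ S Q σ a b := by
  classical
  by_contra hn
  obtain ⟨p, hp, hmin⟩ := (S.filter fun p => ¬ Settled K σ₀ S Q σ p.1 p.2).exists_min_image
    (fun p => toLex (p.2, p.1)) ⟨(a, b), Finset.mem_filter.2 ⟨h, hn⟩⟩
  obtain ⟨hpS, hpn⟩ := Finset.mem_filter.1 hp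
  refine hpn (hQ.settled_of_before hσ (fun a' b' h' hb => ?_) hpS)
  by_contra hn'
  have := hmin (a', b') (Finset.mem_filter.2 ⟨h', hn'⟩)
  rw [Prod.Lex.toLex_le_toLex] at this
  unfold Before at hb
  simp only at this hb
  omega

end BoxTiling

/-- The fields that agree with `σ₀` outside of `S`, and on the borders of the bricks and chips
there, and whose neighbouring symbols on `S` are related. -/
structure IsField {u e : ℤ} {I : Type} (K : BrickCode u e I) (σ₀ : ℤ → ℤ → I) (S : Finset Cell)
    (σ : ℤ → ℤ → I) : Prop where
  typed : ∀ a b, K.TypedAt σ a b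
  off : ∀ a b, (a, b) ∉ S →
    σ a b = σ₀ a b ∧ σ (a - 1) b = σ₀ (a - 1) b ∧ σ a (b - 1) = σ₀ a (b - 1)
  H : ∀ a b, (a, b) ∈ S → K.H (σ (a - 1) b) (σ a b)
  V : ∀ a b, (a, b) ∈ S → K.V (σ a b) (σ a (b - 1))

theorem BoxTiling.exists_isField {u e : ℤ} {I : Type} {K : BrickCode u e I} {σ₀ : ℤ → ℤ → I}
    {S : Finset Cell} {Q : Set (Cell × ℤ × ℤ)} (hQ : BoxTiling K σ₀ S Q) :
    ∃ σ, IsField K σ₀ S σ := by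
  obtain ⟨σ, hσ⟩ := hQ.exists_isReading
  have hs : ∀ {a b}, (a, b) ∈ S → Settled K σ₀ S Q σ a b := hQ.settled hσ
  refine ⟨σ, fun a b => ?_, fun a b h => ⟨hσ.off a b h, hσ.agree_left hs h,
    hσ.agree_down hs hs h⟩, fun a b h => (hs h).H, fun a b h => (hs h).V⟩
  by_cases h : (a, b) ∈ S
  · exact (hs h).typed
  · have := hQ.typed a b
    unfold BrickCode.TypedAt at this ⊢
    rwa [hσ.off _ _ h]

/-! ### The rectangular tiles of a code -/

/-- The rectangular tile with the given width and height. -/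
noncomputable def boxTile (w : ℤ × ℤ) : Tile := rectTile (w.1 - 1).toNat (w.2 - 1).toNat

theorem boxTile_cells {w : ℤ × ℤ} (h₁ : 0 < w.1) (h₂ : 0 < w.2) :
    (boxTile w).cells = box 0 w.1 w.2 := by
  change box 0 _ _ = _
  congr 1 <;> omega

theorem mem_boxTile {r : Cell × ℤ × ℤ} (h₁ : 0 < r.2.1) (h₂ : 0 < r.2.2) {z : Cell} :
    z - r.1 ∈ (boxTile r.2).cells ↔ z ∈ boxCells r := by
  rw [boxTile_cells h₁ h₂, mem_boxCells, mem_box]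
  simp only [Prod.fst_zero, Prod.snd_zero, Prod.fst_sub, Prod.snd_sub]
  omega

theorem boxTile_inj {w w' : ℤ × ℤ} (h₁ : 0 < w.1) (h₂ : 0 < w.2) (h₁' : 0 < w'.1)
    (h₂' : 0 < w'.2) (h : boxTile w = boxTile w') : w = w' := by
  have key : box 0 w.1 w.2 = box 0 w'.1 w'.2 := by
    rw [← boxTile_cells h₁ h₂, ← boxTile_cells h₁' h₂', h]
  have k₁ : (w.1 - 1, w.2 - 1) ∈ box 0 w'.1 w'.2 := key ▸ mem_box.2 (by simp; omega)
  have k₂ : (w'.1 - 1, w'.2 - 1) ∈ box 0 w.1 w.2 := key ▸ mem_box.2 (by simp; omega)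
  rw [mem_box] at k₁ k₂
  simp only [Prod.fst_zero, Prod.snd_zero] at k₁ k₂
  exact Prod.ext (by omega) (by omega)

namespace BrickCode

variable {u e : ℤ} {I : Type} (K : BrickCode u e I)

theorem finite_dimensions [Finite I] : {w | K.IsBrick w ∨ K.IsChip w}.Finite := by
  refine Set.Finite.subset (((Set.finite_range fun q : I × I =>
    ((3 * u + K.shift q.2 - K.shift q.1, 4) : ℤ × ℤ))).union (Set.finite_range fun q : I × I =>
    ((2 * u + K.shift q.2 - K.shift q.1, if K.xbit q.1 then 3 else 2) : ℤ × ℤ))) ?_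
  rintro w (⟨i, j, -, rfl⟩ | ⟨i, j, -, rfl⟩)
  · exact Or.inl ⟨(i, j), rfl⟩
  · exact Or.inr ⟨(i, j), rfl⟩

open Classical in
/-- The rectangular tiles of a code: its bricks and chips. -/
noncomputable def tiles [Finite I] : Finset Tile := K.finite_dimensions.toFinset.image boxTile

theorem mem_tiles [Finite I] {t : Tile} :
    t ∈ K.tiles ↔ ∃ w, (K.IsBrick w ∨ K.IsChip w) ∧ t = boxTile w := by
  simp [tiles, eq_comm]

theorem isRectangle_of_mem_tiles [Finite I] {t : Tile} (h : t ∈ K.tiles) :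
    IsRectangle t.cells := by
  obtain ⟨w, -, rfl⟩ := K.mem_tiles.1 h
  exact isRectangle_rectTile _ _

variable {K}

theorem dimensions_pos {w : ℤ × ℤ} (h : K.IsBrick w ∨ K.IsChip w) : 0 < w.1 ∧ 0 < w.2 := by
  have hu := K.lt
  rcases h with h | h
  · obtain ⟨i, -⟩ := id h
    have := K.e_nonneg i
    have := h.bounds
    omega
  · obtain ⟨i, -⟩ := id h
    have := K.e_nonneg i
    have := h.bounds
    omega

end BrickCode

section Field

variable {u e : ℤ} {I : Type} {K : BrickCode u e I} {σ₀ σ : ℤ → ℤ → I}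

/-- The bricks and chips of places outside `S` are the same for both fields, so the complements of
the two brickworks coincide. -/
theorem IsField.holder_mem_iff {S : Finset Cell} (h : IsField K σ₀ S σ) (z : Cell) :
    holder u (K.shifts σ₀) z ∈ S ↔ holder u (K.shifts σ) z ∈ S := by
  have key : ∀ q ∉ S, holder u (K.shifts σ₀) z = q ↔ holder u (K.shifts σ) z = q := by
    intro q hq
    obtain ⟨e₁, e₂, e₃⟩ := h.off q.1 q.2 hq
    rw [(K.smallShift σ₀).holder_eq_iff, (K.smallShift σ).holder_eq_iff]
    simp only [InBrick, InChip, wall, BrickCode.shifts, e₁, e₂, e₃]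
  rw [← not_iff_not]
  constructor <;> intro hn
  · rwa [(key _ hn).1 rfl]
  · rwa [(key _ hn).2 rfl]

theorem IsField.isBrick {S : Finset Cell} (h : IsField K σ₀ S σ) {p : Cell} (hp : p ∈ S) :
    K.IsBrick (brickBox u (K.shifts σ) p).2 := by
  refine ⟨_, _, h.H p.1 p.2 hp, Prod.ext ?_ rfl⟩
  simp only [brickBox, wall, BrickCode.shifts]
  ring

theorem IsField.isChip {S : Finset Cell} (h : IsField K σ₀ S σ) {p : Cell} (hp : p ∈ S) :
    K.IsChip (chipBox u (K.shifts σ) p).2 := by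
  refine ⟨_, _, h.V p.1 p.2 hp, Prod.ext ?_ ?_⟩
  · simp only [chipBox, wall, BrickCode.shifts]
    ring
  · rw [(h.typed p.1 p.2).1]
    exact chip_height _ _

open Classical in
theorem IsField.tileable [Finite I] {G : Region} (h : IsField K σ₀ G.cells σ) :
    Tileable K.tiles (brickwork (K.smallShift σ₀) G) := by
  have hd := K.smallShift σ
  let A : Cell × ℤ × ℤ → Tile × Cell := fun r => (boxTile r.2, r.1)
  have mem : ∀ {r : Cell × ℤ × ℤ}, K.IsBrick r.2 ∨ K.IsChip r.2 → ∀ {z},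
      z - (A r).2 ∈ (A r).1.cells ↔ z ∈ boxCells r := fun hr z =>
    mem_boxTile (BrickCode.dimensions_pos hr).1 (BrickCode.dimensions_pos hr).2
  have hB : ∀ {p}, p ∈ G.cells → ∀ {z}, z - (A (brickBox u (K.shifts σ) p)).2 ∈
      (A (brickBox u (K.shifts σ) p)).1.cells ↔ InBrick u (K.shifts σ) p.1 p.2 z.1 z.2 :=
    fun {p} hp {z} => (mem (Or.inl (h.isBrick hp))).trans mem_brickBox
  have hC : ∀ {p}, p ∈ G.cells → ∀ {z}, z - (A (chipBox u (K.shifts σ) p)).2 ∈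
      (A (chipBox u (K.shifts σ) p)).1.cells ↔ InChip u (K.shifts σ) p.1 p.2 z.1 z.2 :=
    fun {p} hp {z} => (mem (Or.inr (h.isChip hp))).trans mem_chipBox
  refine ⟨G.cells.image (fun p => A (brickBox u (K.shifts σ) p)) ∪
    G.cells.image (fun p => A (chipBox u (K.shifts σ) p)), ?_, ?_, ?_⟩
  · intro a ha
    rw [K.mem_tiles]
    rcases Finset.mem_union.1 ha with ha | ha <;> obtain ⟨p, hp, rfl⟩ := Finset.mem_image.1 ha
    · exact ⟨_, Or.inl (h.isBrick hp), rfl⟩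
    · exact ⟨_, Or.inr (h.isChip hp), rfl⟩
  · intro a ha z hz
    rw [mem_brickwork, h.holder_mem_iff]
    rw [← add_sub_cancel_right z a.2] at hz
    rcases Finset.mem_union.1 ha with ha | ha <;> obtain ⟨p, hp, rfl⟩ := Finset.mem_image.1 ha
    · rw [hd.holder_eq_iff.2 (Or.inl ((hB hp).1 hz))]
      exact hp
    · rw [hd.holder_eq_iff.2 (Or.inr ((hC hp).1 hz))]
      exact hp
  · intro z hz
    rw [mem_brickwork, h.holder_mem_iff] at hz
    have key : ∀ a ∈ G.cells.image (fun p => A (brickBox u (K.shifts σ) p)) ∪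
        G.cells.image (fun p => A (chipBox u (K.shifts σ) p)), z - a.2 ∈ a.1.cells →
        InBrick u (K.shifts σ) (holder u (K.shifts σ) z).1 (holder u (K.shifts σ) z).2 z.1 z.2 ∧
          a = A (brickBox u (K.shifts σ) (holder u (K.shifts σ) z)) ∨
        InChip u (K.shifts σ) (holder u (K.shifts σ) z).1 (holder u (K.shifts σ) z).2 z.1 z.2 ∧
          a = A (chipBox u (K.shifts σ) (holder u (K.shifts σ) z)) := by
      intro a ha hza
      rcases Finset.mem_union.1 ha with ha | ha <;> obtain ⟨p, hp, rfl⟩ := Finset.mem_image.1 ha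
      · have := (hB hp).1 hza
        rw [hd.holder_eq_iff.2 (Or.inl this)]
        exact Or.inl ⟨this, rfl⟩
      · have := (hC hp).1 hza
        rw [hd.holder_eq_iff.2 (Or.inr this)]
        exact Or.inr ⟨this, rfl⟩
    rcases hd.holder_eq_iff.1 (rfl : holder u (K.shifts σ) z = _) with k | k
    · refine ⟨_, ⟨Finset.mem_union_left _ (Finset.mem_image_of_mem _ hz), (hB hz).2 k⟩, ?_⟩
      rintro a ⟨ha, hza⟩
      rcases key a ha hza with ⟨-, rfl⟩ | ⟨k', -⟩
      · rfl
      · exact absurd k.2.1 (not_lt.2 k'.1)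
    · refine ⟨_, ⟨Finset.mem_union_right _ (Finset.mem_image_of_mem _ hz), (hC hz).2 k⟩, ?_⟩
      rintro a ⟨ha, hza⟩
      rcases key a ha hza with ⟨k', -⟩ | ⟨-, rfl⟩
      · exact absurd k'.2.1 (not_lt.2 k.1)
      · rfl

theorem tileable_brickwork_iff [Finite I] (hσ₀ : ∀ a b, K.TypedAt σ₀ a b) {G : Region} :
    Tileable K.tiles (brickwork (K.smallShift σ₀) G) ↔ ∃ σ, IsField K σ₀ G.cells σ := by
  refine ⟨?_, fun ⟨σ, h⟩ => h.tileable⟩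
  rintro ⟨P, hP, hsub, hcov⟩
  let Q : Set (Cell × ℤ × ℤ) :=
    {r | (K.IsBrick r.2 ∨ K.IsChip r.2) ∧ (boxTile r.2, r.1) ∈ P}
  have mem : ∀ r ∈ Q, ∀ z, z - r.1 ∈ (boxTile r.2).cells ↔ z ∈ boxCells r := fun r hr z =>
    mem_boxTile (BrickCode.dimensions_pos hr.1).1 (BrickCode.dimensions_pos hr.1).2
  have hmem : ∀ r ∈ Q, ∀ z ∈ boxCells r, z ∈ (brickwork (K.smallShift σ₀) G).cells := by
    intro r hr z hz
    have := hsub _ hr.2 _ ((mem r hr z).2 hz)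
    simpa using this
  refine BoxTiling.exists_isField (Q := Q) ⟨hσ₀, fun r hr z hz => ?_, fun z hz => ?_,
    fun r hr r' hr' z hz hz' => ?_, fun r hr => hr.1⟩
  · exact (mem_brickwork _).1 (hmem r hr z hz)
  · obtain ⟨a, ⟨ha, hza⟩, -⟩ := hcov z ((mem_brickwork _).2 hz)
    obtain ⟨w, hw, haw⟩ := K.mem_tiles.1 (hP a ha)
    have hr : (a.2, w) ∈ Q := ⟨hw, by rw [← haw]; exact ha⟩
    exact ⟨_, hr, (mem _ hr z).1 (by rw [← haw]; exact hza)⟩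
  · have := (hcov z (hmem r hr z hz)).unique ⟨hr.2, (mem r hr z).2 hz⟩
      ⟨hr'.2, (mem r' hr' z).2 hz'⟩
    rw [Prod.mk.injEq] at this
    obtain ⟨p₁, p₂⟩ := BrickCode.dimensions_pos hr.1
    obtain ⟨q₁, q₂⟩ := BrickCode.dimensions_pos hr'.1
    exact Prod.ext this.2 (boxTile_inj p₁ p₂ q₁ q₂ this.1)

end Field

/-! ### Guessing the neighbours of relational Wang tiles -/

/-- The directions to the right and up. -/
def ahead : Bool → Dir
  | false => .right
  | true => .up

theorem eq_ahead_or (d : Dir) : ∃ b, d = ahead b ∨ d = (ahead b).opp := by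
  cases d
  exacts [⟨false, Or.inl rfl⟩, ⟨true, Or.inl rfl⟩, ⟨false, Or.inr rfl⟩, ⟨true, Or.inr rfl⟩]

theorem RelWangSet.allowed_opp (W : RelWangSet) (d : Dir) (t t' : Fin W.n) :
    W.Allowed d.opp t t' ↔ W.Allowed d t' t := by
  cases d <;> rfl

/-- A tile, or a guess of the next tile, or, if marked by `true`, a tile on the boundary. -/
abbrev Mark (n : ℕ) : Type := Bool × Option (Fin n)

/-- The mark for the code of a side. -/
def markOfCode (n : ℕ) (b : Bool) (k : ℕ) : Mark n :=
  if h : 0 < k ∧ k ≤ n then (b, some ⟨k - 1, by omega⟩) else (false, none)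

theorem markOfCode_zero (n : ℕ) (b : Bool) : markOfCode n b 0 = (false, none) := by
  simp [markOfCode]

theorem markOfCode_succ {n : ℕ} (b : Bool) (k : Fin n) :
    markOfCode n b (k + 1) = (b, some k) := by
  have := k.isLt
  rw [markOfCode, dif_pos (by omega)]
  simp

/-- How the marks at two consecutive places may be related: with `false`, a tile is followed by a
guess of the next tile; with `true`, a guess is followed by the tile that was guessed, or a tile on
the boundary by a tile. -/
def Follows {n : ℕ} (R : Fin n → Fin n → Prop) : Bool → Mark n → Mark n → Prop
  | false, x, y => ∃ i j, x = (false, some i) ∧ y = (false, some j) ∧ R i j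
  | true, x, y => (∃ i, x = (false, some i) ∧ y = (false, some i)) ∨
      ∃ i j, x = (true, some i) ∧ y = (false, some j) ∧ R i j

/-- The mark that is prescribed between a cell and the next one. -/
def LabelledRegion.edgeMark {n : ℕ} (G : LabelledRegion (Fin n)) (p : Cell) (d : Dir) : Mark n :=
  if 0 < G.natCode p d then markOfCode n false (G.natCode p d)
  else markOfCode n true (G.natCode (p + d.vec) d.opp)

section EdgeMark

variable {n : ℕ} (G : LabelledRegion (Fin n)) {p : Cell} {d : Dir}

theorem LabelledRegion.edgeMark_of_mem (hp : p ∈ G.cells) :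
    G.edgeMark p d = markOfCode n false (G.natCode p d) := by
  unfold edgeMark
  split_ifs with h
  · rfl
  · have h' : G.natCode p d = 0 := by omega
    rw [h', markOfCode_zero, G.natCode_of_mem (by rwa [Dir.vec_add_opp]), markOfCode_zero]

theorem LabelledRegion.edgeMark_of_add_mem (hp : p + d.vec ∈ G.cells) :
    G.edgeMark p d = markOfCode n true (G.natCode (p + d.vec) d.opp) := by
  unfold edgeMark
  rw [if_neg (by rw [G.natCode_of_mem hp]; omega)]

theorem LabelledRegion.edgeMark_exit (hp : p ∈ G.cells) (h : p + d.vec ∉ G.cells) :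
    G.edgeMark p d = (false, some (G.label ⟨(p, d), hp, h⟩)) := by
  rw [G.edgeMark_of_mem hp, G.natCode_of_notMem hp h, markOfCode_succ]

theorem LabelledRegion.edgeMark_entry (hp : p ∈ G.cells) (h : p + d.opp.vec ∉ G.cells) :
    G.edgeMark (p - d.vec) d = (true, some (G.label ⟨(p, d.opp), hp, h⟩)) := by
  rw [G.edgeMark_of_add_mem (by rwa [sub_add_cancel]), sub_add_cancel,
    G.natCode_of_notMem hp h, markOfCode_succ]

end EdgeMark

/-- The marks `m` in the cells and `g` between each cell and the next one are a tiling together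
with correct guesses. -/
structure IsGuess (W : RelWangSet) (G : LabelledRegion (Fin W.n)) (m : Cell → Mark W.n)
    (g : Cell → Bool → Mark W.n) : Prop where
  off : ∀ p b, ¬ (p ∈ G.cells ∧ p + (ahead b).vec ∈ G.cells) → g p b = G.edgeMark p (ahead b)
  guess : ∀ p ∈ G.cells, ∀ b, Follows (W.Allowed (ahead b)) false (m p) (g p b)
  check : ∀ p ∈ G.cells, ∀ b, Follows (W.Allowed (ahead b)) true (g (p - (ahead b).vec) b) (m p)

/-- Between two cells of the region the intermediate mark was written as a guess by the first and is
compared for equality with the tile of the second. On leaving the region the guess is pinned to the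
boundary tile. On entering it, the flag `true` turns the comparison into the relation itself. -/
theorem IsGuess.relWangTileable {W : RelWangSet} {G : LabelledRegion (Fin W.n)}
    {m : Cell → Mark W.n} {g : Cell → Bool → Mark W.n} (h : IsGuess W G m g) :
    RelWangTileable W G := by
  have hm : ∀ p : {p // p ∈ G.cells}, ∃ i, m p.1 = (false, some i) := fun p => by
    obtain ⟨i, j, hi, -⟩ := h.guess p.1 p.2 false
    exact ⟨i, hi⟩
  choose φ hφ using hm
  have hg : ∀ (p : {p // p ∈ G.cells}) b, ∃ j, g p.1 b = (false, some j) ∧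
      W.Allowed (ahead b) (φ p) j := fun p b => by
    obtain ⟨i, j, hi, hj, hij⟩ := h.guess p.1 p.2 b
    rw [hφ p] at hi
    obtain rfl : φ p = i := by simpa using hi
    exact ⟨j, hj, hij⟩
  have key : ∀ (p q : {p // p ∈ G.cells}) b, q.1 = p.1 + (ahead b).vec →
      W.Allowed (ahead b) (φ p) (φ q) := by
    intro p q b hq
    obtain ⟨j, hj, hij⟩ := hg p b
    have := h.check q.1 q.2 b
    rw [hq, add_sub_cancel_right, hj, ← hq, hφ q] at this
    rcases this with ⟨i, h₁, h₂⟩ | ⟨i, j, h₁, -⟩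
    · simp only [Prod.mk.injEq, true_and, Option.some.injEq] at h₁ h₂
      rwa [h₂, ← h₁]
    · simp at h₁
  refine ⟨φ, fun p q d hq => ?_, ?_⟩
  · obtain ⟨b, rfl | rfl⟩ := eq_ahead_or d
    · exact key p q b hq
    · rw [W.allowed_opp]
      exact key q p b (by rw [hq, Dir.vec_opp]; abel)
  · rintro ⟨⟨p, d⟩, hp, hn⟩
    obtain ⟨b, rfl | rfl⟩ := eq_ahead_or d
    · obtain ⟨j, hj, hij⟩ := hg ⟨p, hp⟩ b
      have := h.off p b fun h' => hn h'.2
      simp only at hn hj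
      rw [this, G.edgeMark_exit hp hn] at hj
      obtain rfl : G.label ⟨(p, ahead b), hp, hn⟩ = j := by simpa using hj
      exact hij
    · have := h.check p hp b
      rw [h.off _ b fun h' => hn (by simpa [Dir.vec_opp, sub_eq_add_neg] using h'.1),
        G.edgeMark_entry hp hn, hφ ⟨p, hp⟩] at this
      simp only
      rw [W.allowed_opp]
      rcases this with ⟨i, h₁, -⟩ | ⟨i, j, h₁, h₂, hij⟩
      · simp at h₁
      · simp only [Prod.mk.injEq, true_and, Option.some.injEq] at h₁ h₂
        rwa [h₁, h₂]

open Classical in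
theorem exists_isGuess {W : RelWangSet} {G : LabelledRegion (Fin W.n)}
    (h : RelWangTileable W G) : ∃ m g, IsGuess W G m g ∧ ∀ p ∉ G.cells, m p = (false, none) := by
  obtain ⟨φ, hin, hbd⟩ := h
  refine ⟨fun p => if hp : p ∈ G.cells then (false, some (φ ⟨p, hp⟩)) else (false, none),
    fun p b => if hp : p ∈ G.cells ∧ p + (ahead b).vec ∈ G.cells then
      (false, some (φ ⟨_, hp.2⟩)) else G.edgeMark p (ahead b),
    ⟨fun p b hp => dif_neg hp, fun p hp b => ?_, fun p hp b => ?_⟩, fun p hp => dif_neg hp⟩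
  · rw [dif_pos hp]
    by_cases hq : p + (ahead b).vec ∈ G.cells
    · rw [dif_pos ⟨hp, hq⟩]
      exact ⟨_, _, rfl, rfl, hin ⟨p, hp⟩ ⟨_, hq⟩ (ahead b) rfl⟩
    · rw [dif_neg fun h => hq h.2, G.edgeMark_exit hp hq]
      exact ⟨_, _, rfl, rfl, hbd ⟨(p, ahead b), hp, hq⟩⟩
  · rw [dif_pos hp]
    by_cases hq : p - (ahead b).vec ∈ G.cells
    · rw [dif_pos ⟨hq, by rwa [sub_add_cancel]⟩]
      refine Or.inl ⟨φ ⟨p, hp⟩, ?_, rfl⟩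
      congr 3
      exact Subtype.ext (sub_add_cancel _ _)
    · have hq' : p + (ahead b).opp.vec ∉ G.cells := by rwa [Dir.vec_opp, ← sub_eq_add_neg]
      rw [dif_neg fun h => hq h.1, G.edgeMark_entry hp hq']
      exact Or.inr ⟨_, _, rfl, rfl, (W.allowed_opp _ _ _).1 (hbd ⟨(p, (ahead b).opp), hp, hq'⟩)⟩

/-! ### The code of a set of relational Wang tiles -/

theorem sum_four_pow_lt {m : Multiset ℕ} (hm : m.card ≤ 3) {a : ℕ} (h : ∀ b ∈ m, b < a) :
    (m.map fun b => 4 ^ b).sum < 4 ^ a := by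
  cases a with
  | zero =>
    obtain rfl : m = 0 := Multiset.eq_zero_of_forall_notMem fun b hb => by simpa using h b hb
    simp
  | succ a =>
    have := Multiset.sum_le_card_nsmul (m.map fun b => 4 ^ b) (4 ^ a) fun x hx => by
      obtain ⟨b, hb, rfl⟩ := Multiset.mem_map.1 hx
      exact Nat.pow_le_pow_right (by norm_num) (Nat.lt_succ_iff.1 (h b hb))
    rw [Multiset.card_map, smul_eq_mul] at this
    have h₁ : 0 < 4 ^ a := by positivity
    rw [pow_succ]
    nlinarith

/-- At most three powers of four can be recovered from their sum. -/
theorem eq_of_sum_four_pow_eq {k : ℕ} (hk : k ≤ 3) : ∀ {m m' : Multiset ℕ}, m.card = k →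
    m'.card = k → (m.map fun b => 4 ^ b).sum = (m'.map fun b => 4 ^ b).sum → m = m' := by
  induction k with
  | zero => exact fun h h' _ => (Multiset.card_eq_zero.1 h).trans (Multiset.card_eq_zero.1 h').symm
  | succ k ih =>
    intro m m' h h' hs
    have hmax : ∀ {m : Multiset ℕ}, m.card = k + 1 → ∃ a ∈ m, ∀ b ∈ m, b ≤ a := by
      intro m hm
      obtain ⟨a, ha, hle⟩ := m.toFinset.exists_max_image id
        (Multiset.toFinset_nonempty.2 fun h0 => by simp [h0] at hm)
      exact ⟨a, Multiset.mem_toFinset.1 ha, fun b hb => hle b (Multiset.mem_toFinset.2 hb)⟩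
    obtain ⟨a, ha, hle⟩ := hmax h
    obtain ⟨a', ha', hle'⟩ := hmax h'
    have sum_ge : ∀ {m : Multiset ℕ} {a : ℕ}, a ∈ m → 4 ^ a ≤ (m.map fun b => 4 ^ b).sum :=
      fun {m a} h => Multiset.single_le_sum (fun _ _ => Nat.zero_le _) _
        (Multiset.mem_map_of_mem (fun b => 4 ^ b) h)
    -- If the maxima differed, the larger power alone would exceed the other sum. Equal maxima are
    -- removed from both multisets.
    have e : a = a' := by
      rcases lt_trichotomy a a' with hlt | he | hlt
      · have := sum_four_pow_lt (by omega) fun b hb => (hle b hb).trans_lt hlt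
        have := sum_ge ha'
        omega
      · exact he
      · have := sum_four_pow_lt (by omega) fun b hb => (hle' b hb).trans_lt hlt
        have := sum_ge ha
        omega
    subst e
    obtain ⟨t, rfl⟩ := Multiset.exists_cons_of_mem ha
    obtain ⟨t', rfl⟩ := Multiset.exists_cons_of_mem ha'
    simp only [Multiset.card_cons, Multiset.map_cons, Multiset.sum_cons] at h h' hs
    rw [ih (m := t) (m' := t') (by omega) (by omega) (by omega) (by omega)]

/-- A mark together with the parities of its place. -/
abbrev PlacedMark (n : ℕ) : Type := Bool × Bool × Mark n

/-- The greatest number of a symbol. -/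
def codeBound (n : ℕ) : ℤ := 4 ^ Fintype.card (PlacedMark n)

/-- The scale of the bricks. -/
def brickScale (n : ℕ) : ℤ := 10 * codeBound n + 1

/-- The code for the tilings, with guesses, by relational Wang tiles. -/
noncomputable def guessCode (W : RelWangSet) :
    BrickCode (brickScale W.n) (codeBound W.n) (PlacedMark W.n) where
  shift i := 4 ^ (Fintype.equivFin (PlacedMark W.n) i : ℕ)
  xbit i := i.1
  ybit i := i.2.1
  -- Horizontal relations matter in even rows only, vertical ones in even columns only; the parity
  -- of the earlier place tells whether a tile is followed by its guess or a guess is checked.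
  H i j := i.1 ≠ j.1 ∧ i.2.1 = j.2.1 ∧
    (i.2.1 = false → Follows (W.Allowed (ahead false)) i.1 i.2.2 j.2.2)
  -- Chips relate a place to the one below, whereas guesses point upwards; hence the exchanged
  -- arguments.
  V i j := i.1 = j.1 ∧ i.2.1 ≠ j.2.1 ∧
    (i.1 = false → Follows (W.Allowed (ahead true)) j.2.1 j.2.2 i.2.2)
  lt := by unfold brickScale; omega
  shift_nonneg i := by positivity
  shift_le i := pow_le_pow_right₀ (by norm_num) (Fin.isLt _).le
  sum_eq {i j k i' j' k'} h := by
    refine Multiset.map_injective (f := fun i => (Fintype.equivFin (PlacedMark W.n) i : ℕ))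
      (fun i j h => (Fintype.equivFin _).injective (Fin.ext h)) ?_
    refine eq_of_sum_four_pow_eq le_rfl (by simp) (by simp) ?_
    have h' := h
    norm_cast at h'
    simpa [add_assoc] using h'
  H_bits h := ⟨h.1, h.2.1⟩
  V_bits h := ⟨h.1, h.2.1⟩

/-- The field with the marks `m` in the places with even coordinates and `g` in between. -/
def markField {n : ℕ} (m : Cell → Mark n) (g : Cell → Bool → Mark n) (a b : ℤ) : PlacedMark n :=
  (decide (a % 2 = 1), decide (b % 2 = 1),
    if a % 2 = 1 then if b % 2 = 1 then (false, none) else g (a / 2, b / 2) false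
    else if b % 2 = 1 then g (a / 2, b / 2) true else m (a / 2, b / 2))

section MarkField

variable {n : ℕ} (m : Cell → Mark n) (g : Cell → Bool → Mark n) (a b : ℤ)

theorem markField_even_even : markField m g (2 * a) (2 * b) = (false, false, m (a, b)) := by
  simp [markField]

theorem markField_odd_even :
    markField m g (2 * a + 1) (2 * b) = (true, false, g (a, b) false) := by
  have h₁ : (2 * a + 1) % 2 = 1 := by omega
  have h₂ : (2 * a + 1) / 2 = a := by omega
  simp [markField, h₁, h₂]

theorem markField_even_odd :
    markField m g (2 * a) (2 * b + 1) = (false, true, g (a, b) true) := by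
  have h₁ : (2 * b + 1) % 2 = 1 := by omega
  have h₂ : (2 * b + 1) / 2 = b := by omega
  simp [markField, h₁, h₂]

theorem markField_odd_odd :
    markField m g (2 * a + 1) (2 * b + 1) = (true, true, (false, none)) := by
  have h₁ : (2 * b + 1) % 2 = 1 := by omega
  have h₂ : (2 * a + 1) % 2 = 1 := by omega
  simp [markField, h₁, h₂]

theorem typedAt_markField {W : RelWangSet} (m : Cell → Mark W.n) (g : Cell → Bool → Mark W.n)
    (a b : ℤ) : (guessCode W).TypedAt (markField m g) a b := ⟨rfl, rfl⟩

end MarkField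

/-- The prescribed marks on the boundary of a labelled region. -/
def LabelledRegion.boundaryField {n : ℕ} (G : LabelledRegion (Fin n)) : ℤ → ℤ → PlacedMark n :=
  markField (fun _ => (false, none)) fun p b => G.edgeMark p (ahead b)

/-- The cell of which a cell is one quarter. -/
def half (z : Cell) : Cell := (z.1 / 2, z.2 / 2)

theorem half_eq_iff {z q : Cell} : half z = q ↔ z ∈ box (2 * q.1, 2 * q.2) 2 2 := by
  obtain ⟨a, b⟩ := q
  rw [mem_box, half, Prod.mk.injEq]
  simp only
  omega

theorem half_fibre_connected (q : Cell) : (grid.induce (half ⁻¹' {q})).Connected := by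
  have : half ⁻¹' {q} = box (2 * q.1, 2 * q.2) 2 2 := by
    ext z; exact half_eq_iff
  rw [this]
  exact box_connected (by norm_num) (by norm_num) _

theorem half_adj (q : Cell) (d : Dir) : ∃ z w, grid.Adj z w ∧ half z = q ∧ half w = q + d.vec := by
  obtain ⟨a, b⟩ := q
  cases d
  · exact ⟨(2 * a + 1, 2 * b), _, adj_vec _ .right, by
      simp only [half, Prod.mk.injEq]; omega, by
      simp only [half, Dir.vec, Prod.mk_add_mk, Prod.mk.injEq]; omega⟩
  · exact ⟨(2 * a, 2 * b + 1), _, adj_vec _ .up, by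
      simp only [half, Prod.mk.injEq]; omega, by
      simp only [half, Dir.vec, Prod.mk_add_mk, Prod.mk.injEq]; omega⟩
  · exact ⟨(2 * a, 2 * b), _, adj_vec _ .left, by
      simp only [half, Prod.mk.injEq]; omega, by
      simp only [half, Dir.vec, Prod.mk_add_mk, Prod.mk.injEq]; omega⟩
  · exact ⟨(2 * a, 2 * b), _, adj_vec _ .down, by
      simp only [half, Prod.mk.injEq]; omega, by
      simp only [half, Dir.vec, Prod.mk_add_mk, Prod.mk.injEq]; omega⟩

/-- The region with each cell divided into four. -/
noncomputable def Region.double (G : Region) : Region :=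
  have key : ((G.cells.biUnion fun q => box (2 * q.1, 2 * q.2) 2 2 : Finset Cell) : Set Cell) =
      half ⁻¹' G.cells := by
    ext z
    simp only [Finset.coe_biUnion, Set.mem_iUnion, Finset.mem_coe, ← half_eq_iff,
      Set.mem_preimage]
    simp
  { cells := G.cells.biUnion fun q => box (2 * q.1, 2 * q.2) 2 2
    connected := by
      rw [key]; exact connected_preimage half_fibre_connected half_adj G.connected
    noHoles := by
      rw [key, ← Set.preimage_compl]
      exact connected_preimage half_fibre_connected half_adj G.noHoles }

theorem Region.mem_double {G : Region} {z : Cell} : z ∈ G.double.cells ↔ half z ∈ G.cells := by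
  simp only [Region.double, Finset.mem_biUnion, ← half_eq_iff]
  simp

/-! ### Fields on the doubled region as tilings with guesses -/

section Field

variable {W : RelWangSet} {G : LabelledRegion (Fin W.n)}

theorem mem_double_of {a b A B : ℤ} (h₁ : a / 2 = A) (h₂ : b / 2 = B) :
    (a, b) ∈ G.double.cells ↔ (A, B) ∈ G.cells := by
  rw [Region.mem_double, half, h₁, h₂]

/-- The only delicate point is the mark on a boundary edge. Its place is pinned either because it
lies outside the region or because its wall also bounds the brick or chip of the next place, which
lies outside. -/
theorem IsField.isGuess {σ : ℤ → ℤ → PlacedMark W.n}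
    (h : IsField (guessCode W) G.boundaryField G.double.cells σ) :
    IsGuess W G (fun p => (σ (2 * p.1) (2 * p.2)).2.2)
      (fun p b => (σ (2 * p.1 + (ahead b).vec.1) (2 * p.2 + (ahead b).vec.2)).2.2) := by
  have bits : ∀ a b, (σ a b).1 = decide (a % 2 = 1) ∧ (σ a b).2.1 = decide (b % 2 = 1) := h.typed
  refine ⟨?_, ?_, ?_⟩
  · rintro ⟨A, B⟩ b hn
    cases b
    · have : σ (2 * A + 1) (2 * B) = G.boundaryField (2 * A + 1) (2 * B) := by
        by_cases hp : (A, B) ∈ G.cells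
        · have := (h.off (2 * A + 1 + 1) (2 * B) (by
            rw [mem_double_of (A := A + 1) (B := B) (by omega) (by omega)]
            exact fun h' => hn ⟨hp, by simpa [ahead, Dir.vec] using h'⟩)).2.1
          rwa [add_sub_cancel_right] at this
        · exact (h.off _ _ (by
            rwa [mem_double_of (A := A) (B := B) (by omega) (by omega)])).1
      simp only [ahead, Dir.vec, add_zero]
      rw [this, LabelledRegion.boundaryField, markField_odd_even]
      rfl
    · have : σ (2 * A) (2 * B + 1) = G.boundaryField (2 * A) (2 * B + 1) := by
        by_cases hp : (A, B) ∈ G.cells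
        · have := (h.off (2 * A) (2 * B + 1 + 1) (by
            rw [mem_double_of (A := A) (B := B + 1) (by omega) (by omega)]
            exact fun h' => hn ⟨hp, by simpa [ahead, Dir.vec] using h'⟩)).2.2
          rwa [add_sub_cancel_right] at this
        · exact (h.off _ _ (by
            rwa [mem_double_of (A := A) (B := B) (by omega) (by omega)])).1
      simp only [ahead, Dir.vec, add_zero]
      rw [this, LabelledRegion.boundaryField, markField_even_odd]
      rfl
  · rintro ⟨A, B⟩ hp b
    cases b
    · have := (h.H (2 * A + 1) (2 * B)
        ((mem_double_of (A := A) (B := B) (by omega) (by omega)).2 hp)).2.2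
      rw [add_sub_cancel_right, (bits _ _).1, (bits _ _).2] at this
      simpa [ahead, Dir.vec] using this
    · have := (h.V (2 * A) (2 * B + 1)
        ((mem_double_of (A := A) (B := B) (by omega) (by omega)).2 hp)).2.2
      rw [add_sub_cancel_right, (bits _ _).1, (bits _ _).2] at this
      simpa [ahead, Dir.vec] using this
  · rintro ⟨A, B⟩ hp b
    cases b
    · have := (h.H (2 * A) (2 * B)
        ((mem_double_of (A := A) (B := B) (by omega) (by omega)).2 hp)).2.2
      rw [(bits _ _).1, (bits _ _).2, show (2 * A - 1) % 2 = 1 by omega,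
        show 2 * A - 1 = 2 * (A - 1) + 1 by omega] at this
      simpa [ahead, Dir.vec] using this
    · have := (h.V (2 * A) (2 * B)
        ((mem_double_of (A := A) (B := B) (by omega) (by omega)).2 hp)).2.2
      rw [(bits _ _).1, (bits _ _).2, show (2 * B - 1) % 2 = 1 by omega,
        show 2 * B - 1 = 2 * (B - 1) + 1 by omega] at this
      simpa [ahead, Dir.vec] using this

theorem IsGuess.isField {m : Cell → Mark W.n} {g : Cell → Bool → Mark W.n}
    (h : IsGuess W G m g) (hm : ∀ p ∉ G.cells, m p = (false, none)) :
    IsField (guessCode W) G.boundaryField G.double.cells (markField m g) := by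
  have left : ∀ A : ℤ, 2 * A - 1 = 2 * (A - 1) + 1 := fun A => by omega
  have off₁ : ∀ A B, (A, B) ∉ G.cells → ∀ b, g (A, B) b = G.edgeMark (A, B) (ahead b) :=
    fun A B hn b => h.off _ _ fun h' => hn h'.1
  have off₂ : ∀ A B, (A, B) ∉ G.cells → g (A - 1, B) false = G.edgeMark (A - 1, B) (ahead false) :=
    fun A B hn => h.off _ _ fun h' => hn (by simpa [ahead, Dir.vec] using h'.2)
  have off₃ : ∀ A B, (A, B) ∉ G.cells → g (A, B - 1) true = G.edgeMark (A, B - 1) (ahead true) :=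
    fun A B hn => h.off _ _ fun h' => hn (by simpa [ahead, Dir.vec] using h'.2)
  refine ⟨fun a b => typedAt_markField m g a b, fun a b hn => ?_, fun a b hp => ?_,
    fun a b hp => ?_⟩
  · unfold LabelledRegion.boundaryField
    obtain ⟨A, rfl | rfl⟩ := Int.even_or_odd' a <;> obtain ⟨B, rfl | rfl⟩ := Int.even_or_odd' b <;>
      rw [mem_double_of (A := A) (B := B) (by omega) (by omega)] at hn <;>
      simp only [left, add_sub_cancel_right, markField_even_even, markField_odd_even,
        markField_even_odd, markField_odd_odd, hm _ hn, off₁ _ _ hn, off₂ _ _ hn, off₃ _ _ hn,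
        and_self]
  · refine ⟨?_, rfl, fun hb => ?_⟩
    · change decide _ ≠ decide _
      rw [decide_odd_sub_one]
      simp
    · obtain ⟨A, rfl | rfl⟩ := Int.even_or_odd' a <;>
        obtain ⟨B, rfl | rfl⟩ := Int.even_or_odd' b <;>
        rw [mem_double_of (A := A) (B := B) (by omega) (by omega)] at hp
      · rw [left, markField_odd_even, markField_even_even]
        simpa [ahead, Dir.vec] using h.check _ hp false
      · rw [left, markField_odd_odd] at hb
        simp at hb
      · rw [add_sub_cancel_right, markField_odd_even, markField_even_even]
        exact h.guess _ hp false
      · rw [add_sub_cancel_right, markField_even_odd] at hb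
        simp at hb
  · refine ⟨rfl, ?_, fun hb => ?_⟩
    · change decide _ ≠ decide _
      rw [decide_odd_sub_one]
      simp
    · obtain ⟨A, rfl | rfl⟩ := Int.even_or_odd' a <;>
        obtain ⟨B, rfl | rfl⟩ := Int.even_or_odd' b <;>
        rw [mem_double_of (A := A) (B := B) (by omega) (by omega)] at hp
      · rw [left, markField_even_odd, markField_even_even]
        simpa [ahead, Dir.vec] using h.check _ hp true
      · rw [add_sub_cancel_right, markField_even_odd, markField_even_even]
        exact h.guess _ hp true
      · rw [markField_odd_even] at hb
        simp at hb
      · rw [markField_odd_odd] at hb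
        simp at hb

/-- The brickwork that encodes a tileability problem for relational Wang tiles. -/
noncomputable def relBrickwork (W : RelWangSet) (G : LabelledRegion (Fin W.n)) : Region :=
  brickwork ((guessCode W).smallShift G.boundaryField) G.double

theorem tileable_relBrickwork_iff :
    Tileable (guessCode W).tiles (relBrickwork W G) ↔ RelWangTileable W G := by
  refine (tileable_brickwork_iff (σ₀ := G.boundaryField) (typedAt_markField _ _)).trans ?_
  constructor
  · rintro ⟨σ, h⟩
    exact h.isGuess.relWangTileable
  · intro h
    obtain ⟨m, g, hg, hm⟩ := exists_isGuess h
    exact ⟨_, hg.isField hm⟩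

end Field

/-! ### Local computation of the brickwork -/

section Local

variable {n : ℕ}

/-- The prescribed marks near the cell at the origin, given the codes of its sides. -/
def localField (n : ℕ) (c : Dir → ℕ) : ℤ → ℤ → PlacedMark n :=
  markField (fun _ => (false, none)) fun q b =>
    if q = 0 then markOfCode n false (c (ahead b)) else markOfCode n true (c (ahead b).opp)

/-- For an edge of a cell of the region the prescribed mark depends on the code of that cell alone,
even if the place of the mark belongs to the left or lower neighbour. So the walls around its four
quarters can be found from its own record. -/
theorem LabelledRegion.boundaryField_eq_localField (G : LabelledRegion (Fin n)) {A B : ℤ}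
    (h : (A, B) ∈ G.cells) {a b : ℤ} (ha : a = 0 ∨ a = 1) (hb : b = 0 ∨ b = 1) :
    G.boundaryField (2 * A + a) (2 * B + b) = localField n (G.natCode (A, B)) a b ∧
      G.boundaryField (2 * A + a - 1) (2 * B + b) = localField n (G.natCode (A, B)) (a - 1) b ∧
      G.boundaryField (2 * A + a) (2 * B + b - 1) = localField n (G.natCode (A, B)) a (b - 1) := by
  have ee : G.boundaryField (2 * A) (2 * B) = localField n (G.natCode (A, B)) 0 0 := by
    unfold boundaryField localField
    rw [markField_even_even]
    simp [markField]
  have oe : G.boundaryField (2 * A + 1) (2 * B) = localField n (G.natCode (A, B)) 1 0 := by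
    unfold boundaryField localField
    rw [markField_odd_even, G.edgeMark_of_mem h]
    simp [markField]
  have eo : G.boundaryField (2 * A) (2 * B + 1) = localField n (G.natCode (A, B)) 0 1 := by
    unfold boundaryField localField
    rw [markField_even_odd, G.edgeMark_of_mem h]
    simp [markField]
  have oo : ∀ i j : ℤ, G.boundaryField (2 * (A + i) + 1) (2 * (B + j) + 1) =
      localField n (G.natCode (A, B)) (2 * i + 1) (2 * j + 1) := fun i j => by
    unfold boundaryField localField
    rw [markField_odd_odd, markField_odd_odd]
  have left : G.boundaryField (2 * A - 1) (2 * B) = localField n (G.natCode (A, B)) (-1) 0 := by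
    unfold boundaryField localField
    rw [show 2 * A - 1 = 2 * (A - 1) + 1 by omega, markField_odd_even,
      G.edgeMark_of_add_mem (by simpa [ahead, Dir.vec] using h)]
    refine Eq.trans ?_ (markField_odd_even _ _ (-1) 0).symm
    simp [ahead, Dir.vec]
  have down : G.boundaryField (2 * A) (2 * B - 1) = localField n (G.natCode (A, B)) 0 (-1) := by
    unfold boundaryField localField
    rw [show 2 * B - 1 = 2 * (B - 1) + 1 by omega, markField_even_odd,
      G.edgeMark_of_add_mem (by simpa [ahead, Dir.vec] using h)]
    refine Eq.trans ?_ (markField_even_odd _ _ 0 (-1)).symm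
    simp [ahead, Dir.vec]
  have oo₀ := oo 0 0
  have oo₁ := oo (-1) 0
  have oo₂ := oo 0 (-1)
  rw [show 2 * (A + -1) + 1 = 2 * A - 1 by omega] at oo₁
  rw [show 2 * (B + -1) + 1 = 2 * B - 1 by omega] at oo₂
  norm_num at oo₀ oo₁ oo₂
  rcases ha with rfl | rfl <;> rcases hb with rfl | rfl <;>
    simp only [add_zero, add_sub_cancel_right, zero_sub, sub_self, ee, oe, eo, left, down, oo₀, oo₁,
      oo₂, and_self]

end Local

section Pieces

variable {u : ℤ}

/-- The displacement of the bricks of the quarters of a cell. -/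
def brickOffset (u : ℤ) (p : Cell) : Cell := (6 * u * p.1 - 4 * u * p.2, 5 * p.1 + 8 * p.2)

/-- The column is shifted by an even number, so the rounding in `base` is unaffected and the pieces
of a cell are moved by an exact translation, linear in its coordinates. -/
theorem base_two_mul_add (A B a b : ℤ) :
    base (2 * A + a) (2 * B + b) = base a b + (5 * A + 8 * B) := by
  unfold base; omega

/-- The bricks and chips of the quarters of a cell are translates of those at the origin with the
same displacements of the walls. -/
theorem inBrick_or_inChip_translate {d d' : ℤ → ℤ → ℤ} {A B a b : ℤ}
    (h₁ : d (2 * A + a) (2 * B + b) = d' a b)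
    (h₂ : d (2 * A + a - 1) (2 * B + b) = d' (a - 1) b)
    (h₃ : d (2 * A + a) (2 * B + b - 1) = d' a (b - 1)) (w : Cell) :
    (InBrick u d (2 * A + a) (2 * B + b) (w + brickOffset u (A, B)).1
        (w + brickOffset u (A, B)).2 ∨
      InChip u d (2 * A + a) (2 * B + b) (w + brickOffset u (A, B)).1
        (w + brickOffset u (A, B)).2) ↔
      (InBrick u d' a b w.1 w.2 ∨ InChip u d' a b w.1 w.2) := by
  have k₁ : wall u d (2 * A + a) (2 * B + b) = wall u d' a b + (brickOffset u (A, B)).1 := by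
    simp only [wall, h₁, brickOffset]; ring
  have k₂ : wall u d (2 * A + a - 1) (2 * B + b) =
      wall u d' (a - 1) b + (brickOffset u (A, B)).1 := by
    simp only [wall, h₂, brickOffset]; ring
  have k₃ : wall u d (2 * A + a) (2 * B + b - 1) =
      wall u d' a (b - 1) + (brickOffset u (A, B)).1 := by
    simp only [wall, h₃, brickOffset]; ring
  have k₄ := base_two_mul_add A B a b
  have k₅ := base_two_mul_add A B (a + 1) b
  rw [← add_assoc] at k₅
  have k₆ : (brickOffset u (A, B)).2 = 5 * A + 8 * B := rfl
  unfold InBrick InChip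
  simp only [Prod.fst_add, Prod.snd_add]
  omega

end Pieces

section Compute

variable (W : RelWangSet)

/-- The bricks and chips of the quarters of the cell at the origin, given the codes of its
sides. -/
noncomputable def quarterPieces (c : Dir → ℕ) : Finset Cell :=
  (box 0 2 2).biUnion fun q =>
    boxCells (brickBox (brickScale W.n) ((guessCode W).shifts (localField W.n c)) q) ∪
      boxCells (chipBox (brickScale W.n) ((guessCode W).shifts (localField W.n c)) q)

theorem mem_quarterPieces_iff (G : LabelledRegion (Fin W.n)) {p : Cell} (hp : p ∈ G.cells)
    (w : Cell) : w ∈ quarterPieces W (G.natCode p) ↔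
      half (holder (brickScale W.n) ((guessCode W).shifts G.boundaryField)
        (w + brickOffset (brickScale W.n) p)) = p := by
  obtain ⟨A, B⟩ := p
  have key : ∀ q ∈ box 0 2 2,
      (w ∈ boxCells (brickBox (brickScale W.n)
          ((guessCode W).shifts (localField W.n (G.natCode (A, B)))) q) ∪
        boxCells (chipBox (brickScale W.n)
          ((guessCode W).shifts (localField W.n (G.natCode (A, B)))) q) ↔
      holder (brickScale W.n) ((guessCode W).shifts G.boundaryField)
        (w + brickOffset (brickScale W.n) (A, B)) = (2 * A + q.1, 2 * B + q.2)) := by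
    rintro ⟨a, b⟩ hq
    rw [mem_box] at hq
    simp only [Prod.fst_zero, Prod.snd_zero] at hq
    obtain ⟨e₁, e₂, e₃⟩ := G.boundaryField_eq_localField hp
      (show a = 0 ∨ a = 1 by omega) (show b = 0 ∨ b = 1 by omega)
    rw [Finset.mem_union, mem_brickBox, mem_chipBox,
      ((guessCode W).smallShift G.boundaryField).holder_eq_iff]
    exact (inBrick_or_inChip_translate (by simp only [BrickCode.shifts, e₁])
      (by simp only [BrickCode.shifts, e₂]) (by simp only [BrickCode.shifts, e₃]) w).symm
  rw [quarterPieces, Finset.mem_biUnion, half_eq_iff]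
  constructor
  · rintro ⟨q, hq, h⟩
    rw [(key q hq).1 h]
    rw [mem_box] at hq ⊢
    simp only [Prod.fst_zero, Prod.snd_zero] at hq ⊢
    omega
  · intro h
    generalize hz : holder (brickScale W.n) ((guessCode W).shifts G.boundaryField)
      (w + brickOffset (brickScale W.n) (A, B)) = z at h
    rw [mem_box] at h
    have hq : (z.1 - 2 * A, z.2 - 2 * B) ∈ box 0 2 2 := by
      rw [mem_box]
      simp only [Prod.fst_zero, Prod.snd_zero] at h ⊢
      omega
    refine ⟨_, hq, (key _ hq).2 ?_⟩
    rw [hz]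
    simp

/-- The affine forms of the coordinates of the brickwork of a cell. -/
noncomputable def brickForms (c : Dir → ℕ) : List (ℤ × ℤ × ℤ) :=
  (quarterPieces W c).toList.flatMap fun w =>
    [(6 * brickScale W.n, -(4 * brickScale W.n), w.1), (5, 8, w.2)]

theorem linearTimeComputable_relBrickwork (T : Finset Tile) :
    LinearTimeComputable (relWangProblem W) (tileProblem T) (relBrickwork W) := by
  refine linearTimeComputable_of_transducer (B := tileProblem T) (relBrickwork W)
    (brickForms W) ?_
  intro G L hL hm
  have := describes_preimage (G := relBrickwork W G) (S := G.cells)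
    (own := fun z => half (holder (brickScale W.n) ((guessCode W).shifts G.boundaryField) z))
    (F := fun p => (quarterPieces W (G.natCode p)).toList.map
      (· + brickOffset (brickScale W.n) p))
    (fun p _ => (Finset.nodup_toList _).map (add_left_injective _))
    (fun p hp z => by
      rw [List.mem_map]
      constructor
      · rintro ⟨w, hw, rfl⟩
        exact (mem_quarterPieces_iff W G hp w).1 (Finset.mem_toList.1 hw)
      · intro hz
        refine ⟨z - brickOffset (brickScale W.n) p, Finset.mem_toList.2 ?_, sub_add_cancel _ _⟩
        rw [mem_quarterPieces_iff W G hp, sub_add_cancel]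
        exact hz)
    (fun z => (mem_brickwork _).trans Region.mem_double) hL hm
  change (relBrickwork W G).Describes _
  convert this using 1
  refine List.flatMap_congr fun p hp => ?_
  rw [brickForms, List.map_flatMap, List.flatMap_map]
  refine List.flatMap_congr fun w _ => ?_
  simp [affine, brickOffset]
  constructor <;> ring

end Compute

theorem relationalWangTiles_reducible_rectangles :
    LinearTimeReducible relationalWangTiles rectangles := fun W =>
  ⟨⟨(guessCode W).tiles, fun _ => (guessCode W).isRectangle_of_mem_tiles⟩, relBrickwork W,
    linearTimeComputable_relBrickwork W _, fun _ => tileable_relBrickwork_iff.symm⟩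

/-! ### Closing the cycle of reductions -/

theorem LinearTimeReducibleSameCard.reducible {A B : TileabilityClass}
    (h : LinearTimeReducibleSameCard A B) : LinearTimeReducible A B := fun T => by
  obtain ⟨T', f, -, hf⟩ := h T
  exact ⟨T', f, hf⟩

/-- All five classes are reducible to each other, along a cycle of reductions. -/
theorem linearTimeReducible_of_mem {A B : TileabilityClass}
    (hA : A ∈ [rectangles, ordinaryTiles, generalizedWangTiles, ordinaryWangTiles,
      relationalWangTiles])
    (hB : B ∈ [rectangles, ordinaryTiles, generalizedWangTiles, ordinaryWangTiles,
      relationalWangTiles]) : LinearTimeReducible A B := by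
  have s₁ : ∀ T l G, (rectangles.problem T).Describes l G →
      (rectangles.problem T).size G ≤ l.length := fun T l G h => Region.Describes.card_le h
  have s₂ : ∀ T l G, (ordinaryTiles.problem T).Describes l G →
      (ordinaryTiles.problem T).size G ≤ l.length := fun T l G h => Region.Describes.card_le h
  have s₃ : ∀ T l G, (generalizedWangTiles.problem T).Describes l G →
      (generalizedWangTiles.problem T).size G ≤ l.length :=
    fun T l G h => LabelledRegion.Describes.card_le h
  have s₄ : ∀ T l G, (ordinaryWangTiles.problem T).Describes l G →
      (ordinaryWangTiles.problem T).size G ≤ l.length :=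
    fun T l G h => LabelledRegion.Describes.card_le h
  have s₅ : ∀ T l G, (relationalWangTiles.problem T).Describes l G →
      (relationalWangTiles.problem T).size G ≤ l.length :=
    fun T l G h => LabelledRegion.Describes.card_le h
  have h₂ := rectangles_reducible_ordinaryTiles
  have h₃ := h₂.trans s₂ ordinaryTiles_reducible_generalizedWangTiles.reducible
  have h₄ := h₃.trans s₃ generalizedWangTiles_reducible_ordinaryWangTiles
  have h₅ := h₄.trans s₄ ordinaryWangTiles_reducible_relationalWangTiles
  have k₅ := relationalWangTiles_reducible_rectangles
  have k₄ := ordinaryWangTiles_reducible_relationalWangTiles.trans s₅ k₅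
  have k₃ := generalizedWangTiles_reducible_ordinaryWangTiles.trans s₄ k₄
  have k₂ := ordinaryTiles_reducible_generalizedWangTiles.reducible.trans s₃ k₃
  have h₁ := h₂.trans s₂ k₂
  have to_rect : LinearTimeReducible A rectangles := by
    simp only [List.mem_cons, List.not_mem_nil, or_false] at hA
    rcases hA with rfl | rfl | rfl | rfl | rfl
    exacts [h₁, k₂, k₃, k₄, k₅]
  have from_rect : LinearTimeReducible rectangles B := by
    simp only [List.mem_cons, List.not_mem_nil, or_false] at hB
    rcases hB with rfl | rfl | rfl | rfl | rfl
    exacts [h₁, h₂, h₃, h₄, h₅]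
  exact to_rect.trans s₁ from_rect

end Tileability

theorem lemma3p1 :
    List.Pairwise Tileability.LinearTimeEquivalent
      [Tileability.rectangles, Tileability.ordinaryTiles, Tileability.generalizedWangTiles,
        Tileability.ordinaryWangTiles, Tileability.relationalWangTiles] ∧
    Tileability.LinearTimeReducibleSameCard
      Tileability.ordinaryTiles Tileability.generalizedWangTiles ∧
    Tileability.LinearTimeReducibleSameCard
      Tileability.generalizedWangTiles Tileability.ordinaryTiles := by
  refine ⟨?_, Tileability.ordinaryTiles_reducible_generalizedWangTiles,
    Tileability.generalizedWangTiles_reducible_ordinaryTiles⟩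
  exact List.pairwise_iff_forall_sublist.2 fun {A B} h => by
    have hA := h.subset (List.mem_cons_self)
    have hB := h.subset (List.mem_cons_of_mem _ (List.mem_cons_self))
    exact ⟨Tileability.linearTimeReducible_of_mem hA hB,
      Tileability.linearTimeReducible_of_mem hB hA⟩
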